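/- **Theorem.** Let $\gamma,\lambda,\mu>0$ and $\omega\in\mathbb R$. Let $Q=H^1(\mathbb R^+)\oplus H^1(\mathbb R^-)$ (complex-valued functions, identified when equal almost everywhere). For $\psi\in Q$ let $\psi(0\pm)$ be its one-sided boundary values at the origin, let $\psi'$ be its weak derivative on $\mathbb R\setminus\{0\}$, and put $$S_\omega(\psi)=\tfrac12\|\psi'\|_2^2+\tfrac\omega2\|\psi\|_2^2-\tfrac1{2\gamma}|\psi(0+)-\psi(0-)|^2-\tfrac{\lambda}{2\mu+2}\|\psi\|_{2\mu+2}^{2\mu+2},$$ $$I_\omega(\psi)=\|\psi'\|_2^2+\omega\|\psi\|_2^2-\tfrac1{\gamma}|\psi(0+)-\psi(0-)|^2-\lambda\|\psi\|_{2\mu+2}^{2\mu+2}.$$ A *ground state* at frequency $\omega$ is a minimizer of $S_\omega$ on $\{\psi\in Q\setminus\{0\}: I_\omega(\psi)=0\}$. For $\omega>0$ and $x_0,x_1,x_2,\theta\in\mathbb R$ let $$\phi_\omega^{x_0}(x)=\lambda^{-\frac1{2\mu}}(\mu+1)^{\frac1{2\mu}}\omega^{\frac1{2\mu}}\operatorname{sech}^{\frac1\mu}\!\big[\mu\sqrt\omega\,(x-x_0)\big],\qquad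 \psi_\omega^{x_1,x_2,\theta}(x)=\begin{cases}-e^{i\theta}\phi_\omega^{x_1}(x),&x<0,\\ \phantom{-}e^{i\theta}\phi_\omega^{x_2}(x),&x>0.\end{cases}$$ Let $\omega_0=\frac4{\gamma^2}$ and $\omega^*=\frac{4(\mu+1)}{\gamma^2\mu}$. 1. If $\omega_0<\omega\le\omega^*$, then the set of ground states is exactly $\{\psi_\omega^{y,-y,\theta}:\theta\in\mathbb R\}$, where $$y=\frac1{2\mu\sqrt\omega}\log\frac{\gamma\sqrt\omega+2}{\gamma\sqrt\omega-2};$$ these functions are odd on $\mathbb R\setminus\{0\}$. 2. If $\omega>\omega^*$, then the system $$t_1^{2\mu}-t_1^{2\mu+2}=t_2^{2\mu}-t_2^{2\mu+2},\qquad t_1^{-1}+t_2^{-1}=\gamma\sqrt\omega$$ has exactly one solution $(t_1,t_2)$ with $0<t_1<t_2<1$. With this solution and $$y_i=\frac1{2\mu\sqrt\omega}\log\left|\frac{1+t_i}{1-t_i}\right|\qquad(i=1,2),$$ one has $0<y_1<y_2$, and the set of ground states is exactly $$\{\psi_\omega^{y_1,-y_2,\theta}:\theta\in\mathbb R\}\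 \cup\ \{\psi_\omega^{y_2,-y_1,\theta}:\theta\in\mathbb R\},$$ the two families being disjoint. Thus, up to a phase, there are exactly two ground states, and neither is symmetric. -/

import Mathlib

open MeasureTheory Set Filter Topology

noncomputable section

namespace DeltaPrimeNLS

/-- `g` is a weak derivative of `ψ` on the open set `U ⊆ ℝ`. -/
def IsWeakDerivOn (U : Set ℝ) (ψ g : ℝ → ℂ) : Prop :=
  ∀ η : ℝ → ℝ, ContDiff ℝ (⊤ : ℕ∞) η → HasCompactSupport η → tsupport η ⊆ U →
    ∫ x in U, deriv η x • ψ x = -∫ x in U, η x • g x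

/-- The Sobolev space `H¹(U)`: `ψ` is square integrable on `U` and has a square integrable
weak derivative there. -/
def MemH1 (U : Set ℝ) (ψ : ℝ → ℂ) : Prop :=
  MemLp ψ 2 (volume.restrict U) ∧
    ∃ g : ℝ → ℂ, MemLp g 2 (volume.restrict U) ∧ IsWeakDerivOn U ψ g

open Classical in
/-- The square integrable weak derivative of `ψ ∈ H¹(U)` (unique up to null sets, see
`IsWeakDerivOn.ae_eq`); zero if there is none. -/
def weakDeriv (U : Set ℝ) (ψ : ℝ → ℂ) : ℝ → ℂ :=
  if h : ∃ g : ℝ → ℂ, MemLp g 2 (volume.restrict U) ∧ IsWeakDerivOn U ψ g then h.choose else 0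

theorem IsWeakDerivOn.ae_eq {U : Set ℝ} (hU : IsOpen U) {ψ g₁ g₂ : ℝ → ℂ}
    (hg₁ : MemLp g₁ 2 (volume.restrict U)) (hg₂ : MemLp g₂ 2 (volume.restrict U))
    (h₁ : IsWeakDerivOn U ψ g₁) (h₂ : IsWeakDerivOn U ψ g₂) :
    g₁ =ᵐ[volume.restrict U] g₂ := by
  have hl : ∀ g : ℝ → ℂ, MemLp g 2 (volume.restrict U) → LocallyIntegrableOn g U volume := by
    intro g hg
    exact locallyIntegrableOn_of_locallyIntegrable_restrict
      (hg.locallyIntegrable (by norm_num))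
  have key := hU.ae_eq_zero_of_integral_contDiff_smul_eq_zero (μ := volume) (f := g₁ - g₂)
    ((hl g₁ hg₁).sub (hl g₂ hg₂)) (by
      intro η hη hc hs
      have hout : ∀ x ∉ U, η x = 0 := fun x hx =>
        image_eq_zero_of_notMem_tsupport fun h => hx (hs h)
      have hm : MemLp η 2 (volume.restrict U) :=
        (hη.continuous.memLp_of_hasCompactSupport hc).restrict U
      have e := (h₁ η hη hc hs).symm.trans (h₂ η hη hc hs)
      rw [neg_inj] at e
      rw [← setIntegral_eq_integral_of_forall_compl_eq_zero (s := U)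
        (fun x hx => by simp [hout x hx])]
      have hi : ∀ g : ℝ → ℂ, MemLp g 2 (volume.restrict U) →
          Integrable (fun x => η x • g x) (volume.restrict U) := fun g hg =>
        memLp_one_iff_integrable.1 (hg.smul hm)
      simp only [Pi.sub_apply, smul_sub]
      rw [integral_sub (hi g₁ hg₁) (hi g₂ hg₂), e, sub_self])
  rw [Filter.EventuallyEq, ae_restrict_iff' hU.measurableSet]
  filter_upwards [key] with x hx hxU
  exact sub_eq_zero.1 (hx hxU)

/-- The energy space `Q = H¹(ℝ⁺) ⊕ H¹(ℝ⁻)`; its elements are represented by functions on `ℝ`,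
two functions that agree almost everywhere being the same element. -/
def energySpace : Set (ℝ → ℂ) := {ψ | MemH1 (Ioi 0) ψ ∧ MemH1 (Iio 0) ψ}

/-- The boundary value `ψ(0+)`: the limit of `ψ x` as `x → 0` through `x > 0`, up to null sets
(for `ψ ∈ Q`, the value at `0` of the continuous representative on the right half-line). -/
def rightValue (ψ : ℝ → ℂ) : ℂ := limUnder (𝓝[>] (0 : ℝ) ⊓ ae volume) ψ

/-- The boundary value `ψ(0-)`. -/
def leftValue (ψ : ℝ → ℂ) : ℂ := limUnder (𝓝[<] (0 : ℝ) ⊓ ae volume) ψ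

/-- `‖ψ'‖²`, the derivative being taken away from the origin. -/
def derivNormSq (ψ : ℝ → ℂ) : ℝ :=
  (∫ x in Ioi (0 : ℝ), ‖weakDeriv (Ioi 0) ψ x‖ ^ 2) +
    ∫ x in Iio (0 : ℝ), ‖weakDeriv (Iio 0) ψ x‖ ^ 2

/-- The mass `M(ψ) = ‖ψ‖²`. -/
def mass (ψ : ℝ → ℂ) : ℝ := ∫ x, ‖ψ x‖ ^ 2

/-- `‖ψ‖_{2μ+2}^{2μ+2}`. -/
def powerNorm (μ : ℝ) (ψ : ℝ → ℂ) : ℝ := ∫ x, ‖ψ x‖ ^ (2 * μ + 2)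

/-- The quadratic form `F_γ` of the attractive `δ'` interaction of strength `γ`. -/
def formF (γ : ℝ) (ψ : ℝ → ℂ) : ℝ :=
  derivNormSq ψ - γ⁻¹ * ‖rightValue ψ - leftValue ψ‖ ^ 2

/-- The energy `E`. -/
def energy (γ lam μ : ℝ) (ψ : ℝ → ℂ) : ℝ :=
  1 / 2 * formF γ ψ - lam / (2 * μ + 2) * powerNorm μ ψ

/-- The action `S_ω = E + (ω/2) M`. -/
def action (γ lam μ ω : ℝ) (ψ : ℝ → ℂ) : ℝ :=
  energy γ lam μ ψ + ω / 2 * mass ψ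

/-- The Nehari functional `I_ω`. -/
def nehari (γ lam μ ω : ℝ) (ψ : ℝ → ℂ) : ℝ :=
  formF γ ψ + ω * mass ψ - lam * powerNorm μ ψ

/-- The nonzero elements of `Q` with `I_ω = 0`. -/
def nehariManifold (γ lam μ ω : ℝ) : Set (ℝ → ℂ) :=
  {ψ | ψ ∈ energySpace ∧ ¬ ψ =ᵐ[volume] 0 ∧ nehari γ lam μ ω ψ = 0}

/-- The ground states: the minimizers of the action on the Nehari manifold. -/
def groundStates (γ lam μ ω : ℝ) : Set (ℝ → ℂ) :=
  {ψ | ψ ∈ nehariManifold γ lam μ ω ∧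
    ∀ φ ∈ nehariManifold γ lam μ ω, action γ lam μ ω ψ ≤ action γ lam μ ω φ}

/-- The soliton `φ_ω^{x₀}` of the free equation. -/
def soliton (lam μ ω x₀ x : ℝ) : ℝ :=
  lam ^ (-(1 / (2 * μ))) * (μ + 1) ^ (1 / (2 * μ)) * ω ^ (1 / (2 * μ)) *
    (Real.cosh (μ * √ω * (x - x₀)))⁻¹ ^ (1 / μ)

/-- The function `ψ_ω^{x₁,x₂,θ}` (its value at the origin is irrelevant). -/
def boundState (lam μ ω x₁ x₂ θ x : ℝ) : ℂ :=
  if x < 0 then -(Complex.exp (θ * Complex.I) * soliton lam μ ω x₁ x)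
  else Complex.exp (θ * Complex.I) * soliton lam μ ω x₂ x

/-- The orbit under phase multiplication of `ψ_ω^{x₁,x₂,0}`, as a subset of `Q`: all functions
that agree almost everywhere with `ψ_ω^{x₁,x₂,θ}` for some `θ`. -/
def phaseOrbit (lam μ ω x₁ x₂ : ℝ) : Set (ℝ → ℂ) :=
  {ψ | ∃ θ : ℝ, ψ =ᵐ[volume] boundState lam μ ω x₁ x₂ θ}

/-- `(t₁, t₂)`, with `0 < t₁ < t₂ < 1`, solves the matching system. -/
def SolvesSystem (γ μ ω t₁ t₂ : ℝ) : Prop :=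
  0 < t₁ ∧ t₁ < t₂ ∧ t₂ < 1 ∧
    t₁ ^ (2 * μ) - t₁ ^ (2 * μ + 2) = t₂ ^ (2 * μ) - t₂ ^ (2 * μ + 2) ∧
    t₁⁻¹ + t₂⁻¹ = γ * √ω

/-- The bifurcation frequency `ω*`. -/
def omegaStar (γ μ : ℝ) : ℝ := 4 * (μ + 1) / (γ ^ 2 * μ)

/-- The point `y > 0` with `tanh (μ √ω y) = t`, for `t ∈ (0, 1)`. -/
def centre (μ ω t : ℝ) : ℝ := 1 / (2 * μ * √ω) * Real.log |(1 + t) / (1 - t)|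

end DeltaPrimeNLS

end

open DeltaPrimeNLS

noncomputable section

/-! On the Nehari manifold the action is a positive multiple of the power norm `N`, so the ground
states are the minimizers of `N` there. The problem splits at the origin into two half-line
problems, coupled only through the jump.

Put `k = √ω` and `B = (μ+1)ω/lam`. A decreasing soliton tail on a half-line is determined up to
phase by its normalized logarithmic slope `t ∈ (0,1)` at the end point; `M(t)` (`tailMass`) denotes
its power norm. The analytic core is a sharp inequality (`HalfLineH1.tailMass_le_action`): if `f`
has power norm `M(t)` on the half-line, then `‖f'‖² + k²‖f‖² ≥ lam M(t) + k t |f(0)|²`, and for `t <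
1` only soliton tails give equality (`HalfLineH1.eq_tailProfile_of_equality`). It is proved by
calibration, with no appeal to existence of minimizers. At each `x` let `s(x)` be the slope of the
tail whose power norm equals what `f` still has beyond `x`. A suitable function of `s(x)` and
`|f(x)|`, the `potential`, has as derivative a non-negative `deficit` minus the action density
(`HalfLinePrimitive.integral_deficit`). The deficit is a square plus a Bernoulli gap, and its
vanishing forces the soliton's first-order equation.

For gluing, write `A = γ√ω/2` and pair the slopes `(A+d)⁻¹` and `(A-d)⁻¹`, whose inverses add up to
`γ√ω`. By Cauchy-Schwarz the two boundary terms `k t |f(0)|²` then dominate the jump term. Given `ψ`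
on the Nehari manifold, choose `d` and a scale `r` so that its two half-line power norms are
`r^(2μ+2)` times those of the pair of tails (`exists_split`). Summing the scaled inequalities gives
`r² ≤ r^(2μ+2)`, hence `r ≥ 1` and `N(ψ) ≥ S(d)`, where `S` (`splitMass`) is the total power norm of
the pair (`exists_splitMass_le_powerNorm`).

What remains is to minimize the even function `S` on `|d| ≤ A-1`. In the variable `u = 1/t` the
derivative of `M` is a constant times `matching μ t ^ (1/μ)`, so `S'` has the sign of `logRatio`.
The derivative of `logRatio` is a positive factor times a strictly increasing function of `d²`
(`strictMonoOn_logRatioRate`), whose sign at `0` is that of `1 - μ(A²-1)`, that is, of `ω* - ω`.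
Hence `d = 0` is the only minimizer for `ω ≤ ω*`. For `ω > ω*` the minimizers are `±d₀`, with `d₀`
the unique positive zero of `logRatio`, which is the matching system in other variables. -/

namespace DeltaPrimeNLS

/-! ### Absolute continuity and the fundamental theorem of calculus -/

section AbsolutelyContinuous

theorem _root_.LipschitzOnWith.comp_absolutelyContinuousOnInterval {X Y : Type*}
    [PseudoMetricSpace X] [PseudoMetricSpace Y] {φ : X → Y} {f : ℝ → X} {a b : ℝ} {K : NNReal}
    (hφ : LipschitzOnWith K φ (f '' uIcc a b)) (hf : AbsolutelyContinuousOnInterval f a b) :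
    AbsolutelyContinuousOnInterval (fun x => φ (f x)) a b := by
  have h : Tendsto (fun E : ℕ × (ℕ → ℝ × ℝ) =>
      (K : ℝ) * ∑ i ∈ Finset.range E.1, dist (f (E.2 i).1) (f (E.2 i).2))
      (AbsolutelyContinuousOnInterval.totalLengthFilter ⊓
        𝓟 (AbsolutelyContinuousOnInterval.disjWithin a b)) (𝓝 ((K : ℝ) * 0)) :=
    Tendsto.const_mul (K : ℝ) hf
  rw [mul_zero] at h
  refine squeeze_zero' (Eventually.of_forall fun E => Finset.sum_nonneg fun _ _ => dist_nonneg)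
    ?_ h
  have hmem : ∀ᶠ E in AbsolutelyContinuousOnInterval.totalLengthFilter ⊓
      𝓟 (AbsolutelyContinuousOnInterval.disjWithin a b),
      E ∈ AbsolutelyContinuousOnInterval.disjWithin a b :=
    eventually_inf_principal.mpr (by simp)
  filter_upwards [hmem] with E hE
  rw [Finset.mul_sum]
  refine Finset.sum_le_sum fun i hi => ?_
  exact hφ.dist_le_mul _ (mem_image_of_mem _ (hE.1 i hi).1) _ (mem_image_of_mem _ (hE.1 i hi).2)

theorem absolutelyContinuousOnInterval_of_hasDerivAt {F F' : ℝ → ℝ} {a b : ℝ} (hab : a ≤ b)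
    (hF : ∀ x ∈ Icc a b, HasDerivAt F (F' x) x) (hc : ContinuousOn F' (Icc a b)) :
    AbsolutelyContinuousOnInterval F a b := by
  obtain ⟨C, hC⟩ := isCompact_Icc.exists_bound_of_continuousOn hc
  have hL : LipschitzOnWith (Real.toNNReal C) F (uIcc a b) := by
    rw [uIcc_of_le hab]
    refine Convex.lipschitzOnWith_of_nnnorm_hasDerivWithin_le (convex_Icc a b)
      (fun x hx => (hF x hx).hasDerivWithinAt) fun x hx => ?_
    rw [← NNReal.coe_le_coe]
    exact (hC x hx).trans (Real.le_coe_toNNReal C)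
  exact hL.absolutelyContinuousOnInterval

/-- This is the form of the fundamental theorem that suits Sobolev functions: powers of `|f|` and
the calibrating potential have their expected derivatives only almost everywhere. -/
theorem _root_.AbsolutelyContinuousOnInterval.integral_eq_sub_of_ae_hasDerivAt {F F' : ℝ → ℝ}
    {a b : ℝ} (hab : a ≤ b) (hF : AbsolutelyContinuousOnInterval F a b)
    (h : ∀ᵐ x, x ∈ Ioo a b → HasDerivAt F (F' x) x) :
    IntervalIntegrable F' volume a b ∧ ∫ x in a..b, F' x = F b - F a := by
  have hb : ∀ᵐ x : ℝ, x ≠ b := by simp [ae_iff, measure_singleton]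
  have h' : ∀ᵐ x, x ∈ uIoc a b → deriv F x = F' x := by
    filter_upwards [h, hb] with x hx hxb hx'
    rw [uIoc_of_le hab] at hx'
    exact (hx ⟨hx'.1, lt_of_le_of_ne hx'.2 hxb⟩).deriv
  refine ⟨hF.intervalIntegrable_deriv.congr_ae ((ae_restrict_iff' measurableSet_uIoc).2 h'), ?_⟩
  rw [← hF.integral_deriv_eq_sub]
  refine (intervalIntegral.integral_congr_ae ?_).symm
  exact h'

end AbsolutelyContinuous

/-! ### Primitives on the half-line -/

/-- `f` is a primitive on `[0, ∞)` of the square integrable function `g`. -/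
structure HalfLinePrimitive (f g : ℝ → ℂ) : Prop where
  continuous : Continuous f
  memLp_deriv : MemLp g 2 (volume.restrict (Ioi 0))
  eq_add_integral : ∀ x, 0 ≤ x → f x = f 0 + ∫ t in (0 : ℝ)..x, g t

/-- `f` is a continuous representative of an element of `H¹(0, ∞)` with derivative `g`. -/
structure HalfLineH1 (f g : ℝ → ℂ) : Prop extends HalfLinePrimitive f g where
  memLp : MemLp f 2 (volume.restrict (Ioi 0))

namespace HalfLinePrimitive

variable {f g : ℝ → ℂ}

theorem intervalIntegrable (h : HalfLinePrimitive f g) {X : ℝ} (hX : 0 ≤ X) :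
    IntervalIntegrable g volume 0 X := by
  rw [intervalIntegrable_iff_integrableOn_Ioc_of_le hX]
  have h1 : MemLp g 2 (volume.restrict (Ioc 0 X)) :=
    h.memLp_deriv.mono_measure (Measure.restrict_mono Ioc_subset_Ioi_self le_rfl)
  exact h1.integrable (by norm_num)

theorem ae_hasDerivAt (h : HalfLinePrimitive f g) :
    ∀ᵐ x, 0 < x → HasDerivAt f (g x) x := by
  -- Lebesgue differentiation on each `[0, n]`; the countably many exceptional sets are merged.
  have h1 : ∀ n : ℕ, ∀ᵐ x : ℝ, x ∈ uIcc (0 : ℝ) n → ∀ c ∈ uIcc (0 : ℝ) n,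
      HasDerivAt (fun x => ∫ t in c..x, g t) (g x) x := fun n =>
    (h.intervalIntegrable n.cast_nonneg).ae_hasDerivAt_integral
  filter_upwards [ae_all_iff.2 h1] with x hx hx0
  obtain ⟨n, hn⟩ := exists_nat_gt x
  have h2 := hx n (by rw [uIcc_of_le n.cast_nonneg]; exact ⟨hx0.le, hn.le⟩) 0 left_mem_uIcc
  refine (h2.const_add (f 0)).congr_of_eventuallyEq ?_
  filter_upwards [lt_mem_nhds hx0] with y hy
  exact h.eq_add_integral y hy.le

theorem absolutelyContinuous (h : HalfLinePrimitive f g) (ℓ : ℂ →L[ℝ] ℝ) {X : ℝ} (hX : 0 ≤ X) :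
    AbsolutelyContinuousOnInterval (fun x => ℓ (f x)) 0 X := by
  have hi : IntervalIntegrable (fun t => ℓ (g t)) volume 0 X :=
    ⟨ℓ.integrable_comp (h.intervalIntegrable hX).1, ℓ.integrable_comp (h.intervalIntegrable hX).2⟩
  have h1 := hi.absolutelyContinuousOnInterval_intervalIntegral (c := 0) left_mem_uIcc
  have h2 : AbsolutelyContinuousOnInterval (fun _ : ℝ => ℓ (f 0)) 0 X :=
    contDiffOn_const.absolutelyContinuousOnInterval
  have h3 := h2.fun_add h1
  rw [absolutelyContinuousOnInterval_iff] at h3 ⊢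
  have he : ∀ x ∈ uIcc 0 X, ℓ (f x) = ℓ (f 0) + ∫ t in (0 : ℝ)..x, ℓ (g t) := by
    intro x hx
    rw [uIcc_of_le hX] at hx
    rw [h.eq_add_integral x hx.1, map_add,
      ← ℓ.intervalIntegral_comp_comm (h.intervalIntegrable hx.1)]
  intro ε hε
  obtain ⟨δ, hδ, hd⟩ := h3 ε hε
  refine ⟨δ, hδ, fun E hE hE' => ?_⟩
  convert! hd E hE hE' using 1
  refine Finset.sum_congr rfl fun i hi => ?_
  rw [he _ (hE.1 i hi).1, he _ (hE.1 i hi).2]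

theorem ae_hasDerivAt_clm (h : HalfLinePrimitive f g) (ℓ : ℂ →L[ℝ] ℝ) :
    ∀ᵐ x, 0 < x → HasDerivAt (fun x => ℓ (f x)) (ℓ (g x)) x := by
  filter_upwards [h.ae_hasDerivAt] with x hx hx0
  exact ℓ.hasFDerivAt.comp_hasDerivAt x (hx hx0)

/-- `|f| ^ (2 q)` is absolutely continuous for `q ≥ 1`. -/
theorem absolutelyContinuous_normSq_rpow (h : HalfLinePrimitive f g) {q : ℝ} (hq : 1 ≤ q) {X : ℝ}
    (hX : 0 ≤ X) :
    AbsolutelyContinuousOnInterval (fun x => Complex.normSq (f x) ^ q) 0 X := by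
  have hre := h.absolutelyContinuous Complex.reCLM hX
  have him := h.absolutelyContinuous Complex.imCLM hX
  have h1 : AbsolutelyContinuousOnInterval (fun x => Complex.normSq (f x)) 0 X := by
    have := (hre.fun_mul hre).fun_add (him.fun_mul him)
    simpa [Complex.normSq_apply] using this
  obtain ⟨C, hC⟩ := h1.exists_bound
  -- Since `q ≥ 1`, the power is Lipschitz on bounded intervals up to and including `0`, so zeros of
  -- `f` do no harm.
  have hL : LipschitzOnWith (Real.toNNReal (q * C ^ (q - 1))) (fun y : ℝ => y ^ q) (Icc 0 C) := by
    refine Convex.lipschitzOnWith_of_nnnorm_hasDerivWithin_le (f' := fun y => q * y ^ (q - 1))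
      (convex_Icc 0 C)
      (fun x hx => (Real.hasDerivAt_rpow_const (Or.inr hq)).hasDerivWithinAt) fun x hx => ?_
    rw [← NNReal.coe_le_coe]
    refine le_trans ?_ (Real.le_coe_toNNReal _)
    have : 0 ≤ x ^ (q - 1) := Real.rpow_nonneg hx.1 _
    rw [coe_nnnorm, Real.norm_of_nonneg (by positivity)]
    exact mul_le_mul_of_nonneg_left (Real.rpow_le_rpow hx.1 hx.2 (by linarith)) (by linarith)
  refine LipschitzOnWith.comp_absolutelyContinuousOnInterval (hL.mono ?_) h1
  rintro _ ⟨x, hx, rfl⟩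
  exact ⟨Complex.normSq_nonneg _, (le_abs_self _).trans (hC x hx)⟩

theorem ae_hasDerivAt_normSq_rpow (h : HalfLinePrimitive f g) {q : ℝ} (hq : 1 ≤ q) :
    ∀ᵐ x, 0 < x → HasDerivAt (fun x => Complex.normSq (f x) ^ q)
      (2 * q * Complex.normSq (f x) ^ (q - 1) *
        ((f x).re * (g x).re + (f x).im * (g x).im)) x := by
  filter_upwards [h.ae_hasDerivAt_clm Complex.reCLM, h.ae_hasDerivAt_clm Complex.imCLM]
    with x hre him hx
  have h1 := ((hre hx).mul (hre hx)).add ((him hx).mul (him hx))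
  have h2 : HasDerivAt (fun x => Complex.normSq (f x))
      (2 * ((f x).re * (g x).re + (f x).im * (g x).im)) x := by
    convert! h1 using 1
    simp only [Complex.reCLM_apply, Complex.imCLM_apply]
    ring
  convert! h2.rpow_const (p := q) (Or.inr hq) using 1
  ring

theorem isWeakDerivOn (h : HalfLinePrimitive f g) : IsWeakDerivOn (Ioi 0) f g := by
  intro η hη hc hs
  obtain ⟨b, hb⟩ : ∃ b : ℝ, tsupport η ⊆ Iic b := by
    obtain ⟨b, hb⟩ := hc.isCompact.bddAbove
    exact ⟨b, fun x hx => hb hx⟩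
  set X := max b 0 + 1 with hXd
  have hX : 0 ≤ X := by positivity
  have hz : ∀ x, x ≤ 0 ∨ X ≤ x → η x = 0 := by
    intro x hx
    refine image_eq_zero_of_notMem_tsupport fun hx' => ?_
    rcases hx with hx | hx
    · exact absurd (hs hx') (not_lt.2 hx)
    · have := hb hx'
      have := le_max_left b 0
      simp only [mem_Iic] at *
      linarith
  have hz' : ∀ x, X ≤ x → deriv η x = 0 := by
    intro x hx
    refine image_eq_zero_of_notMem_tsupport fun hx' => ?_
    have := hb (closure_minimal (support_deriv_subset (f := η)) (isClosed_tsupport η) hx')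
    have := le_max_left b 0
    simp only [mem_Iic] at *
    linarith
  have hη1 : ContDiff ℝ 1 η := hη.of_le (by exact_mod_cast le_top)
  have hcd : Continuous (deriv η) := hη1.continuous_deriv le_rfl
  have key : ∀ u : ℝ → ℂ, (∀ x, X ≤ x → u x = 0) →
      ∫ x in Ioi (0 : ℝ), u x = ∫ x in (0 : ℝ)..X, u x := by
    intro u hu
    rw [intervalIntegral.integral_of_le hX]
    refine (setIntegral_eq_of_subset_of_forall_sdiff_eq_zero measurableSet_Ioi
      Ioc_subset_Ioi_self fun x hx => hu x ?_)
    by_contra hh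
    exact hx.2 ⟨hx.1, (not_le.1 hh).le⟩
  rw [key _ (fun x hx => by simp [hz' x hx]), key _ (fun x hx => by simp [hz x (Or.inr hx)])]
  have hi1 : IntervalIntegrable (fun x => deriv η x • f x) volume 0 X :=
    (hcd.smul h.continuous).intervalIntegrable _ _
  have hi2 : IntervalIntegrable (fun x => η x • g x) volume 0 X :=
    (h.intervalIntegrable hX).continuousOn_smul hη.continuous.continuousOn
  -- Integration by parts is done for real and imaginary parts separately, as products of absolutely
  -- continuous real functions.
  have hmain : ∀ ℓ : ℂ →L[ℝ] ℝ,
      ℓ (∫ x in (0 : ℝ)..X, deriv η x • f x) = ℓ (-∫ x in (0 : ℝ)..X, η x • g x) := by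
    intro ℓ
    rw [map_neg, ← ℓ.intervalIntegral_comp_comm hi1, ← ℓ.intervalIntegral_comp_comm hi2]
    have hac : AbsolutelyContinuousOnInterval (fun x => η x * ℓ (f x)) 0 X :=
      (absolutelyContinuousOnInterval_of_hasDerivAt hX
        (fun x _ => (hη1.differentiable (by norm_num) x).hasDerivAt) hcd.continuousOn).fun_mul
        (h.absolutelyContinuous ℓ hX)
    have hd : ∀ᵐ x, x ∈ Ioo 0 X → HasDerivAt (fun x => η x * ℓ (f x))
        (ℓ (deriv η x • f x) + ℓ (η x • g x)) x := by
      filter_upwards [h.ae_hasDerivAt_clm ℓ] with x hx hx0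
      rw [map_smul, map_smul]
      exact (hη1.differentiable (by norm_num) x).hasDerivAt.mul (hx hx0.1)
    have := (hac.integral_eq_sub_of_ae_hasDerivAt hX hd).2
    rw [intervalIntegral.integral_add, hz X (Or.inr le_rfl), hz 0 (Or.inl le_rfl)] at this
    · linarith
    · exact ⟨ℓ.integrable_comp hi1.1, ℓ.integrable_comp hi1.2⟩
    · exact ⟨ℓ.integrable_comp hi2.1, ℓ.integrable_comp hi2.2⟩
  exact Complex.ext (hmain Complex.reCLM) (hmain Complex.imCLM)

end HalfLinePrimitive

/-! ### Continuous representatives of H¹ functions -/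

/-- A locally integrable function on the half-line whose weak derivative vanishes is constant. -/
theorem ae_eq_const_of_integral_deriv_smul_eq_zero {h : ℝ → ℂ}
    (hh : LocallyIntegrable h (volume.restrict (Ioi 0)))
    (hz : ∀ η : ℝ → ℝ, ContDiff ℝ (⊤ : ℕ∞) η → HasCompactSupport η → tsupport η ⊆ Ioi 0 →
      ∫ x in Ioi (0 : ℝ), deriv η x • h x = 0) :
    ∃ c : ℂ, h =ᵐ[volume.restrict (Ioi 0)] fun _ => c := by
  -- A reference test function of integral one; outer radius `1/2` around `1` keeps its support
  -- inside the open half-line.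
  let β : ContDiffBump (1 : ℝ) := ⟨1 / 4, 1 / 2, by norm_num, by norm_num⟩
  set θ : ℝ → ℝ := β.normed volume with hθ
  have hθs : ContDiff ℝ (⊤ : ℕ∞) θ := β.contDiff_normed
  have hθc : HasCompactSupport θ := β.hasCompactSupport_normed
  have hθt : tsupport θ ⊆ Ioi 0 := by
    rw [hθ, β.tsupport_normed_eq]
    intro x hx
    rw [Metric.mem_closedBall, Real.dist_eq] at hx
    have : β.rOut = 1 / 2 := rfl
    rw [this] at hx
    have := (abs_le.1 hx).1
    simp only [mem_Ioi]
    linarith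
  have hθ1 : ∫ x, θ x = 1 := β.integral_normed
  set c : ℂ := ∫ x in Ioi (0 : ℝ), θ x • h x with hc
  have hi : ∀ χ : ℝ → ℝ, Continuous χ → HasCompactSupport χ →
      IntegrableOn (fun x => χ x • h x) (Ioi 0) := fun χ h1 h2 =>
    hh.integrable_smul_left_of_hasCompactSupport h1 h2
  refine ⟨c, ?_⟩
  have hloc : LocallyIntegrableOn (fun x => h x - c) (Ioi 0) volume :=
    locallyIntegrableOn_of_locallyIntegrable_restrict (hh.sub (locallyIntegrable_const c))
  have key := isOpen_Ioi.ae_eq_zero_of_integral_contDiff_smul_eq_zero (μ := volume)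
    hloc (by
      intro χ hχ hχc hχs
      have hχ0 : ∀ x ∉ Ioi (0 : ℝ), χ x = 0 := fun x hx =>
        image_eq_zero_of_notMem_tsupport fun h => hx (hχs h)
      set I : ℝ := ∫ x, χ x with hI
      -- Subtracting a multiple of `θ` makes the mean zero, so that `w` is the derivative of a test
      -- function and the hypothesis applies to it.
      set w : ℝ → ℝ := fun x => χ x - I * θ x with hw
      have hws : ContDiff ℝ (⊤ : ℕ∞) w := hχ.sub (contDiff_const.mul hθs)
      -- The lower end must be strictly positive: the primitive of `w` has to be supported inside
      -- `(0, ∞)`.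
      obtain ⟨a, b, ha, hb⟩ : ∃ a b : ℝ, 0 < a ∧ ∀ x, x < a ∨ b < x → w x = 0 := by
        have hK : IsCompact (tsupport χ ∪ tsupport θ) := hχc.isCompact.union hθc.isCompact
        have hKs : tsupport χ ∪ tsupport θ ⊆ Ioi 0 := union_subset hχs hθt
        have hne : (tsupport χ ∪ tsupport θ).Nonempty := by
          refine Nonempty.inr ?_
          rw [hθ, β.tsupport_normed_eq]
          exact ⟨1, Metric.mem_closedBall_self β.rOut_pos.le⟩
        obtain ⟨a, ha⟩ := hK.exists_isLeast hne
        obtain ⟨b, hb⟩ := hK.exists_isGreatest hne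
        refine ⟨a, b, hKs ha.1, fun x hx => ?_⟩
        have hxK : x ∉ tsupport χ ∪ tsupport θ := by
          intro hx'
          rcases hx with hx | hx
          · exact absurd (ha.2 hx') (not_le.2 hx)
          · exact absurd (hb.2 hx') (not_le.2 hx)
        rw [mem_union, not_or] at hxK
        simp [hw, image_eq_zero_of_notMem_tsupport hxK.1, image_eq_zero_of_notMem_tsupport hxK.2]
      have hwi : Integrable w := (hχ.continuous.integrable_of_hasCompactSupport hχc).sub
        ((hθs.continuous.integrable_of_hasCompactSupport hθc).const_mul I)
      have hw0 : ∫ x, w x = 0 := by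
        rw [hw, integral_sub (hχ.continuous.integrable_of_hasCompactSupport hχc)
          ((hθs.continuous.integrable_of_hasCompactSupport hθc).const_mul I),
          integral_const_mul, hθ1]
        simp [hI]
      set η : ℝ → ℝ := fun x => ∫ t in (0 : ℝ)..x, w t with hη
      have hηd : ∀ x, HasDerivAt η (w x) x := fun x =>
        intervalIntegral.integral_hasDerivAt_right (hws.continuous.intervalIntegrable _ _)
          (hws.continuous.stronglyMeasurableAtFilter _ _) hws.continuous.continuousAt
      have hηe : deriv η = w := funext fun x => (hηd x).deriv
      have hηs : ContDiff ℝ (⊤ : ℕ∞) η := by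
        rw [contDiff_infty_iff_deriv]
        exact ⟨fun x => (hηd x).differentiableAt, by rw [hηe]; exact hws⟩
      have hη0 : ∀ x ∉ Icc a b, η x = 0 := by
        intro x hx
        rcases lt_or_ge x a with hxa | hxa
        · refine intervalIntegral.integral_zero_ae (Eventually.of_forall fun t ht => hb t (Or.inl ?_))
          rw [mem_uIoc] at ht
          rcases ht with ht | ht <;> linarith [ht.1, ht.2]
        · have hxb : b < x := by
            by_contra hh
            exact hx ⟨hxa, not_lt.1 hh⟩
          have : η x = ∫ t, w t := by
            rw [hη]
            simp only
            rw [intervalIntegral.integral_of_le (by linarith)]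
            refine setIntegral_eq_integral_of_forall_compl_eq_zero fun t ht => hb t ?_
            by_contra hh
            rw [not_or, not_lt, not_lt] at hh
            exact ht ⟨by linarith [hh.1], by linarith [hh.2]⟩
          rw [this, hw0]
      have hηt : tsupport η ⊆ Icc a b :=
        closure_minimal (fun x hx => by_contra fun h => hx (hη0 x h)) isClosed_Icc
      have hηc : HasCompactSupport η := isCompact_Icc.of_isClosed_subset (isClosed_tsupport η) hηt
      have h0 := hz η hηs hηc (hηt.trans fun x hx => lt_of_lt_of_le ha hx.1)
      rw [hηe] at h0
      have h1 : ∫ x in Ioi (0 : ℝ), χ x • h x = I • c := by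
        have : ∀ x, w x • h x = χ x • h x - I • (θ x • h x) := fun x => by
          simp only [hw, sub_smul, mul_smul]
        simp only [this] at h0
        rw [integral_sub (hi χ hχ.continuous hχc)
            (show Integrable (fun x => I • (θ x • h x)) (volume.restrict (Ioi 0)) from
              Integrable.smul I (hi θ hθs.continuous hθc)),
          integral_smul, ← hc] at h0
        exact sub_eq_zero.1 h0
      have h2 : ∫ x in Ioi (0 : ℝ), χ x • c = I • c := by
        rw [setIntegral_eq_integral_of_forall_compl_eq_zero fun x hx => by simp [hχ0 x hx],
          integral_smul_const]
      rw [← setIntegral_eq_integral_of_forall_compl_eq_zero (s := Ioi 0)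
        fun x hx => by simp [hχ0 x hx]]
      simp only [smul_sub]
      rw [integral_sub (hi χ hχ.continuous hχc), h1, h2, sub_self]
      exact ((hχ.continuous.integrable_of_hasCompactSupport hχc).smul_const c).integrableOn)
  rw [Filter.EventuallyEq, ae_restrict_iff' measurableSet_Ioi]
  filter_upwards [key] with x hx hx0
  exact sub_eq_zero.1 (hx hx0)

theorem IsWeakDerivOn.congr {U : Set ℝ} {ψ φ g : ℝ → ℂ} (h : IsWeakDerivOn U ψ g)
    (he : ψ =ᵐ[volume.restrict U] φ) : IsWeakDerivOn U φ g := by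
  intro η h1 h2 h3
  rw [← h η h1 h2 h3]
  refine integral_congr_ae ?_
  filter_upwards [he] with x hx
  rw [hx]

theorem MemH1.exists_halfLineH1 {ψ : ℝ → ℂ} (hψ : MemH1 (Ioi 0) ψ) :
    ∃ f g, HalfLineH1 f g ∧ ψ =ᵐ[volume.restrict (Ioi 0)] f := by
  obtain ⟨hψ2, g, hg, hw⟩ := hψ
  -- Extension by zero makes the primitive `G` continuous on all of `ℝ`; then `ψ - G` has vanishing
  -- weak derivative and is constant.
  set g' : ℝ → ℂ := (Ioi 0).indicator g with hg'
  have hg'2 : MemLp g' 2 volume := (memLp_indicator_iff_restrict measurableSet_Ioi).2 hg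
  have hg'l : LocallyIntegrable g' volume := hg'2.locallyIntegrable (by norm_num)
  set G : ℝ → ℂ := fun x => ∫ t in (0 : ℝ)..x, g' t with hG
  have hGc : Continuous G := intervalIntegral.continuous_primitive
    (fun a b => ⟨(hg'l.integrableOn_isCompact isCompact_Icc).mono_set Ioc_subset_Icc_self,
      (hg'l.integrableOn_isCompact isCompact_Icc).mono_set Ioc_subset_Icc_self⟩) 0
  have hG0 : G 0 = 0 := by simp [hG]
  have hGe : ∀ x, 0 ≤ x → G x = ∫ t in (0 : ℝ)..x, g t := by
    intro x hx
    refine intervalIntegral.integral_congr_ae (Eventually.of_forall fun t ht => ?_)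
    rw [uIoc_of_le hx] at ht
    exact indicator_of_mem ht.1 _
  have hGp : HalfLinePrimitive G g := ⟨hGc, hg, fun x hx => by rw [hG0, zero_add, hGe x hx]⟩
  have hψl : LocallyIntegrable ψ (volume.restrict (Ioi 0)) := hψ2.locallyIntegrable (by norm_num)
  have hGl : LocallyIntegrable G (volume.restrict (Ioi 0)) := hGc.locallyIntegrable
  obtain ⟨c, hc⟩ := ae_eq_const_of_integral_deriv_smul_eq_zero (h := fun x => ψ x - G x)
    (hψl.sub hGl) (by
      intro η h1 h2 h3
      have hη1 : ContDiff ℝ 1 η := h1.of_le (by exact_mod_cast le_top)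
      have hdc : Continuous (deriv η) := hη1.continuous_deriv le_rfl
      simp only [smul_sub]
      rw [integral_sub (hψl.integrable_smul_left_of_hasCompactSupport hdc h2.deriv)
        (hGl.integrable_smul_left_of_hasCompactSupport hdc h2.deriv),
        hw η h1 h2 h3, hGp.isWeakDerivOn η h1 h2 h3, sub_self])
  have he : ψ =ᵐ[volume.restrict (Ioi 0)] fun x => G x + c := by
    filter_upwards [hc] with x hx
    rw [← hx]
    ring
  refine ⟨fun x => G x + c, g, ⟨⟨hGc.add continuous_const, hg, fun x hx => ?_⟩, ?_⟩, he⟩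
  · rw [hG0, hGe x hx]
    ring
  · exact (memLp_congr_ae he).1 hψ2

theorem HalfLineH1.memH1 {ψ f g : ℝ → ℂ} (h : HalfLineH1 f g)
    (he : ψ =ᵐ[volume.restrict (Ioi 0)] f) : MemH1 (Ioi 0) ψ :=
  ⟨(memLp_congr_ae he).2 h.memLp, g, h.memLp_deriv, h.isWeakDerivOn.congr he.symm⟩

theorem weakDeriv_spec {U : Set ℝ} {ψ : ℝ → ℂ} (h : MemH1 U ψ) :
    MemLp (weakDeriv U ψ) 2 (volume.restrict U) ∧ IsWeakDerivOn U ψ (weakDeriv U ψ) := by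
  rw [weakDeriv, dif_pos h.2]
  exact h.2.choose_spec

theorem HalfLineH1.weakDeriv_ae_eq {ψ f g : ℝ → ℂ} (h : HalfLineH1 f g)
    (he : ψ =ᵐ[volume.restrict (Ioi 0)] f) :
    weakDeriv (Ioi 0) ψ =ᵐ[volume.restrict (Ioi 0)] g := by
  have hs := weakDeriv_spec (h.memH1 he)
  exact IsWeakDerivOn.ae_eq isOpen_Ioi hs.1 h.memLp_deriv hs.2 (h.isWeakDerivOn.congr he.symm)

/-! ### Reflection of the left half-line onto the right one -/

section Reflection

theorem setIntegral_comp_neg {E : Type*} [NormedAddCommGroup E] [NormedSpace ℝ E]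
    (U : Set ℝ) (F : ℝ → E) : ∫ x in -U, F (-x) = ∫ x in U, F x :=
  (Measure.measurePreserving_neg (volume : Measure ℝ)).setIntegral_preimage_emb
    (Homeomorph.neg ℝ).measurableEmbedding F U

theorem measurePreserving_neg_restrict (U : Set ℝ) :
    MeasurePreserving (fun x : ℝ => -x) (volume.restrict (-U)) (volume.restrict U) :=
  (Measure.measurePreserving_neg (volume : Measure ℝ)).restrict_preimage_emb
    (Homeomorph.neg ℝ).measurableEmbedding U

theorem IsWeakDerivOn.comp_neg {U : Set ℝ} {ψ g : ℝ → ℂ} (h : IsWeakDerivOn U ψ g) :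
    IsWeakDerivOn (-U) (fun x => ψ (-x)) (fun x => -g (-x)) := by
  intro η h1 h2 h3
  have hs : tsupport (fun x => η (-x)) = -tsupport η :=
    tsupport_comp_eq_preimage η (Homeomorph.neg ℝ)
  have := h (fun x => η (-x)) (h1.comp contDiff_neg)
    (h2.comp_homeomorph (Homeomorph.neg ℝ)) (by
      rw [hs]
      intro x hx
      simpa using h3 hx)
  rw [← setIntegral_comp_neg U, ← setIntegral_comp_neg U] at this
  simp only [deriv_comp_neg, neg_neg, neg_smul, integral_neg, smul_neg] at this ⊢
  exact neg_inj.1 this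

theorem MemH1.comp_neg {U : Set ℝ} {ψ : ℝ → ℂ} (h : MemH1 U ψ) :
    MemH1 (-U) (fun x => ψ (-x)) := by
  obtain ⟨h1, g, h2, h3⟩ := h
  exact ⟨h1.comp_measurePreserving (measurePreserving_neg_restrict U), fun x => -g (-x),
    (h2.comp_measurePreserving (measurePreserving_neg_restrict U)).neg, h3.comp_neg⟩

theorem neg_Iio_zero : -Iio (0 : ℝ) = Ioi 0 := by simp

theorem neg_Ioi_zero : -Ioi (0 : ℝ) = Iio 0 := by simp

theorem memH1_Iio_iff {ψ : ℝ → ℂ} :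
    MemH1 (Iio 0) ψ ↔ MemH1 (Ioi 0) (fun x => ψ (-x)) := by
  constructor
  · intro h
    simpa only [neg_Iio_zero] using h.comp_neg
  · intro h
    simpa only [neg_Ioi_zero, neg_neg] using h.comp_neg

theorem integral_sq_weakDeriv_Iio {ψ : ℝ → ℂ} (h : MemH1 (Iio 0) ψ) :
    ∫ x in Iio (0 : ℝ), ‖weakDeriv (Iio 0) ψ x‖ ^ 2 =
      ∫ x in Ioi (0 : ℝ), ‖weakDeriv (Ioi 0) (fun x => ψ (-x)) x‖ ^ 2 := by
  have hs := weakDeriv_spec h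
  have hs' := weakDeriv_spec (memH1_Iio_iff.1 h)
  have h1 := hs.1.comp_measurePreserving (measurePreserving_neg_restrict (Iio 0))
  have h2 := hs.2.comp_neg
  rw [neg_Iio_zero] at h1 h2
  have he := IsWeakDerivOn.ae_eq isOpen_Ioi h1.neg hs'.1 h2 hs'.2
  rw [← setIntegral_comp_neg (Iio 0), neg_Iio_zero]
  refine integral_congr_ae ?_
  filter_upwards [he] with x hx
  rw [← hx]
  simp

end Reflection

/-! ### One-sided boundary values -/

section BoundaryValues

/-- An interval is not a null set, so it meets every set of full measure. Nontriviality of the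
filter is what makes the limit defining a boundary value unique. -/
theorem nhdsWithin_inf_ae_neBot {a : ℝ} {S : Set ℝ}
    (hS : ∀ s ∈ 𝓝[S] a, ∃ u v, u < v ∧ Ioo u v ⊆ s) :
    (𝓝[S] a ⊓ ae (volume : Measure ℝ)).NeBot := by
  rw [inf_neBot_iff]
  intro s hs t ht
  obtain ⟨u, v, huv, hus⟩ := hS s hs
  by_contra hne
  rw [not_nonempty_iff_eq_empty] at hne
  have hsub : Ioo u v ⊆ tᶜ := fun x hx hxt => by
    have : x ∈ s ∩ t := ⟨hus hx, hxt⟩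
    simp [hne] at this
  have h0 : volume (Ioo u v) = 0 := measure_mono_null hsub ht
  rw [Real.volume_Ioo, ENNReal.ofReal_eq_zero] at h0
  linarith

theorem rightValue_eq {ψ f : ℝ → ℂ} (hf : Continuous f)
    (he : ψ =ᵐ[volume.restrict (Ioi 0)] f) : rightValue ψ = f 0 := by
  have : (𝓝[>] (0 : ℝ) ⊓ ae (volume : Measure ℝ)).NeBot := by
    refine nhdsWithin_inf_ae_neBot fun s hs => ?_
    obtain ⟨u, hu, hus⟩ := mem_nhdsGT_iff_exists_Ioo_subset.1 hs
    exact ⟨0, u, hu, hus⟩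
  refine Tendsto.limUnder_eq ?_
  have h1 : Tendsto f (𝓝[>] (0 : ℝ) ⊓ ae volume) (𝓝 (f 0)) :=
    (hf.tendsto 0).mono_left (inf_le_left.trans nhdsWithin_le_nhds)
  refine h1.congr' ?_
  rw [Filter.EventuallyEq, ae_restrict_iff' measurableSet_Ioi] at he
  filter_upwards [mem_inf_of_right he, mem_inf_of_left self_mem_nhdsWithin] with x hx hx0
  exact (hx hx0).symm

theorem ae_eq_Iio_of_comp_neg {ψ f : ℝ → ℂ}
    (he : (fun x => ψ (-x)) =ᵐ[volume.restrict (Ioi 0)] f) :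
    ψ =ᵐ[volume.restrict (Iio 0)] fun x => f (-x) := by
  have h := (measurePreserving_neg_restrict (Ioi 0)).quasiMeasurePreserving.ae_eq_comp he
  rw [neg_Ioi_zero] at h
  simpa [Function.comp_def] using h

theorem leftValue_eq {ψ f : ℝ → ℂ} (hf : Continuous f)
    (he : (fun x => ψ (-x)) =ᵐ[volume.restrict (Ioi 0)] f) : leftValue ψ = f 0 := by
  have : (𝓝[<] (0 : ℝ) ⊓ ae (volume : Measure ℝ)).NeBot := by
    refine nhdsWithin_inf_ae_neBot fun s hs => ?_
    obtain ⟨u, hu, hus⟩ := mem_nhdsLT_iff_exists_Ioo_subset.1 hs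
    exact ⟨u, 0, hu, hus⟩
  replace he := ae_eq_Iio_of_comp_neg he
  refine Tendsto.limUnder_eq ?_
  have hc : Continuous fun x => f (-x) := hf.comp continuous_neg
  have h1 : Tendsto (fun x => f (-x)) (𝓝[<] (0 : ℝ) ⊓ ae volume) (𝓝 (f 0)) := by
    simpa using (hc.tendsto 0).mono_left (inf_le_left.trans nhdsWithin_le_nhds)
  refine h1.congr' ?_
  rw [Filter.EventuallyEq, ae_restrict_iff' measurableSet_Iio] at he
  filter_upwards [mem_inf_of_right he, mem_inf_of_left self_mem_nhdsWithin] with x hx hx0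
  exact (hx hx0).symm

end BoundaryValues

/-! ### Boundedness and integrability of powers -/

namespace HalfLineH1

variable {f g : ℝ → ℂ}

theorem integrableOn_sq (h : HalfLineH1 f g) : IntegrableOn (fun x => ‖f x‖ ^ 2) (Ioi 0) :=
  (memLp_two_iff_integrable_sq_norm h.memLp.1).1 h.memLp

theorem _root_.DeltaPrimeNLS.HalfLinePrimitive.integrableOn_sq_deriv (h : HalfLinePrimitive f g) :
    IntegrableOn (fun x => ‖g x‖ ^ 2) (Ioi 0) :=
  (memLp_two_iff_integrable_sq_norm h.memLp_deriv.1).1 h.memLp_deriv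

theorem re_mul_add_im_mul_le (z w : ℂ) : |z.re * w.re + z.im * w.im| ≤ ‖z‖ * ‖w‖ := by
  have h : z.re * w.re + z.im * w.im = (z * (starRingEnd ℂ) w).re := by simp
  rw [h]
  refine (Complex.abs_re_le_norm _).trans ?_
  simp

/-- Integrate `(|f|²)' = 2 Re(f̄ g) ≤ |f|² + |g|²`. The uniform bound is what puts `f` in all higher
`L^q`. -/
theorem normSq_le (h : HalfLineH1 f g) {x : ℝ} (hx : 0 ≤ x) :
    ‖f x‖ ^ 2 ≤ ‖f 0‖ ^ 2 +
      ∫ x in Ioi (0 : ℝ), (‖f x‖ ^ 2 + ‖g x‖ ^ 2) := by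
  have hI := h.integrableOn_sq.add h.integrableOn_sq_deriv
  have hd := (h.absolutelyContinuous_normSq_rpow le_rfl hx).integral_eq_sub_of_ae_hasDerivAt hx
    ((h.ae_hasDerivAt_normSq_rpow le_rfl).mono fun y hy hy' => hy hy'.1)
  have h1 : ∫ y in (0 : ℝ)..x, (2 * 1 * Complex.normSq (f y) ^ ((1 : ℝ) - 1) *
        ((f y).re * (g y).re + (f y).im * (g y).im)) ≤
      ∫ y in (0 : ℝ)..x, (‖f y‖ ^ 2 + ‖g y‖ ^ 2) := by
    refine intervalIntegral.integral_mono hx hd.1 ?_ fun y => ?_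
    · rw [intervalIntegrable_iff_integrableOn_Ioc_of_le hx]
      exact hI.mono_set Ioc_subset_Ioi_self
    · have := (abs_le.1 (re_mul_add_im_mul_le (f y) (g y))).2
      rw [sub_self, Real.rpow_zero]
      nlinarith [sq_nonneg (‖f y‖ - ‖g y‖)]
  have h2 : ∫ y in (0 : ℝ)..x, (‖f y‖ ^ 2 + ‖g y‖ ^ 2) ≤
      ∫ y in Ioi (0 : ℝ), (‖f y‖ ^ 2 + ‖g y‖ ^ 2) := by
    rw [intervalIntegral.integral_of_le hx]
    exact setIntegral_mono_set hI (Eventually.of_forall fun y => by positivity)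
      Ioc_subset_Ioi_self.eventuallyLE
  rw [hd.2, Real.rpow_one, Real.rpow_one, Complex.normSq_eq_norm_sq, Complex.normSq_eq_norm_sq]
    at h1
  linarith

theorem integrableOn_rpow (h : HalfLineH1 f g) {q : ℝ} (hq : 2 ≤ q) :
    IntegrableOn (fun x => ‖f x‖ ^ q) (Ioi 0) := by
  set C := ‖f 0‖ ^ 2 + ∫ x in Ioi (0 : ℝ), (‖f x‖ ^ 2 + ‖g x‖ ^ 2)
  have hm : AEStronglyMeasurable (fun x => ‖f x‖ ^ q) (volume.restrict (Ioi 0)) :=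
    (h.continuous.norm.rpow_const fun x => Or.inr (by linarith)).aestronglyMeasurable
  refine (h.integrableOn_sq.const_mul (C ^ (q / 2 - 1))).mono' hm ?_
  refine (ae_restrict_iff' measurableSet_Ioi).2 (Eventually.of_forall fun x hx => ?_)
  have h0 : ‖f x‖ ^ 2 ≤ C := h.normSq_le (le_of_lt hx)
  rw [Real.norm_of_nonneg (by positivity)]
  have h1 : ‖f x‖ ^ q = (‖f x‖ ^ 2) ^ (q / 2 - 1) * ‖f x‖ ^ 2 := by
    rw [← Real.rpow_natCast, ← Real.rpow_mul (norm_nonneg _),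
      ← Real.rpow_add_of_nonneg (norm_nonneg _) (by push_cast; linarith) (by norm_num)]
    congr 1
    push_cast
    ring
  rw [h1]
  exact mul_le_mul_of_nonneg_right (Real.rpow_le_rpow (by positivity) h0 (by linarith))
    (by positivity)

end HalfLineH1

/-! ### The functionals in terms of a pair of half-line functions -/

/-- `ψ` is represented on `(0, ∞)` by `f₁` and, after reflection, on `(-∞, 0)` by `f₂`. -/
structure EnergyRep (ψ f₁ g₁ f₂ g₂ : ℝ → ℂ) : Prop where
  right : HalfLineH1 f₁ g₁
  left : HalfLineH1 f₂ g₂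
  right_ae : ψ =ᵐ[volume.restrict (Ioi 0)] f₁
  left_ae : (fun x => ψ (-x)) =ᵐ[volume.restrict (Ioi 0)] f₂

theorem exists_energyRep {ψ : ℝ → ℂ} (h : ψ ∈ energySpace) :
    ∃ f₁ g₁ f₂ g₂, EnergyRep ψ f₁ g₁ f₂ g₂ := by
  obtain ⟨f₁, g₁, h1, h1'⟩ := h.1.exists_halfLineH1
  obtain ⟨f₂, g₂, h2, h2'⟩ := (memH1_Iio_iff.1 h.2).exists_halfLineH1
  exact ⟨f₁, g₁, f₂, g₂, h1, h2, h1', h2'⟩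

namespace EnergyRep

variable {ψ f₁ g₁ f₂ g₂ : ℝ → ℂ}

theorem mem_energySpace (h : EnergyRep ψ f₁ g₁ f₂ g₂) : ψ ∈ energySpace :=
  ⟨h.right.memH1 h.right_ae, memH1_Iio_iff.2 (h.left.memH1 h.left_ae)⟩

theorem derivNormSq_eq (h : EnergyRep ψ f₁ g₁ f₂ g₂) :
    derivNormSq ψ = (∫ x in Ioi (0 : ℝ), ‖g₁ x‖ ^ 2) + ∫ x in Ioi (0 : ℝ), ‖g₂ x‖ ^ 2 := by
  rw [derivNormSq, integral_sq_weakDeriv_Iio h.mem_energySpace.2]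
  congr 1
  · refine integral_congr_ae ?_
    filter_upwards [h.right.weakDeriv_ae_eq h.right_ae] with x hx
    rw [hx]
  · refine integral_congr_ae ?_
    filter_upwards [h.left.weakDeriv_ae_eq h.left_ae] with x hx
    rw [hx]

theorem integral_comp_eq (h : EnergyRep ψ f₁ g₁ f₂ g₂) (Φ : ℂ → ℝ)
    (h1 : IntegrableOn (fun x => Φ (f₁ x)) (Ioi 0))
    (h2 : IntegrableOn (fun x => Φ (f₂ x)) (Ioi 0)) :
    ∫ x, Φ (ψ x) = (∫ x in Ioi (0 : ℝ), Φ (f₁ x)) + ∫ x in Ioi (0 : ℝ), Φ (f₂ x) := by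
  have e1 : (fun x => Φ (ψ x)) =ᵐ[volume.restrict (Ioi 0)] fun x => Φ (f₁ x) :=
    h.right_ae.mono fun x hx => by simp only [hx]
  have e2 : (fun x => Φ (ψ x)) =ᵐ[volume.restrict (Iio 0)] fun x => Φ (f₂ (-x)) :=
    (ae_eq_Iio_of_comp_neg h.left_ae).mono fun x hx => by simp only [hx]
  have h2' : IntegrableOn (fun x => Φ (f₂ (-x))) (Iio 0) := by
    have := (measurePreserving_neg_restrict (Ioi 0)).integrable_comp_of_integrable h2
    rwa [neg_Ioi_zero] at this
  have i1 : IntegrableOn (fun x => Φ (ψ x)) (Ioi 0) := h1.congr e1.symm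
  have i2 : IntegrableOn (fun x => Φ (ψ x)) (Iic 0) :=
    (integrableOn_Iic_iff_integrableOn_Iio (by simp)).2 (Integrable.congr h2' e2.symm)
  rw [← intervalIntegral.integral_Iic_add_Ioi i2 i1, integral_Iic_eq_integral_Iio,
    integral_congr_ae e1, integral_congr_ae e2, add_comm]
  congr 1
  have := setIntegral_comp_neg (Ioi 0) (fun x => Φ (f₂ x))
  rwa [neg_Ioi_zero] at this

theorem mass_eq (h : EnergyRep ψ f₁ g₁ f₂ g₂) :
    mass ψ = (∫ x in Ioi (0 : ℝ), ‖f₁ x‖ ^ 2) + ∫ x in Ioi (0 : ℝ), ‖f₂ x‖ ^ 2 :=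
  h.integral_comp_eq (fun z => ‖z‖ ^ 2) h.right.integrableOn_sq h.left.integrableOn_sq

theorem powerNorm_eq (h : EnergyRep ψ f₁ g₁ f₂ g₂) {μ : ℝ} (hμ : 0 < μ) :
    powerNorm μ ψ = (∫ x in Ioi (0 : ℝ), ‖f₁ x‖ ^ (2 * μ + 2)) +
      ∫ x in Ioi (0 : ℝ), ‖f₂ x‖ ^ (2 * μ + 2) :=
  h.integral_comp_eq (fun z => ‖z‖ ^ (2 * μ + 2)) (h.right.integrableOn_rpow (by linarith))
    (h.left.integrableOn_rpow (by linarith))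

theorem nehari_eq (h : EnergyRep ψ f₁ g₁ f₂ g₂) {μ : ℝ} (hμ : 0 < μ) (γ lam ω : ℝ) :
    nehari γ lam μ ω ψ =
      ((∫ x in Ioi (0 : ℝ), ‖g₁ x‖ ^ 2) + ω * ∫ x in Ioi (0 : ℝ), ‖f₁ x‖ ^ 2) +
      ((∫ x in Ioi (0 : ℝ), ‖g₂ x‖ ^ 2) + ω * ∫ x in Ioi (0 : ℝ), ‖f₂ x‖ ^ 2) -
      γ⁻¹ * ‖f₁ 0 - f₂ 0‖ ^ 2 -
      lam * ((∫ x in Ioi (0 : ℝ), ‖f₁ x‖ ^ (2 * μ + 2)) +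
        ∫ x in Ioi (0 : ℝ), ‖f₂ x‖ ^ (2 * μ + 2)) := by
  rw [nehari, formF, h.derivNormSq_eq, h.mass_eq, h.powerNorm_eq hμ,
    rightValue_eq h.right.continuous h.right_ae, leftValue_eq h.left.continuous h.left_ae]
  ring

end EnergyRep

/-- Eliminating the quadratic part by the constraint turns minimization of the action into
minimization of the power norm. -/
theorem action_eq_of_nehari_eq_zero {γ lam μ ω : ℝ} (hμ : 0 < μ) {ψ : ℝ → ℂ}
    (h : nehari γ lam μ ω ψ = 0) :
    action γ lam μ ω ψ = lam * μ / (2 * μ + 2) * powerNorm μ ψ := by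
  rw [nehari] at h
  have h' : formF γ ψ = lam * powerNorm μ ψ - ω * mass ψ := by linarith
  rw [action, energy, h']
  field_simp
  ring

/-! ### The power norm of a soliton tail as a function of its slope -/

section TailMass

/-- Density of the power norm of a soliton tail with respect to the logarithmic slope `σ`. -/
def tailDensity (B k μ σ : ℝ) : ℝ := B / (μ * k) * (B * (1 - σ ^ 2)) ^ (1 / μ)

/-- The power norm of the soliton tail on a half-line, as a function of the (normalized) logarithmic
slope `s` at the end point. -/
def tailMass (B k μ s : ℝ) : ℝ := ∫ σ in s..1, tailDensity B k μ σ

/-- The inverse of `tailMass` on `[0, 1]`. -/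
def tailMassInv (B k μ v : ℝ) : ℝ := Function.invFunOn (tailMass B k μ) (Icc 0 1) v

variable {B k μ : ℝ}

theorem continuous_tailDensity (hμ : 0 < μ) : Continuous (tailDensity B k μ) := by
  unfold tailDensity
  have : 0 ≤ 1 / μ := by positivity
  exact continuous_const.mul (Continuous.rpow_const (by fun_prop) fun _ => Or.inr this)

theorem one_sub_sq_pos {σ : ℝ} (h1 : -1 < σ) (h2 : σ < 1) : 0 < 1 - σ ^ 2 := by nlinarith

theorem tailDensity_pos (hB : 0 < B) (hk : 0 < k) (hμ : 0 < μ) {σ : ℝ} (h1 : -1 < σ)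
    (h2 : σ < 1) : 0 < tailDensity B k μ σ := by
  have := one_sub_sq_pos h1 h2
  unfold tailDensity
  positivity

theorem hasStrictDerivAt_tailMass (hμ : 0 < μ) (s : ℝ) :
    HasStrictDerivAt (tailMass B k μ) (-tailDensity B k μ s) s :=
  intervalIntegral.integral_hasStrictDerivAt_left
    ((continuous_tailDensity hμ).intervalIntegrable _ _)
    ((continuous_tailDensity hμ).stronglyMeasurableAtFilter _ _)
    (continuous_tailDensity hμ).continuousAt

theorem continuous_tailMass (hμ : 0 < μ) : Continuous (tailMass B k μ) :=
  continuous_iff_continuousAt.2 fun s => (hasStrictDerivAt_tailMass hμ s).hasDerivAt.continuousAt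

theorem tailMass_one : tailMass B k μ 1 = 0 := by simp [tailMass]

theorem strictAntiOn_tailMass (hB : 0 < B) (hk : 0 < k) (hμ : 0 < μ) :
    StrictAntiOn (tailMass B k μ) (Icc 0 1) := by
  refine strictAntiOn_of_deriv_neg (convex_Icc 0 1) (continuous_tailMass hμ).continuousOn ?_
  intro x hx
  rw [interior_Icc] at hx
  rw [(hasStrictDerivAt_tailMass hμ x).hasDerivAt.deriv, neg_lt_zero]
  exact tailDensity_pos hB hk hμ (by linarith [hx.1]) hx.2

theorem tailMass_pos (hB : 0 < B) (hk : 0 < k) (hμ : 0 < μ) {s : ℝ} (h0 : 0 ≤ s) (h1 : s < 1) :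
    0 < tailMass B k μ s := by
  rw [← tailMass_one (B := B) (k := k) (μ := μ)]
  exact strictAntiOn_tailMass hB hk hμ ⟨h0, h1.le⟩ ⟨zero_le_one, le_rfl⟩ h1

theorem tailMass_nonneg (hB : 0 < B) (hk : 0 < k) (hμ : 0 < μ) {s : ℝ} (h0 : 0 ≤ s)
    (h1 : s ≤ 1) : 0 ≤ tailMass B k μ s := by
  rcases h1.eq_or_lt with rfl | h1
  · rw [tailMass_one]
  · exact (tailMass_pos hB hk hμ h0 h1).le

/-- The density decreases in `σ`, so its value at `s` bounds it, and `1 - s ≤ 1 - s²`. The extra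
factor `B(1 - s²)` later absorbs the singular coefficient of the potential as the slope tends to
`1`. -/
theorem tailMass_le (hB : 0 < B) (hk : 0 < k) (hμ : 0 < μ) {s : ℝ} (h0 : 0 ≤ s) (h1 : s ≤ 1) :
    tailMass B k μ s ≤ (B * (1 - s ^ 2)) * (B * (1 - s ^ 2)) ^ (1 / μ) / (μ * k) := by
  have hb : 0 ≤ B * (1 - s ^ 2) := mul_nonneg hB.le (by nlinarith)
  have h2 : tailMass B k μ s ≤ ∫ _ in s..1, B / (μ * k) * (B * (1 - s ^ 2)) ^ (1 / μ) := by
    refine intervalIntegral.integral_mono_on h1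
      ((continuous_tailDensity hμ).intervalIntegrable _ _)
      (continuous_const.intervalIntegrable _ _) fun σ hσ => ?_
    unfold tailDensity
    refine mul_le_mul_of_nonneg_left (Real.rpow_le_rpow (mul_nonneg hB.le ?_) ?_ ?_) ?_
    · nlinarith [hσ.1, hσ.2]
    · exact mul_le_mul_of_nonneg_left (by nlinarith [hσ.1]) hB.le
    · positivity
    · positivity
  refine h2.trans ?_
  rw [intervalIntegral.integral_const, smul_eq_mul]
  have hE : 0 ≤ (B * (1 - s ^ 2)) ^ (1 / μ) := Real.rpow_nonneg hb _
  have : (1 - s) * (B / (μ * k) * (B * (1 - s ^ 2)) ^ (1 / μ)) =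
      (B * (1 - s)) * ((B * (1 - s ^ 2)) ^ (1 / μ) / (μ * k)) := by ring
  rw [this, mul_div_assoc]
  refine mul_le_mul_of_nonneg_right (mul_le_mul_of_nonneg_left ?_ hB.le) (by positivity)
  nlinarith

theorem tailMassInv_tailMass (hB : 0 < B) (hk : 0 < k) (hμ : 0 < μ) {s : ℝ}
    (hs : s ∈ Icc (0 : ℝ) 1) : tailMassInv B k μ (tailMass B k μ s) = s :=
  (strictAntiOn_tailMass hB hk hμ).injOn.leftInvOn_invFunOn hs

theorem hasDerivAt_tailMassInv (hB : 0 < B) (hk : 0 < k) (hμ : 0 < μ) {s : ℝ}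
    (hs : s ∈ Ioo (0 : ℝ) 1) :
    HasDerivAt (tailMassInv B k μ) (-tailDensity B k μ s)⁻¹ (tailMass B k μ s) := by
  refine HasStrictDerivAt.hasDerivAt ((hasStrictDerivAt_tailMass hμ s).to_local_left_inverse
    (neg_ne_zero.2 (tailDensity_pos hB hk hμ (by linarith [hs.1]) hs.2).ne') ?_)
  filter_upwards [Ioo_mem_nhds hs.1 hs.2] with x hx
  exact tailMassInv_tailMass hB hk hμ ⟨hx.1.le, hx.2.le⟩

/-- The soliton amplitude at logarithmic slope `s`, raised to the power `2 μ`. -/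
def ampPow (B s : ℝ) : ℝ := B * (1 - s ^ 2)

theorem ampPow_pos (hB : 0 < B) {s : ℝ} (h1 : -1 < s) (h2 : s < 1) : 0 < ampPow B s :=
  mul_pos hB (one_sub_sq_pos h1 h2)

end TailMass

/-! ### Two Young inequalities with equality cases -/

section Scalar

variable {μ : ℝ}

/-- This is Bernoulli's inequality at `1` with exponent `(3μ+2)/(2μ) > 1`, multiplied by `2μ/(μ+2)`;
strictness away from `1` gives the equality case. -/
theorem rpow_bernoulli_interior (hμ : 0 < μ) {y : ℝ} (hy : 0 ≤ y) :
    0 ≤ 1 + 2 * μ / (μ + 2) * y ^ ((3 * μ + 2) / (2 * μ)) - (3 * μ + 2) / (μ + 2) * y ∧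
    (1 + 2 * μ / (μ + 2) * y ^ ((3 * μ + 2) / (2 * μ)) - (3 * μ + 2) / (μ + 2) * y = 0 →
      y = 1) := by
  have hq : 1 < (3 * μ + 2) / (2 * μ) := by
    rw [lt_div_iff₀ (by positivity)]
    linarith
  have e : ∀ Y : ℝ, 1 + 2 * μ / (μ + 2) * Y - (3 * μ + 2) / (μ + 2) * y =
      2 * μ / (μ + 2) * (Y - (1 + (3 * μ + 2) / (2 * μ) * (y - 1))) := by
    intro Y
    field_simp
    ring
  rw [e]
  have hc : 0 < 2 * μ / (μ + 2) := by positivity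
  constructor
  · have := one_add_mul_self_le_rpow_one_add (s := y - 1) (by linarith) hq.le
    rw [add_sub_cancel] at this
    exact mul_nonneg hc.le (by linarith)
  · intro h
    by_contra hne
    have := one_add_mul_self_lt_rpow_one_add (s := y - 1) (by linarith) (sub_ne_zero.2 hne) hq
    rw [add_sub_cancel] at this
    have := mul_pos hc (sub_pos.2 this)
    linarith

theorem rpow_bernoulli_boundary (hμ : 0 < μ) {z : ℝ} (hz : 0 ≤ z) :
    z ≤ 2 / (μ + 2) * z ^ ((μ + 2) / 2) + μ / (μ + 2) ∧
    (z = 2 / (μ + 2) * z ^ ((μ + 2) / 2) + μ / (μ + 2) → z = 1) := by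
  have hq : 1 < (μ + 2) / 2 := by linarith
  have e : ∀ Y : ℝ, 2 / (μ + 2) * Y + μ / (μ + 2) - z =
      2 / (μ + 2) * (Y - (1 + (μ + 2) / 2 * (z - 1))) := by
    intro Y
    field_simp
    ring
  have hc : 0 < 2 / (μ + 2) := by positivity
  constructor
  · have := one_add_mul_self_le_rpow_one_add (s := z - 1) (by linarith) hq.le
    rw [add_sub_cancel] at this
    have := mul_nonneg hc.le (sub_nonneg.2 this)
    rw [← e] at this
    linarith
  · intro h
    by_contra hne
    have := one_add_mul_self_lt_rpow_one_add (s := z - 1) (by linarith) (sub_ne_zero.2 hne) hq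
    rw [add_sub_cancel] at this
    have := mul_pos hc (sub_pos.2 this)
    rw [← e] at this
    linarith

/-- Bernoulli's inequality at `y = N^μ / b`. Here `N` stands for `|f|²` and `b^(1/μ)` for the
squared soliton amplitude, and the expression is the bracket occurring in `deficit`. -/
theorem young_interior (hμ : 0 < μ) {N b : ℝ} (hN : 0 ≤ N) (hb : 0 < b) :
    0 ≤ 1 + 2 * μ / (μ + 2) * ((N ^ (μ / 2)) ^ 3 * (b ^ (-(1 / 2) : ℝ) / b) * N / b ^ (1 / μ)) -
      (3 * μ + 2) / (μ + 2) * ((N ^ (μ / 2)) ^ 2 / b) ∧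
    (1 + 2 * μ / (μ + 2) * ((N ^ (μ / 2)) ^ 3 * (b ^ (-(1 / 2) : ℝ) / b) * N / b ^ (1 / μ)) -
      (3 * μ + 2) / (μ + 2) * ((N ^ (μ / 2)) ^ 2 / b) = 0 → N = b ^ (1 / μ)) := by
  have e1 : (N ^ (μ / 2)) ^ 2 = N ^ μ := by
    rw [← Real.rpow_natCast, ← Real.rpow_mul hN]
    congr 1
    push_cast
    ring
  have e2 : (N ^ (μ / 2)) ^ 3 * (b ^ (-(1 / 2) : ℝ) / b) * N / b ^ (1 / μ) =
      (N ^ μ / b) ^ ((3 * μ + 2) / (2 * μ)) := by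
    have h1 : (N ^ (μ / 2)) ^ 3 * N = N ^ ((3 * μ + 2) / 2) := by
      rw [← Real.rpow_natCast, ← Real.rpow_mul hN]
      nth_rewrite 2 [← Real.rpow_one N]
      rw [← Real.rpow_add_of_nonneg hN (by positivity) zero_le_one]
      congr 1
      push_cast
      ring
    have h2 : b ^ ((3 * μ + 2) / (2 * μ)) = b * b ^ (1 / μ) / b ^ (-(1 / 2) : ℝ) := by
      nth_rewrite 2 [← Real.rpow_one b]
      rw [← Real.rpow_add hb, ← Real.rpow_sub hb]
      congr 1
      field_simp
      ring
    rw [Real.div_rpow (by positivity) hb.le, ← Real.rpow_mul hN, h2]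
    have h3 : μ * ((3 * μ + 2) / (2 * μ)) = (3 * μ + 2) / 2 := by field_simp
    rw [h3, ← h1]
    have := Real.rpow_pos_of_pos hb (1 / μ)
    have := Real.rpow_pos_of_pos hb (-(1 / 2) : ℝ)
    field_simp
  rw [e1, e2]
  have h := rpow_bernoulli_interior hμ (y := N ^ μ / b) (by positivity)
  refine ⟨h.1, fun h0 => ?_⟩
  have h1 := h.2 h0
  rw [div_eq_one_iff_eq hb.ne'] at h1
  rw [← h1, ← Real.rpow_mul hN, mul_one_div_cancel hμ.ne', Real.rpow_one]

/-- Bernoulli's inequality with exponent `(μ+2)/2` at `z = N / b^(1/μ)`. It replaces the nonlinear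
end-point term of the potential by the quadratic `|f(0)|²`. -/
theorem young_boundary (hμ : 0 < μ) {N b : ℝ} (hN : 0 ≤ N) (hb : 0 < b) :
    N ≤ 2 / (μ + 2) * (b ^ (-(1 / 2) : ℝ) * N ^ ((μ + 2) / 2)) + μ / (μ + 2) * b ^ (1 / μ) ∧
    (N = 2 / (μ + 2) * (b ^ (-(1 / 2) : ℝ) * N ^ ((μ + 2) / 2)) + μ / (μ + 2) * b ^ (1 / μ) →
      N = b ^ (1 / μ)) := by
  have hE := Real.rpow_pos_of_pos hb (1 / μ)
  have e : b ^ (-(1 / 2) : ℝ) * N ^ ((μ + 2) / 2) =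
      b ^ (1 / μ) * (N / b ^ (1 / μ)) ^ ((μ + 2) / 2) := by
    rw [Real.div_rpow hN hE.le, ← Real.rpow_mul hb.le]
    have : b ^ (1 / μ * ((μ + 2) / 2)) = b ^ (1 / μ) / b ^ (-(1 / 2) : ℝ) := by
      rw [← Real.rpow_sub hb]
      congr 1
      field_simp
      ring
    rw [this]
    have := Real.rpow_pos_of_pos hb (-(1 / 2) : ℝ)
    field_simp
  have h := rpow_bernoulli_boundary hμ (z := N / b ^ (1 / μ)) (by positivity)
  have e' : ∀ Z : ℝ, 2 / (μ + 2) * (b ^ (1 / μ) * Z) + μ / (μ + 2) * b ^ (1 / μ) =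
    (2 / (μ + 2) * Z + μ / (μ + 2)) * b ^ (1 / μ) := fun Z => by ring
  rw [e, e', ← div_le_iff₀ hE, ← div_eq_iff hE.ne']
  exact ⟨h.1, fun h0 => (div_eq_one_iff_eq hE.ne').1 (h.2 h0)⟩

end Scalar

/-! ### The calibration -/

/-- The part of the power norm lying beyond `x`, when the total is `m`. -/
def remMass (μ : ℝ) (f : ℝ → ℂ) (m x : ℝ) : ℝ := m - ∫ y in (0 : ℝ)..x, ‖f y‖ ^ (2 * μ + 2)

/-- The logarithmic slope of the soliton tail whose power norm equals the part of the power norm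
of `f` lying beyond `x`. -/
def tailSlope (B k μ : ℝ) (f : ℝ → ℂ) (t x : ℝ) : ℝ :=
  tailMassInv B k μ (remMass μ f (tailMass B k μ t) x)

/-- The calibrating potential for the action on the half-line. -/
def potential (B k μ : ℝ) (f : ℝ → ℂ) (t x : ℝ) : ℝ :=
  k * tailSlope B k μ f t x *
      (2 / (μ + 2) * (ampPow B (tailSlope B k μ f t x) ^ (-(1 / 2) : ℝ) *
        Complex.normSq (f x) ^ ((μ + 2) / 2)) +
        μ / (μ + 2) * ampPow B (tailSlope B k μ f t x) ^ (1 / μ)) +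
    (μ + 1) * k ^ 2 / B * remMass μ f (tailMass B k μ t) x

/-- The non-negative deficit density in the calibration of the action. -/
def deficit (B k μ : ℝ) (f g : ℝ → ℂ) (t x : ℝ) : ℝ :=
  ‖g x + ((k * tailSlope B k μ f t x * ampPow B (tailSlope B k μ f t x) ^ (-(1 / 2) : ℝ) *
      Complex.normSq (f x) ^ (μ / 2) : ℝ) : ℂ) * f x‖ ^ 2 +
    k ^ 2 * Complex.normSq (f x) *
      (1 + 2 * μ / (μ + 2) * ((Complex.normSq (f x) ^ (μ / 2)) ^ 3 *
        (ampPow B (tailSlope B k μ f t x) ^ (-(1 / 2) : ℝ) / ampPow B (tailSlope B k μ f t x)) *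
        Complex.normSq (f x) / ampPow B (tailSlope B k μ f t x) ^ (1 / μ)) -
      (3 * μ + 2) / (μ + 2) * ((Complex.normSq (f x) ^ (μ / 2)) ^ 2 /
        ampPow B (tailSlope B k μ f t x)))

section

variable {B k μ : ℝ} {f g : ℝ → ℂ} {t : ℝ}

theorem continuous_norm_rpow (hf : Continuous f) (hμ : 0 < μ) :
    Continuous fun x => ‖f x‖ ^ (2 * μ + 2) :=
  hf.norm.rpow_const fun _ => Or.inr (by linarith)

theorem hasDerivAt_remMass (hf : Continuous f) (hμ : 0 < μ) (m x : ℝ) :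
    HasDerivAt (remMass μ f m) (-‖f x‖ ^ (2 * μ + 2)) x :=
  (intervalIntegral.integral_hasDerivAt_right
    ((continuous_norm_rpow hf hμ).intervalIntegrable _ _)
    ((continuous_norm_rpow hf hμ).stronglyMeasurableAtFilter _ _)
    (continuous_norm_rpow hf hμ).continuousAt).const_sub m

theorem continuous_remMass (hf : Continuous f) (hμ : 0 < μ) (m : ℝ) :
    Continuous (remMass μ f m) :=
  continuous_iff_continuousAt.2 fun x => (hasDerivAt_remMass hf hμ m x).continuousAt

theorem antitone_remMass (hf : Continuous f) (hμ : 0 < μ) (m : ℝ) :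
    Antitone (remMass μ f m) :=
  antitone_of_hasDerivAt_nonpos (hasDerivAt_remMass hf hμ m) fun x => by
    have : 0 ≤ ‖f x‖ ^ (2 * μ + 2) := by positivity
    simpa using this

theorem remMass_zero (m : ℝ) : remMass μ f m 0 = m := by simp [remMass]

theorem HalfLineH1.tendsto_remMass (h : HalfLineH1 f g) (hμ : 0 < μ) {m : ℝ}
    (hm : ∫ x in Ioi (0 : ℝ), ‖f x‖ ^ (2 * μ + 2) = m) :
    Tendsto (remMass μ f m) atTop (𝓝 0) := by
  have := (intervalIntegral_tendsto_integral_Ioi 0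
    (h.integrableOn_rpow (q := 2 * μ + 2) (by linarith)) tendsto_id).const_sub m
  rwa [hm, sub_self] at this

/-- The remaining power norm decreases continuously from `M(t)` to `0`, and `M(σ) > 0` because `σ <
1`; so it is reached at a finite point. -/
theorem HalfLineH1.exists_remMass_eq (h : HalfLineH1 f g) (hB : 0 < B) (hk : 0 < k)
    (hμ : 0 < μ) (ht : 0 < t)
    (hm : ∫ x in Ioi (0 : ℝ), ‖f x‖ ^ (2 * μ + 2) = tailMass B k μ t) {σ : ℝ}
    (hσ : σ ∈ Ico t 1) :
    ∃ X, 0 ≤ X ∧ remMass μ f (tailMass B k μ t) X = tailMass B k μ σ := by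
  have hp := tailMass_pos hB hk hμ (ht.le.trans hσ.1) hσ.2
  obtain ⟨Y, hY, hY0⟩ := ((h.tendsto_remMass hμ hm).eventually (gt_mem_nhds hp)).and
    (eventually_ge_atTop 0) |>.exists
  have hle : tailMass B k μ σ ≤ tailMass B k μ t :=
    (strictAntiOn_tailMass hB hk hμ).antitoneOn ⟨ht.le, hσ.1.trans hσ.2.le⟩
      ⟨ht.le.trans hσ.1, hσ.2.le⟩ hσ.1
  obtain ⟨X, hX, hXe⟩ := intermediate_value_Icc' hY0
    (continuous_remMass h.continuous hμ (tailMass B k μ t)).continuousOn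
    ⟨hY.le, by rwa [remMass_zero]⟩
  exact ⟨X, hX.1, hXe⟩

/-- Up to `X` the slope stays in `[t, σ]`, away from `0` and from `1`. There the inverse of
`tailMass` is genuine and differentiable; at slope `1` the density vanishes. -/
theorem tailSlope_spec (hf : Continuous f) (hB : 0 < B) (hk : 0 < k) (hμ : 0 < μ) (ht : 0 < t)
    {σ X : ℝ} (hσ : σ ∈ Ico t 1) (hX : remMass μ f (tailMass B k μ t) X = tailMass B k μ σ)
    {x : ℝ} (hx : x ∈ Icc 0 X) :
    tailSlope B k μ f t x ∈ Icc t σ ∧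
      tailMass B k μ (tailSlope B k μ f t x) = remMass μ f (tailMass B k μ t) x := by
  have h1 := antitone_remMass hf hμ (tailMass B k μ t) hx.1
  have h2 := antitone_remMass hf hμ (tailMass B k μ t) hx.2
  rw [remMass_zero] at h1
  rw [hX] at h2
  obtain ⟨s, hs, hse⟩ := intermediate_value_Icc' hσ.1
    (continuous_tailMass (B := B) (k := k) hμ).continuousOn ⟨h2, h1⟩
  have : tailSlope B k μ f t x = s := by
    rw [tailSlope, ← hse]
    exact tailMassInv_tailMass hB hk hμ ⟨ht.le.trans hs.1, hs.2.trans hσ.2.le⟩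
  rw [this]
  exact ⟨hs, hse⟩

theorem hasDerivAt_tailSlope (hf : Continuous f) (hB : 0 < B) (hk : 0 < k) (hμ : 0 < μ)
    (ht : 0 < t) {σ X : ℝ} (hσ : σ ∈ Ico t 1)
    (hX : remMass μ f (tailMass B k μ t) X = tailMass B k μ σ) {x : ℝ} (hx : x ∈ Icc 0 X) :
    HasDerivAt (tailSlope B k μ f t)
      (‖f x‖ ^ (2 * μ + 2) / tailDensity B k μ (tailSlope B k μ f t x)) x := by
  have hs := tailSlope_spec hf hB hk hμ ht hσ hX hx
  have h1 := hasDerivAt_tailMassInv hB hk hμ (s := tailSlope B k μ f t x)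
    ⟨ht.trans_le hs.1.1, hs.1.2.trans_lt hσ.2⟩
  rw [hs.2] at h1
  convert! h1.comp x (hasDerivAt_remMass hf hμ _ x) using 1
  rw [inv_neg, neg_mul_neg, div_eq_mul_inv, mul_comm]

theorem hasDerivAt_mul_ampPow_rpow (hB : 0 < B) {s : ℝ} (h1 : -1 < s) (h2 : s < 1) (r : ℝ) :
    HasDerivAt (fun s => s * ampPow B s ^ r)
      (ampPow B s ^ r + s * (r * (ampPow B s ^ r / ampPow B s) * (-2 * B * s))) s := by
  have hb := ampPow_pos hB h1 h2
  have h3 : HasDerivAt (ampPow B) (-2 * B * s) s := by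
    have := ((hasDerivAt_pow 2 s).const_sub 1).const_mul B
    convert! this using 1
    push_cast
    ring
  convert! (hasDerivAt_id s).mul (h3.rpow_const (p := r) (Or.inl hb.ne')) using 1
  rw [Real.rpow_sub_one hb.ne']
  simp only [id]
  ring

theorem continuousOn_deriv_mul_ampPow_rpow (hB : 0 < B) (r : ℝ) :
    ContinuousOn (fun s => ampPow B s ^ r +
      s * (r * (ampPow B s ^ r / ampPow B s) * (-2 * B * s))) (Ioo (-1) 1) := by
  have hc : Continuous (ampPow B) := by unfold ampPow; fun_prop
  have hn : ∀ s ∈ Ioo (-1 : ℝ) 1, ampPow B s ≠ 0 := fun s hs => (ampPow_pos hB hs.1 hs.2).ne'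
  have h1 : ContinuousOn (fun s => ampPow B s ^ r) (Ioo (-1) 1) :=
    hc.continuousOn.rpow_const fun s hs => Or.inl (hn s hs)
  have h2 := h1.div hc.continuousOn hn
  fun_prop

/-- The pointwise algebra of the calibration. The letters stand for `N = |f|²`, `W = |f|^μ`, `ρ =
Re(f̄ g)`, `G = |g|²`, `h = b^(-1/2)` and `E = b^(1/μ)`; the quotient `W²N / (B/(μk) E)` is the
derivative of the slope. The left side is the derivative of the potential, the right side the
deficit minus the action density. -/
theorem calibration_identity (hB : B ≠ 0) (hμ : 0 < μ) {s b h E W N ρ G : ℝ}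
    (hs : 1 - s ^ 2 ≠ 0) (hb : b = B * (1 - s ^ 2)) (hh : h ^ 2 = b⁻¹) (hE : E ≠ 0) :
    (2 * k / (μ + 2) * (W ^ 2 * N / (B / (μ * k) * E) *
        (h + s * (-(1 / 2) * (h / b) * (-2 * B * s)))) * (W * N) +
      2 * k / (μ + 2) * (s * h) * (2 * ((μ + 2) / 2) * W * ρ)) +
      (μ * k / (μ + 2) * (W ^ 2 * N / (B / (μ * k) * E) *
        (E + s * (1 / μ * (E / b) * (-2 * B * s)))) +
        (μ + 1) * k ^ 2 / B * -(W ^ 2 * N)) =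
    G + 2 * (k * s * h * W) * ρ + (k * s * h * W) ^ 2 * N +
      k ^ 2 * N * (1 + 2 * μ / (μ + 2) * (W ^ 3 * (h / b) * N / E) -
        (3 * μ + 2) / (μ + 2) * (W ^ 2 / b)) - (G + k ^ 2 * N) := by
  have e : (k * s * h * W) ^ 2 * N = k ^ 2 * s ^ 2 * b⁻¹ * W ^ 2 * N := by rw [← hh]; ring
  rw [e, hb]
  have : μ + 2 ≠ 0 := by positivity
  field_simp
  ring

theorem norm_add_real_mul_sq (z w : ℂ) (c : ℝ) :
    ‖w + (c : ℂ) * z‖ ^ 2 = ‖w‖ ^ 2 + 2 * c * (z.re * w.re + z.im * w.im) +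
      c ^ 2 * Complex.normSq z := by
  simp only [← Complex.normSq_eq_norm_sq, Complex.normSq_apply, Complex.add_re, Complex.add_im,
    Complex.mul_re, Complex.mul_im, Complex.ofReal_re, Complex.ofReal_im]
  ring

theorem norm_rpow_eq_normSq_rpow (z : ℂ) (q : ℝ) : ‖z‖ ^ (2 * q) = Complex.normSq z ^ q := by
  rw [Complex.normSq_eq_norm_sq, ← Real.rpow_natCast, ← Real.rpow_mul (norm_nonneg _)]
  norm_num

/-- The action density differs from an exact derivative by the deficit density. -/
theorem HalfLinePrimitive.integral_deficit (h : HalfLinePrimitive f g) (hB : 0 < B) (hk : 0 < k)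
    (hμ : 0 < μ) (ht : 0 < t) {σ X : ℝ} (hσ : σ ∈ Ico t 1) (hX0 : 0 ≤ X)
    (hX : remMass μ f (tailMass B k μ t) X = tailMass B k μ σ) :
    IntervalIntegrable (fun x => deficit B k μ f g t x - (‖g x‖ ^ 2 + k ^ 2 * ‖f x‖ ^ 2))
      volume 0 X ∧
    ∫ x in (0 : ℝ)..X, (deficit B k μ f g t x - (‖g x‖ ^ 2 + k ^ 2 * ‖f x‖ ^ 2)) =
      potential B k μ f t X - potential B k μ f t 0 := by
  have hf := h.continuous
  set s := tailSlope B k μ f t with hsdef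
  have hs : ∀ x ∈ Icc 0 X, s x ∈ Icc t σ := fun x hx =>
    (tailSlope_spec hf hB hk hμ ht hσ hX hx).1
  have hs' : ∀ x ∈ Icc 0 X, s x ∈ Ioo (-1 : ℝ) 1 := fun x hx =>
    ⟨by linarith [(hs x hx).1], (hs x hx).2.trans_lt hσ.2⟩
  set s' : ℝ → ℝ := fun x => ‖f x‖ ^ (2 * μ + 2) / tailDensity B k μ (s x) with hs'def
  have hsd : ∀ x ∈ Icc 0 X, HasDerivAt s (s' x) x := fun x hx =>
    hasDerivAt_tailSlope hf hB hk hμ ht hσ hX hx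
  have hsc : ContinuousOn s (Icc 0 X) := fun x hx => (hsd x hx).continuousAt.continuousWithinAt
  have hs'c : ContinuousOn s' (Icc 0 X) :=
    (continuous_norm_rpow hf hμ).continuousOn.div
      ((continuous_tailDensity hμ).comp_continuousOn hsc)
      fun x hx => (tailDensity_pos hB hk hμ (hs' x hx).1 (hs' x hx).2).ne'
  set D : ℝ → ℝ → ℝ := fun r s => ampPow B s ^ r +
      s * (r * (ampPow B s ^ r / ampPow B s) * (-2 * B * s)) with hD
  have hA : ∀ r : ℝ, ∀ x ∈ Icc 0 X,
      HasDerivAt (fun x => s x * ampPow B (s x) ^ r) (s' x * D r (s x)) x := by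
    intro r x hx
    have := (hasDerivAt_mul_ampPow_rpow hB (hs' x hx).1 (hs' x hx).2 r).comp x (hsd x hx)
    rwa [mul_comm] at this
  have hAc : ∀ r : ℝ, ContinuousOn (fun x => s' x * D r (s x)) (Icc 0 X) := fun r =>
    hs'c.mul ((continuousOn_deriv_mul_ampPow_rpow hB r).comp hsc hs')
  have hα : ∀ x ∈ Icc 0 X, HasDerivAt
      (fun x => 2 * k / (μ + 2) * (s x * ampPow B (s x) ^ (-(1 / 2) : ℝ)))
      (2 * k / (μ + 2) * (s' x * D (-(1 / 2)) (s x))) x := fun x hx => (hA _ x hx).const_mul _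
  have hβ : ∀ x ∈ Icc 0 X, HasDerivAt
      (fun x => μ * k / (μ + 2) * (s x * ampPow B (s x) ^ (1 / μ)) +
        (μ + 1) * k ^ 2 / B * remMass μ f (tailMass B k μ t) x)
      (μ * k / (μ + 2) * (s' x * D (1 / μ) (s x)) +
        (μ + 1) * k ^ 2 / B * -‖f x‖ ^ (2 * μ + 2)) x := fun x hx =>
    ((hA _ x hx).const_mul _).add ((hasDerivAt_remMass hf hμ _ x).const_mul _)
  have hαac := absolutelyContinuousOnInterval_of_hasDerivAt hX0 hα
    (continuousOn_const.mul (hAc _))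
  have hβac := absolutelyContinuousOnInterval_of_hasDerivAt hX0 hβ
    ((continuousOn_const.mul (hAc _)).add
      (continuousOn_const.mul (continuous_norm_rpow hf hμ).neg.continuousOn))
  have hq : 1 ≤ (μ + 2) / 2 := by linarith
  -- The factors built from the slope are differentiable everywhere on `[0, X]`; only `|f|^(μ+2)`
  -- has its derivative merely almost everywhere.
  have hP : potential B k μ f t = fun x =>
      2 * k / (μ + 2) * (s x * ampPow B (s x) ^ (-(1 / 2) : ℝ)) *
        Complex.normSq (f x) ^ ((μ + 2) / 2) +
      (μ * k / (μ + 2) * (s x * ampPow B (s x) ^ (1 / μ)) +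
        (μ + 1) * k ^ 2 / B * remMass μ f (tailMass B k μ t) x) := by
    funext x
    rw [potential]
    ring
  have hac : AbsolutelyContinuousOnInterval (potential B k μ f t) 0 X := by
    rw [hP]
    exact (hαac.fun_mul (h.absolutelyContinuous_normSq_rpow hq hX0)).fun_add hβac
  refine hac.integral_eq_sub_of_ae_hasDerivAt hX0 ?_
  filter_upwards [h.ae_hasDerivAt_normSq_rpow hq] with x hx hxX
  have hxI : x ∈ Icc 0 X := ⟨hxX.1.le, hxX.2.le⟩
  have hd := ((hα x hxI).mul (hx hxX.1)).add (hβ x hxI)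
  rw [hP]
  refine HasDerivAt.congr_deriv hd ?_
  have hb := ampPow_pos hB (hs' x hxI).1 (hs' x hxI).2
  have hN := Complex.normSq_nonneg (f x)
  have e1 : Complex.normSq (f x) ^ ((μ + 2) / 2) =
      Complex.normSq (f x) ^ (μ / 2) * Complex.normSq (f x) := by
    nth_rewrite 3 [← Real.rpow_one (Complex.normSq (f x))]
    rw [← Real.rpow_add_of_nonneg hN (by positivity) zero_le_one]
    congr 1
    ring
  have e2 : ‖f x‖ ^ (2 * μ + 2) = (Complex.normSq (f x) ^ (μ / 2)) ^ 2 * Complex.normSq (f x) := by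
    rw [show 2 * μ + 2 = 2 * (μ + 1) by ring, norm_rpow_eq_normSq_rpow,
      Real.rpow_add_of_nonneg hN hμ.le zero_le_one, Real.rpow_one, ← Real.rpow_natCast,
      ← Real.rpow_mul hN]
    congr 2
    push_cast
    ring
  have e3 : (μ + 2) / 2 - 1 = μ / 2 := by ring
  have hh : (ampPow B (s x) ^ (-(1 / 2) : ℝ)) ^ 2 = (ampPow B (s x))⁻¹ := by
    rw [← Real.rpow_natCast, ← Real.rpow_mul hb.le, ← Real.rpow_neg_one]
    norm_num
  simp only [hs'def, hD, deficit, ← hsdef]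
  rw [e1, e2, e3, norm_add_real_mul_sq, ← Complex.normSq_eq_norm_sq (f x), tailDensity]
  exact calibration_identity hB.ne' hμ (one_sub_sq_pos (hs' x hxI).1 (hs' x hxI).2).ne' rfl
    hh (Real.rpow_pos_of_pos hb _).ne'

end

/-! ### The sharp inequality on the half-line -/

section

variable {B k μ : ℝ} {f g : ℝ → ℂ} {t : ℝ}

theorem deficit_nonneg (hB : 0 < B) (hμ : 0 < μ) {x : ℝ}
    (h1 : -1 < tailSlope B k μ f t x) (h2 : tailSlope B k μ f t x < 1) :
    0 ≤ deficit B k μ f g t x := by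
  have := (young_interior hμ (Complex.normSq_nonneg (f x)) (ampPow_pos hB h1 h2)).1
  have hN := Complex.normSq_nonneg (f x)
  unfold deficit
  positivity

theorem integral_mul_le_sqrt_mul_sqrt {X Y : ℝ} {u v : ℝ → ℝ} (hXY : X ≤ Y)
    (hu : ∀ x, 0 ≤ u x) (hv : ∀ x, 0 ≤ v x)
    (hu2 : MemLp u 2 (volume.restrict (Ioc X Y))) (hv2 : MemLp v 2 (volume.restrict (Ioc X Y))) :
    ∫ x in X..Y, u x * v x ≤ √(∫ x in X..Y, u x ^ 2) * √(∫ x in X..Y, v x ^ 2) := by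
  have h := integral_mul_le_Lp_mul_Lq_of_nonneg (μ := volume.restrict (Ioc X Y))
    (p := 2) (q := 2) (f := u) (g := v) Real.HolderConjugate.two_two
    (Eventually.of_forall hu) (Eventually.of_forall hv) (by simpa using hu2) (by simpa using hv2)
  simp only [intervalIntegral.integral_of_le hXY, Real.sqrt_eq_rpow]
  simpa using h

/-- Integrate the derivative of `|f|^(μ+2)`, which is at most `(μ+2)|f|^(μ+1)|g|` in modulus, from
`X` outwards and apply Cauchy-Schwarz. The point is that the decay is measured by the remaining
power norm. -/
theorem HalfLineH1.normSq_rpow_le (h : HalfLineH1 f g) (hμ : 0 < μ) {m : ℝ}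
    (hm : ∫ x in Ioi (0 : ℝ), ‖f x‖ ^ (2 * μ + 2) = m) {X : ℝ} (hX : 0 ≤ X) :
    Complex.normSq (f X) ^ ((μ + 2) / 2) ≤
      (μ + 2) * (√(remMass μ f m X) * √(∫ x in Ioi (0 : ℝ), ‖g x‖ ^ 2)) := by
  have hq : 1 ≤ (μ + 2) / 2 := by linarith
  set w : ℝ → ℝ := fun x => Complex.normSq (f x) ^ ((μ + 2) / 2) with hw
  set K := (μ + 2) * (√(remMass μ f m X) * √(∫ x in Ioi (0 : ℝ), ‖g x‖ ^ 2)) with hK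
  have hstep : ∀ Y, X ≤ Y → w X ≤ w Y + K := by
    intro Y hXY
    have hY := hX.trans hXY
    have hd := AbsolutelyContinuousOnInterval.integral_eq_sub_of_ae_hasDerivAt hXY
      ((h.absolutelyContinuous_normSq_rpow hq hY).mono (c := X) (d := Y) (by
        rw [uIcc_of_le hXY, uIcc_of_le hY]
        exact Icc_subset_Icc_left hX))
      ((h.ae_hasDerivAt_normSq_rpow hq).mono fun y hy hy' => hy (hX.trans_lt hy'.1))
    have hu2 : MemLp (fun x => ‖f x‖ ^ (μ + 1)) 2 (volume.restrict (Ioc X Y)) := by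
      have hc : Continuous fun x => ‖f x‖ ^ (μ + 1) :=
        h.continuous.norm.rpow_const fun x => Or.inr (by linarith)
      rw [memLp_two_iff_integrable_sq hc.aestronglyMeasurable]
      exact (hc.pow 2).integrableOn_Ioc
    have hv2 : MemLp (fun x => ‖g x‖) 2 (volume.restrict (Ioc X Y)) :=
      (h.memLp_deriv.mono_measure (Measure.restrict_mono
        (fun x hx => hX.trans_lt hx.1) le_rfl)).norm
    have hprod : IntervalIntegrable (fun x => ‖f x‖ ^ (μ + 1) * ‖g x‖) volume X Y := by
      rw [intervalIntegrable_iff_integrableOn_Ioc_of_le hXY]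
      exact hu2.integrable_mul hv2
    have hcs := integral_mul_le_sqrt_mul_sqrt hXY (u := fun x => ‖f x‖ ^ (μ + 1))
      (v := fun x => ‖g x‖) (fun x => by positivity) (fun x => norm_nonneg _) hu2 hv2
    have e1 : ∫ x in X..Y, (‖f x‖ ^ (μ + 1)) ^ 2 ≤ remMass μ f m X := by
      have hc := continuous_norm_rpow h.continuous hμ
      have : ∫ x in X..Y, (‖f x‖ ^ (μ + 1)) ^ 2 = remMass μ f m X - remMass μ f m Y := by
        have e : ∀ x, (‖f x‖ ^ (μ + 1)) ^ 2 = ‖f x‖ ^ (2 * μ + 2) := fun x => by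
          rw [← Real.rpow_natCast, ← Real.rpow_mul (norm_nonneg _)]
          congr 1
          push_cast
          ring
        simp only [e, remMass]
        rw [← intervalIntegral.integral_interval_sub_left (hc.intervalIntegrable 0 Y)
          (hc.intervalIntegrable 0 X)]
        ring
      have hnn : 0 ≤ remMass μ f m Y :=
        (antitone_remMass h.continuous hμ m).le_of_tendsto (h.tendsto_remMass hμ hm) Y
      linarith
    have e2 : ∫ x in X..Y, ‖g x‖ ^ 2 ≤ ∫ x in Ioi (0 : ℝ), ‖g x‖ ^ 2 := by
      rw [intervalIntegral.integral_of_le hXY]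
      exact setIntegral_mono_set h.integrableOn_sq_deriv
        (Eventually.of_forall fun y => by positivity)
        (show Ioc X Y ⊆ Ioi 0 from fun x hx => hX.trans_lt hx.1).eventuallyLE
    have e3 : -(w Y - w X) ≤ (μ + 2) * ∫ x in X..Y, ‖f x‖ ^ (μ + 1) * ‖g x‖ := by
      rw [← hd.2, ← intervalIntegral.integral_neg, ← intervalIntegral.integral_const_mul]
      refine intervalIntegral.integral_mono_on hXY hd.1.neg (hprod.const_mul _) fun x hx => ?_
      have h1 := (abs_le.1 (HalfLineH1.re_mul_add_im_mul_le (f x) (g x))).1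
      have h2 : Complex.normSq (f x) ^ ((μ + 2) / 2 - 1) * ‖f x‖ = ‖f x‖ ^ (μ + 1) := by
        rw [← norm_rpow_eq_normSq_rpow]
        nth_rewrite 2 [← Real.rpow_one ‖f x‖]
        rw [← Real.rpow_add_of_nonneg (norm_nonneg _) (by linarith) zero_le_one]
        congr 1
        ring
      have h3 : 0 ≤ Complex.normSq (f x) ^ ((μ + 2) / 2 - 1) :=
        Real.rpow_nonneg (Complex.normSq_nonneg _) _
      rw [← h2]
      have h4 := mul_le_mul_of_nonneg_left h1 (mul_nonneg (by linarith : 0 ≤ μ + 2) h3)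
      linarith
    have e4 : √(∫ x in X..Y, (‖f x‖ ^ (μ + 1)) ^ 2) * √(∫ x in X..Y, ‖g x‖ ^ 2) ≤
        √(remMass μ f m X) * √(∫ x in Ioi (0 : ℝ), ‖g x‖ ^ 2) :=
      mul_le_mul (Real.sqrt_le_sqrt e1) (Real.sqrt_le_sqrt e2) (Real.sqrt_nonneg _)
        (Real.sqrt_nonneg _)
    have := mul_le_mul_of_nonneg_left (hcs.trans e4) (by linarith : 0 ≤ μ + 2)
    linarith
  have hwi : IntegrableOn w (Ioi 0) := by
    have := h.integrableOn_rpow (q := 2 * ((μ + 2) / 2)) (by linarith)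
    simpa only [norm_rpow_eq_normSq_rpow] using this
  change w X ≤ K
  refine le_of_forall_pos_le_add fun ε hε => ?_
  -- `w` is integrable on a half-line of infinite length, so it cannot stay above `ε`.
  obtain ⟨Y, hXY, hYε⟩ : ∃ Y, X ≤ Y ∧ w Y ≤ ε := by
    by_contra! hcon
    have h1 : IntegrableOn (fun _ : ℝ => ε) (Ioi X) := by
      refine Integrable.mono' (hwi.mono_set (Ioi_subset_Ioi hX)) aestronglyMeasurable_const ?_
      refine (ae_restrict_iff' measurableSet_Ioi).2 (Eventually.of_forall fun x hx => ?_)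
      rw [Real.norm_of_nonneg hε.le]
      exact (hcon x (le_of_lt hx)).le
    rw [integrableOn_const_iff] at h1
    simp [hε.ne'] at h1
  linarith [hstep Y hXY]

/-- A bound for the potential at the point where the slope equals `σ`. -/
def potentialBound (B k μ G σ : ℝ) : ℝ :=
  k * (2 * (√(ampPow B σ ^ (1 / μ) / (μ * k)) * G) + ampPow B σ ^ (1 / μ)) +
    (μ + 1) * k ^ 2 / B * tailMass B k μ σ

theorem tendsto_potentialBound (hμ : 0 < μ) (G : ℝ) :
    Tendsto (potentialBound B k μ G) (𝓝[<] 1) (𝓝 0) := by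
  have h0 : 0 < 1 / μ := by positivity
  have hE : Continuous fun σ => ampPow B σ ^ (1 / μ) := by
    unfold ampPow
    exact Continuous.rpow_const (by fun_prop) fun _ => Or.inr h0.le
  have hM := continuous_tailMass (B := B) (k := k) hμ
  have hc : Continuous (potentialBound B k μ G) := by
    unfold potentialBound
    fun_prop
  have h1 : potentialBound B k μ G 1 = 0 := by
    simp [potentialBound, ampPow, tailMass_one, Real.zero_rpow h0.ne', -one_div]
  rw [← h1]
  exact (hc.tendsto 1).mono_left nhdsWithin_le_nhds

/-- The coefficient `b^(-1/2)` blows up as the slope tends to `1`, but `|f(X)|^(μ+2)` is bounded by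
a multiple of `√(M(σ))`, which contains a compensating `√b`. Together with `tendsto_potentialBound`
this removes the boundary term at infinity. -/
theorem HalfLineH1.potential_le (h : HalfLineH1 f g) (hB : 0 < B) (hk : 0 < k) (hμ : 0 < μ)
    (ht : 0 < t) (hm : ∫ x in Ioi (0 : ℝ), ‖f x‖ ^ (2 * μ + 2) = tailMass B k μ t) {σ X : ℝ}
    (hσ : σ ∈ Ico t 1) (hX0 : 0 ≤ X)
    (hX : remMass μ f (tailMass B k μ t) X = tailMass B k μ σ) :
    potential B k μ f t X ≤
      potentialBound B k μ (√(∫ x in Ioi (0 : ℝ), ‖g x‖ ^ 2)) σ := by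
  have hσ0 : 0 ≤ σ := ht.le.trans hσ.1
  have hsX : tailSlope B k μ f t X = σ := by
    rw [tailSlope, hX]
    exact tailMassInv_tailMass hB hk hμ ⟨hσ0, hσ.2.le⟩
  have hb := ampPow_pos hB (by linarith : -1 < σ) hσ.2
  have hE := Real.rpow_pos_of_pos hb (1 / μ)
  have hh := Real.rpow_pos_of_pos hb (-(1 / 2) : ℝ)
  have h1 := h.normSq_rpow_le hμ hm hX0
  rw [hX] at h1
  set G := √(∫ x in Ioi (0 : ℝ), ‖g x‖ ^ 2)
  have hG : 0 ≤ G := Real.sqrt_nonneg _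
  have h2 : √(tailMass B k μ σ) ≤ √(ampPow B σ) * √(ampPow B σ ^ (1 / μ) / (μ * k)) := by
    rw [← Real.sqrt_mul hb.le]
    refine Real.sqrt_le_sqrt ?_
    rw [← mul_div_assoc]
    exact tailMass_le hB hk hμ hσ0 hσ.2.le
  have h3 : ampPow B σ ^ (-(1 / 2) : ℝ) * √(ampPow B σ) = 1 := by
    rw [Real.sqrt_eq_rpow, ← Real.rpow_add hb]
    norm_num
  have h4 : ampPow B σ ^ (-(1 / 2) : ℝ) * Complex.normSq (f X) ^ ((μ + 2) / 2) ≤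
      (μ + 2) * (√(ampPow B σ ^ (1 / μ) / (μ * k)) * G) := by
    calc _ ≤ ampPow B σ ^ (-(1 / 2) : ℝ) * ((μ + 2) *
          ((√(ampPow B σ) * √(ampPow B σ ^ (1 / μ) / (μ * k))) * G)) :=
          mul_le_mul_of_nonneg_left (h1.trans (mul_le_mul_of_nonneg_left
            (mul_le_mul_of_nonneg_right h2 hG) (by linarith))) hh.le
      _ = (ampPow B σ ^ (-(1 / 2) : ℝ) * √(ampPow B σ)) *
          ((μ + 2) * (√(ampPow B σ ^ (1 / μ) / (μ * k)) * G)) := by ring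
      _ = _ := by rw [h3, one_mul]
  have hR : 0 ≤ √(ampPow B σ ^ (1 / μ) / (μ * k)) * G := by positivity
  have h5 : 2 / (μ + 2) * (ampPow B σ ^ (-(1 / 2) : ℝ) * Complex.normSq (f X) ^ ((μ + 2) / 2)) +
      μ / (μ + 2) * ampPow B σ ^ (1 / μ) ≤
      2 * (√(ampPow B σ ^ (1 / μ) / (μ * k)) * G) + ampPow B σ ^ (1 / μ) := by
    have e1 : 2 / (μ + 2) * ((μ + 2) * (√(ampPow B σ ^ (1 / μ) / (μ * k)) * G)) =
      2 * (√(ampPow B σ ^ (1 / μ) / (μ * k)) * G) := by field_simp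
    have e2 : μ / (μ + 2) ≤ 1 := by
      rw [div_le_one (by linarith)]
      linarith
    have := mul_le_mul_of_nonneg_left h4 (by positivity : 0 ≤ 2 / (μ + 2))
    have := mul_le_mul_of_nonneg_right e2 hE.le
    linarith
  rw [potential, hsX, hX, potentialBound]
  refine add_le_add ?_ le_rfl
  rw [mul_assoc]
  refine mul_le_mul_of_nonneg_left ?_ hk.le
  refine le_trans (mul_le_of_le_one_left ?_ hσ.2.le) h5
  have := Complex.normSq_nonneg (f X)
  positivity

theorem HalfLineH1.setIntegral_deficit_le (h : HalfLineH1 f g) (hB : 0 < B) (hk : 0 < k)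
    (hμ : 0 < μ) (ht : 0 < t)
    (hm : ∫ x in Ioi (0 : ℝ), ‖f x‖ ^ (2 * μ + 2) = tailMass B k μ t) {σ X : ℝ}
    (hσ : σ ∈ Ico t 1) (hX0 : 0 ≤ X)
    (hX : remMass μ f (tailMass B k μ t) X = tailMass B k μ σ) :
    IntervalIntegrable (deficit B k μ f g t) volume 0 X ∧
    (∀ x ∈ Icc 0 X, 0 ≤ deficit B k μ f g t x) ∧
    ∫ x in (0 : ℝ)..X, deficit B k μ f g t x ≤
      (∫ x in Ioi (0 : ℝ), ‖g x‖ ^ 2) + k ^ 2 * (∫ x in Ioi (0 : ℝ), ‖f x‖ ^ 2) -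
        potential B k μ f t 0 +
        potentialBound B k μ (√(∫ x in Ioi (0 : ℝ), ‖g x‖ ^ 2)) σ := by
  have h1 := h.integral_deficit hB hk hμ ht hσ hX0 hX
  have hI : IntegrableOn (fun x => ‖g x‖ ^ 2 + k ^ 2 * ‖f x‖ ^ 2) (Ioi 0) :=
    h.integrableOn_sq_deriv.add (h.integrableOn_sq.const_mul _)
  have hI' : IntervalIntegrable (fun x => ‖g x‖ ^ 2 + k ^ 2 * ‖f x‖ ^ 2) volume 0 X := by
    rw [intervalIntegrable_iff_integrableOn_Ioc_of_le hX0]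
    exact hI.mono_set Ioc_subset_Ioi_self
  have hD : IntervalIntegrable (deficit B k μ f g t) volume 0 X := by
    simpa using h1.1.add hI'
  refine ⟨hD, fun x hx => ?_, ?_⟩
  · have hs := (tailSlope_spec h.continuous hB hk hμ ht hσ hX hx).1
    exact deficit_nonneg hB hμ (by linarith [hs.1]) (hs.2.trans_lt hσ.2)
  have h2 := h1.2
  rw [intervalIntegral.integral_sub hD hI'] at h2
  have h3 : ∫ x in (0 : ℝ)..X, (‖g x‖ ^ 2 + k ^ 2 * ‖f x‖ ^ 2) ≤
      (∫ x in Ioi (0 : ℝ), ‖g x‖ ^ 2) + k ^ 2 * ∫ x in Ioi (0 : ℝ), ‖f x‖ ^ 2 := by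
    rw [← integral_const_mul, ← integral_add h.integrableOn_sq_deriv
      (h.integrableOn_sq.const_mul _), intervalIntegral.integral_of_le hX0]
    exact setIntegral_mono_set hI (Eventually.of_forall fun y => by positivity)
      Ioc_subset_Ioi_self.eventuallyLE
  have := h.potential_le hB hk hμ ht hm hσ hX0 hX
  linarith

theorem eventually_mem_Ico_nhdsLT_one (ht1 : t < 1) : ∀ᶠ σ in 𝓝[<] (1 : ℝ), σ ∈ Ico t 1 := by
  filter_upwards [mem_nhdsWithin_of_mem_nhds (lt_mem_nhds ht1), self_mem_nhdsWithin] with σ h1 h2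
  exact ⟨le_of_lt h1, h2⟩

/-- Drop the non-negative deficit on `[0, X]` and let `σ` tend to `1`. Working with `σ` rather than
`X → ∞` also covers functions whose power norm is exhausted at a finite point. -/
theorem HalfLineH1.potential_zero_le (h : HalfLineH1 f g) (hB : 0 < B) (hk : 0 < k)
    (hμ : 0 < μ) (ht : 0 < t) (ht1 : t < 1)
    (hm : ∫ x in Ioi (0 : ℝ), ‖f x‖ ^ (2 * μ + 2) = tailMass B k μ t) :
    potential B k μ f t 0 ≤
      (∫ x in Ioi (0 : ℝ), ‖g x‖ ^ 2) + k ^ 2 * (∫ x in Ioi (0 : ℝ), ‖f x‖ ^ 2) := by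
  have hlim := (tendsto_potentialBound (B := B) (k := k) hμ
    (√(∫ x in Ioi (0 : ℝ), ‖g x‖ ^ 2))).const_add
    ((∫ x in Ioi (0 : ℝ), ‖g x‖ ^ 2) + k ^ 2 * (∫ x in Ioi (0 : ℝ), ‖f x‖ ^ 2))
  rw [add_zero] at hlim
  refine ge_of_tendsto hlim ?_
  filter_upwards [eventually_mem_Ico_nhdsLT_one ht1] with σ hσ
  obtain ⟨X, hX0, hX⟩ := h.exists_remMass_eq hB hk hμ ht hm hσ
  have h1 := h.setIntegral_deficit_le hB hk hμ ht hm hσ hX0 hX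
  have h2 : 0 ≤ ∫ x in (0 : ℝ)..X, deficit B k μ f g t x :=
    intervalIntegral.integral_nonneg hX0 h1.2.1
  linarith [h1.2.2]

theorem potential_zero (hB : 0 < B) (hk : 0 < k) (hμ : 0 < μ) (ht : 0 < t) (ht1 : t < 1) :
    potential B k μ f t 0 =
      k * t * (2 / (μ + 2) * (ampPow B t ^ (-(1 / 2) : ℝ) *
        Complex.normSq (f 0) ^ ((μ + 2) / 2)) + μ / (μ + 2) * ampPow B t ^ (1 / μ)) +
      (μ + 1) * k ^ 2 / B * tailMass B k μ t := by
  have hs : tailSlope B k μ f t 0 = t := by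
    rw [tailSlope, remMass_zero]
    exact tailMassInv_tailMass hB hk hμ ⟨ht.le, ht1.le⟩
  rw [potential, hs, remMass_zero]

theorem HalfLineH1.ae_eq_zero_of_integral_eq_zero (h : HalfLineH1 f g) (hμ : 0 < μ)
    (hm : ∫ x in Ioi (0 : ℝ), ‖f x‖ ^ (2 * μ + 2) = 0) :
    f =ᵐ[volume.restrict (Ioi 0)] fun _ => 0 := by
  have h1 : (fun x => ‖f x‖ ^ (2 * μ + 2)) =ᵐ[volume.restrict (Ioi 0)] 0 :=
    (setIntegral_eq_zero_iff_of_nonneg_ae (Eventually.of_forall fun x => by positivity)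
      (h.integrableOn_rpow (by linarith))).1 hm
  filter_upwards [h1] with x hx
  have := (Real.rpow_eq_zero_iff_of_nonneg (norm_nonneg (f x))).1 hx
  exact norm_eq_zero.1 this.1

/-- The sharp Robin-type inequality on the half-line. -/
theorem HalfLineH1.tailMass_le_action (h : HalfLineH1 f g) (hB : 0 < B) (hk : 0 < k)
    (hμ : 0 < μ) (ht : 0 < t) (ht1 : t ≤ 1)
    (hm : ∫ x in Ioi (0 : ℝ), ‖f x‖ ^ (2 * μ + 2) = tailMass B k μ t) :
    (μ + 1) * k ^ 2 / B * tailMass B k μ t + k * t * ‖f 0‖ ^ 2 ≤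
      (∫ x in Ioi (0 : ℝ), ‖g x‖ ^ 2) + k ^ 2 * (∫ x in Ioi (0 : ℝ), ‖f x‖ ^ 2) := by
  rcases ht1.eq_or_lt with rfl | ht1
  · rw [tailMass_one] at hm ⊢
    have h2 := h.ae_eq_zero_of_integral_eq_zero hμ hm
    -- Slope `1` means zero power norm; a continuous function that vanishes almost everywhere on
    -- `(0, ∞)` has zero boundary value.
    have h3 : f 0 = 0 := by
      rw [← rightValue_eq h.continuous (ψ := f) (ae_eq_refl _)]
      exact rightValue_eq (f := fun _ => 0) continuous_const h2
    rw [h3]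
    have h4 : 0 ≤ ∫ x in Ioi (0 : ℝ), ‖g x‖ ^ 2 := integral_nonneg fun x => by positivity
    have h5 : 0 ≤ ∫ x in Ioi (0 : ℝ), ‖f x‖ ^ 2 := integral_nonneg fun x => by positivity
    simp only [norm_zero, mul_zero, zero_add, ne_eq, OfNat.ofNat_ne_zero, not_false_eq_true,
      zero_pow]
    positivity
  · have h1 := h.potential_zero_le hB hk hμ ht ht1 hm
    rw [potential_zero hB hk hμ ht ht1] at h1
    have h2 := (young_boundary hμ (Complex.normSq_nonneg (f 0))
      (ampPow_pos hB (by linarith : -1 < t) ht1)).1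
    rw [← Complex.normSq_eq_norm_sq (f 0)]
    have := mul_le_mul_of_nonneg_left h2 (by positivity : 0 ≤ k * t)
    linarith

end

/-! ### The hyperbolic tangent -/

section Tanh

theorem hasDerivAt_tanh (x : ℝ) : HasDerivAt Real.tanh (1 - Real.tanh x ^ 2) x := by
  have hc := (Real.cosh_pos x).ne'
  have h := (Real.hasDerivAt_sinh x).div (Real.hasDerivAt_cosh x) hc
  have e : Real.tanh = Real.sinh / Real.cosh := by
    funext y
    simp [Real.tanh_eq_sinh_div_cosh]
  rw [e]
  convert! h using 1
  simp only [Pi.div_apply]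
  field_simp

theorem continuous_tanh : Continuous Real.tanh :=
  continuous_iff_continuousAt.2 fun x => (hasDerivAt_tanh x).continuousAt

theorem strictMono_tanh : StrictMono Real.tanh := by
  intro x y hxy
  by_contra h
  have := Real.artanh_le_artanh (Real.neg_one_lt_tanh y) (Real.tanh_lt_one x) (not_lt.1 h)
  rw [Real.artanh_tanh, Real.artanh_tanh] at this
  linarith

theorem tendsto_tanh_atTop : Tendsto Real.tanh atTop (𝓝 1) := by
  refine tendsto_order.2 ⟨fun a ha => ?_, fun a ha =>
    Eventually.of_forall fun x => (Real.tanh_lt_one x).trans ha⟩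
  have hb : max a 0 < 1 := max_lt ha zero_lt_one
  filter_upwards [eventually_gt_atTop (Real.artanh (max a 0))] with x hx
  have := strictMono_tanh hx
  rw [Real.tanh_artanh ⟨by linarith [le_max_right a 0], hb⟩] at this
  exact (le_max_left _ _).trans_lt this

theorem one_sub_tanh_sq (x : ℝ) : 1 - Real.tanh x ^ 2 = (Real.cosh x ^ 2)⁻¹ := by
  have hc := (Real.cosh_pos x).ne'
  have := Real.cosh_sq x
  rw [Real.tanh_eq_sinh_div_cosh]
  field_simp
  linarith

end Tanh

/-! ### Soliton tails attain equality -/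

/-- The decreasing soliton tail on the right half-line, centred at `-y`. -/
def tailProfile (B k μ y x : ℝ) : ℝ :=
  B ^ (1 / (2 * μ)) * (Real.cosh (μ * k * (x + y)))⁻¹ ^ (1 / μ)

section

variable {B k μ : ℝ} {f g : ℝ → ℂ} {t : ℝ}

theorem tailProfile_pos (hB : 0 < B) (y x : ℝ) : 0 < tailProfile B k μ y x := by
  have := Real.cosh_pos (μ * k * (x + y))
  unfold tailProfile
  positivity

theorem ampPow_tanh (x : ℝ) : ampPow B (Real.tanh x) = B * ((Real.cosh x)⁻¹) ^ 2 := by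
  rw [ampPow, one_sub_tanh_sq, inv_pow]

theorem tailProfile_rpow (hB : 0 < B) (y x q : ℝ) :
    tailProfile B k μ y x ^ q = ampPow B (Real.tanh (μ * k * (x + y))) ^ (q / (2 * μ)) := by
  have hc := inv_pos.2 (Real.cosh_pos (μ * k * (x + y)))
  rw [ampPow_tanh, Real.mul_rpow hB.le (by positivity), tailProfile,
    Real.mul_rpow (by positivity) (by positivity), ← Real.rpow_mul hB.le, ← Real.rpow_mul hc.le,
    ← Real.rpow_natCast, ← Real.rpow_mul hc.le]
  congr 2
  · ring
  · push_cast
    ring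

theorem tailProfile_sq (hB : 0 < B) (y x : ℝ) :
    tailProfile B k μ y x ^ 2 = ampPow B (Real.tanh (μ * k * (x + y))) ^ (1 / μ) := by
  rw [← Real.rpow_natCast, tailProfile_rpow hB]
  congr 1
  push_cast
  rw [div_mul_cancel_left₀ two_ne_zero, one_div]

theorem hasDerivAt_tailProfile (hμ : 0 < μ) (y x : ℝ) :
    HasDerivAt (tailProfile B k μ y)
      (-(k * Real.tanh (μ * k * (x + y))) * tailProfile B k μ y x) x := by
  have hc := Real.cosh_pos (μ * k * (x + y))
  have h1 : HasDerivAt (fun x => μ * k * (x + y)) (μ * k) x := by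
    simpa using ((hasDerivAt_id x).add_const y).const_mul (μ * k)
  have h2 := (((Real.hasDerivAt_cosh _).comp x h1).inv hc.ne').rpow_const (p := 1 / μ)
    (Or.inl (inv_pos.2 hc).ne')
  refine (h2.const_mul (B ^ (1 / (2 * μ)))).congr_deriv ?_
  simp only [Pi.inv_apply, Function.comp_apply]
  rw [Real.rpow_sub_one (inv_pos.2 hc).ne', Real.tanh_eq_sinh_div_cosh, tailProfile]
  field_simp

theorem hasDerivAt_tanh_affine (y x : ℝ) :
    HasDerivAt (fun x => Real.tanh (μ * k * (x + y)))
      (μ * k * (1 - Real.tanh (μ * k * (x + y)) ^ 2)) x := by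
  have h1 : HasDerivAt (fun x => μ * k * (x + y)) (μ * k) x := by
    simpa using ((hasDerivAt_id x).add_const y).const_mul (μ * k)
  exact ((hasDerivAt_tanh _).comp x h1).congr_deriv (mul_comm _ _)

theorem tendsto_tanh_affine (hk : 0 < k) (hμ : 0 < μ) (y : ℝ) :
    Tendsto (fun x => Real.tanh (μ * k * (x + y))) atTop (𝓝 1) :=
  tendsto_tanh_atTop.comp
    ((tendsto_atTop_add_const_right _ y tendsto_id).const_mul_atTop (by positivity))

/-- Along a tail the slope is `tanh(μk(x+y))`; substituting it for `σ` identifies `tailMass` with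
the power norm beyond `x`. -/
theorem hasDerivAt_tailMass_tanh (hB : 0 < B) (hk : 0 < k) (hμ : 0 < μ) (y x : ℝ) :
    HasDerivAt (fun x => tailMass B k μ (Real.tanh (μ * k * (x + y))))
      (-tailProfile B k μ y x ^ (2 * μ + 2)) x := by
  have h := (hasStrictDerivAt_tailMass (B := B) (k := k) hμ
    (Real.tanh (μ * k * (x + y)))).hasDerivAt.comp x (hasDerivAt_tanh_affine y x)
  refine h.congr_deriv ?_
  have hb := ampPow_pos hB (Real.neg_one_lt_tanh (μ * k * (x + y)))
    (Real.tanh_lt_one (μ * k * (x + y)))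
  rw [tailProfile_rpow hB, show (2 * μ + 2) / (2 * μ) = 1 / μ + 1 by field_simp; ring,
    Real.rpow_add_one hb.ne', tailDensity, ← ampPow]
  nth_rewrite 3 [ampPow]
  field_simp

theorem continuous_tailProfile (hμ : 0 < μ) (y : ℝ) : Continuous (tailProfile B k μ y) :=
  continuous_iff_continuousAt.2 fun x => (hasDerivAt_tailProfile hμ y x).continuousAt

theorem integral_tailProfile_rpow (hB : 0 < B) (hk : 0 < k) (hμ : 0 < μ) (y : ℝ) :
    ∫ x in Ioi (0 : ℝ), tailProfile B k μ y x ^ (2 * μ + 2) =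
      tailMass B k μ (Real.tanh (μ * k * y)) := by
  have h := integral_Ioi_of_hasDerivAt_of_nonpos' (a := 0) (l := 0)
    (fun x _ => hasDerivAt_tailMass_tanh hB hk hμ y x)
    (fun x _ => neg_nonpos.2 (Real.rpow_nonneg (tailProfile_pos hB y x).le _)) (by
      rw [← tailMass_one (B := B) (k := k) (μ := μ)]
      exact ((continuous_tailMass hμ).tendsto 1).comp (tendsto_tanh_affine hk hμ y))
  rw [integral_neg] at h
  simp only [zero_add] at h
  linarith

/-- Integrability and value of the energy density of a soliton tail. -/
theorem integral_energy_tailProfile (hB : 0 < B) (hk : 0 < k) (hμ : 0 < μ) (y : ℝ) :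
    IntegrableOn (fun x => k ^ 2 * (1 + Real.tanh (μ * k * (x + y)) ^ 2) *
      tailProfile B k μ y x ^ 2) (Ioi 0) ∧
    ∫ x in Ioi (0 : ℝ), k ^ 2 * (1 + Real.tanh (μ * k * (x + y)) ^ 2) *
      tailProfile B k μ y x ^ 2 =
      k * Real.tanh (μ * k * y) * tailProfile B k μ y 0 ^ 2 +
        (μ + 1) * k ^ 2 / B * tailMass B k μ (Real.tanh (μ * k * y)) := by
  -- This is the calibrating potential evaluated on the tail itself: there the Young bracket
  -- collapses to the squared amplitude, and the deficit is zero.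
  set Q : ℝ → ℝ := fun x => k * (Real.tanh (μ * k * (x + y)) * tailProfile B k μ y x ^ 2) +
    (μ + 1) * k ^ 2 / B * tailMass B k μ (Real.tanh (μ * k * (x + y))) with hQ
  have hd : ∀ x, HasDerivAt Q (-(k ^ 2 * (1 + Real.tanh (μ * k * (x + y)) ^ 2) *
      tailProfile B k μ y x ^ 2)) x := by
    intro x
    have h := (((hasDerivAt_tanh_affine (k := k) (μ := μ) y x).mul
      ((hasDerivAt_tailProfile (B := B) (k := k) hμ y x).pow 2)).const_mul k).add
      ((hasDerivAt_tailMass_tanh hB hk hμ y x).const_mul ((μ + 1) * k ^ 2 / B))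
    refine h.congr_deriv ?_
    have e : tailProfile B k μ y x ^ (2 * μ + 2) =
        B * (1 - Real.tanh (μ * k * (x + y)) ^ 2) * tailProfile B k μ y x ^ 2 := by
      rw [Real.rpow_add (tailProfile_pos hB y x), tailProfile_rpow hB, div_self (by positivity),
        Real.rpow_one, ampPow]
      norm_num
    rw [e]
    simp only [Pi.pow_apply]
    push_cast
    field_simp
    ring
  have hlim : Tendsto Q atTop (𝓝 0) := by
    have hE : Continuous fun σ => ampPow B σ ^ (1 / μ) := by
      unfold ampPow
      exact Continuous.rpow_const (by fun_prop) fun _ => Or.inr (by positivity)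
    have hM := continuous_tailMass (B := B) (k := k) hμ
    have hc : Continuous fun σ => k * (σ * ampPow B σ ^ (1 / μ)) +
        (μ + 1) * k ^ 2 / B * tailMass B k μ σ := by fun_prop
    have h1 := (hc.tendsto 1).comp (tendsto_tanh_affine hk hμ y)
    have h0 : (1 / μ) ≠ 0 := by positivity
    simp only [tailMass_one, ampPow, one_pow, sub_self, mul_zero, Real.zero_rpow h0,
      add_zero] at h1
    refine h1.congr fun x => ?_
    simp only [hQ, Function.comp_apply, tailProfile_sq hB, ampPow]
  have hnp : ∀ x ∈ Ioi (0 : ℝ), -(k ^ 2 * (1 + Real.tanh (μ * k * (x + y)) ^ 2) *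
      tailProfile B k μ y x ^ 2) ≤ 0 := fun x _ => by
    rw [neg_nonpos]
    positivity
  constructor
  · have := integrableOn_Ioi_deriv_of_nonpos' (fun x _ => hd x) hnp hlim
    simpa using this.neg
  · have := integral_Ioi_of_hasDerivAt_of_nonpos' (fun x _ => hd x) hnp hlim
    rw [integral_neg] at this
    have h0 : Q 0 = k * Real.tanh (μ * k * y) * tailProfile B k μ y 0 ^ 2 +
        (μ + 1) * k ^ 2 / B * tailMass B k μ (Real.tanh (μ * k * y)) := by
      simp only [hQ, zero_add]
      ring
    linarith

theorem norm_exp_mul_ofReal (θ r : ℝ) (hr : 0 ≤ r) :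
    ‖Complex.exp (θ * Complex.I) * (r : ℂ)‖ = r := by
  rw [norm_mul, Complex.norm_exp_ofReal_mul_I, one_mul, Complex.norm_real,
    Real.norm_of_nonneg hr]

theorem halfLineH1_tailProfile (hB : 0 < B) (hk : 0 < k) (hμ : 0 < μ) (y : ℝ) (u : ℂ)
    (hu : ‖u‖ = 1) :
    HalfLineH1 (fun x => u * tailProfile B k μ y x)
      (fun x => u * ((-(k * Real.tanh (μ * k * (x + y))) * tailProfile B k μ y x : ℝ) : ℂ)) := by
  have hT : Continuous fun x => Real.tanh (μ * k * (x + y)) :=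
    continuous_tanh.comp (by fun_prop)
  have hc := continuous_tailProfile (B := B) (k := k) hμ y
  have hc1 : Continuous fun x => u * (tailProfile B k μ y x : ℂ) := by fun_prop
  have hc2 : Continuous fun x =>
    u * ((-(k * Real.tanh (μ * k * (x + y))) * tailProfile B k μ y x : ℝ) : ℂ) := by fun_prop
  have hI := (integral_energy_tailProfile hB hk hμ y).1
  refine ⟨⟨hc1, ?_, fun x hx => ?_⟩, ?_⟩
  · rw [memLp_two_iff_integrable_sq_norm hc2.aestronglyMeasurable]
    refine hI.mono' (hc2.norm.pow 2).aestronglyMeasurable (Eventually.of_forall fun x => ?_)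
    rw [Real.norm_of_nonneg (by positivity), norm_mul, hu, one_mul, Complex.norm_real,
      Real.norm_eq_abs, sq_abs]
    nlinarith [sq_nonneg (k * tailProfile B k μ y x)]
  · have hd : ∀ x : ℝ, HasDerivAt (fun x => u * (tailProfile B k μ y x : ℂ))
        (u * ((-(k * Real.tanh (μ * k * (x + y))) * tailProfile B k μ y x : ℝ) : ℂ)) x :=
      fun x => (hasDerivAt_tailProfile hμ y x).ofReal_comp.const_mul u
    rw [intervalIntegral.integral_eq_sub_of_hasDerivAt (fun x _ => hd x)
      (hc2.intervalIntegrable _ _)]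
    ring
  · rw [memLp_two_iff_integrable_sq_norm hc1.aestronglyMeasurable]
    refine (hI.const_mul (k ^ 2)⁻¹).mono' (hc1.norm.pow 2).aestronglyMeasurable
      (Eventually.of_forall fun x => ?_)
    rw [Real.norm_of_nonneg (by positivity), norm_mul, hu, one_mul, Complex.norm_real,
      Real.norm_eq_abs, sq_abs]
    have : (k ^ 2)⁻¹ * (k ^ 2 * (1 + Real.tanh (μ * k * (x + y)) ^ 2) * tailProfile B k μ y x ^ 2) =
      (1 + Real.tanh (μ * k * (x + y)) ^ 2) * tailProfile B k μ y x ^ 2 := by field_simp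
    rw [this]
    nlinarith [sq_nonneg (Real.tanh (μ * k * (x + y)) * tailProfile B k μ y x)]

theorem integral_action_tailProfile (hB : 0 < B) (hk : 0 < k) (hμ : 0 < μ) (y : ℝ) (u : ℂ)
    (hu : ‖u‖ = 1) :
    (∫ x in Ioi (0 : ℝ),
        ‖u * ((-(k * Real.tanh (μ * k * (x + y))) * tailProfile B k μ y x : ℝ) : ℂ)‖ ^ 2) +
      k ^ 2 * ∫ x in Ioi (0 : ℝ), ‖u * (tailProfile B k μ y x : ℂ)‖ ^ 2 =
    k * Real.tanh (μ * k * y) * tailProfile B k μ y 0 ^ 2 +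
      (μ + 1) * k ^ 2 / B * tailMass B k μ (Real.tanh (μ * k * y)) := by
  have h := halfLineH1_tailProfile hB hk hμ y u hu
  rw [← (integral_energy_tailProfile hB hk hμ y).2, ← integral_const_mul,
    ← integral_add h.integrableOn_sq_deriv (h.integrableOn_sq.const_mul _)]
  congr 1
  funext x
  rw [norm_mul, norm_mul, hu, one_mul, one_mul, Complex.norm_real, Complex.norm_real,
    Real.norm_eq_abs, Real.norm_eq_abs, sq_abs, sq_abs]
  ring

end

/-! ### Rigidity in the half-line inequality -/

section

variable {B k μ : ℝ} {f g : ℝ → ℂ} {t : ℝ}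

theorem artanh_eq_log_sub_log {s : ℝ} (h1 : -1 < s) (h2 : s < 1) :
    Real.artanh s = 1 / 2 * (Real.log (1 + s) - Real.log (1 - s)) := by
  rw [Real.artanh_eq_half_log ⟨h1.le, h2.le⟩, Real.log_div (by linarith) (by linarith)]

/-- A function on `[0, X]` with `s' = c (1 - s²)` is a hyperbolic tangent. -/
theorem artanh_eq_of_hasDerivAt {s : ℝ → ℝ} {X c : ℝ} (hX : 0 ≤ X)
    (hs : ∀ x ∈ Icc 0 X, s x ∈ Ioo (-1 : ℝ) 1)
    (hd : ∀ x ∈ Icc 0 X, HasDerivAt s (c * (1 - s x ^ 2)) x) :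
    Real.artanh (s X) = Real.artanh (s 0) + c * X := by
  set L : ℝ → ℝ := fun x => 1 / 2 * (Real.log (1 + s x) - Real.log (1 - s x)) - c * x with hL
  have hLd : ∀ x ∈ Icc 0 X, HasDerivAt L 0 x := by
    intro x hx
    have h1 : 1 + s x ≠ 0 := by linarith [(hs x hx).1]
    have h2 : 1 - s x ≠ 0 := by linarith [(hs x hx).2]
    have h := ((((hd x hx).const_add 1).log h1).sub (((hd x hx).const_sub 1).log h2)).const_mul
      (1 / 2 : ℝ) |>.sub ((hasDerivAt_id x).const_mul c)
    refine h.congr_deriv ?_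
    have h3 : 1 - s x ^ 2 = (1 + s x) * (1 - s x) := by ring
    rw [h3]
    field_simp
    ring
  have hc := constant_of_has_deriv_right_zero (f := L) (a := 0) (b := X)
    (fun x hx => (hLd x hx).continuousAt.continuousWithinAt)
    (fun x hx => (hLd x ⟨hx.1, hx.2.le⟩).hasDerivWithinAt) X ⟨hX, le_rfl⟩
  have h0 := hs 0 ⟨le_rfl, hX⟩
  have h1 := hs X ⟨hX, le_rfl⟩
  rw [artanh_eq_log_sub_log h0.1 h0.2, artanh_eq_log_sub_log h1.1 h1.2]
  simp only [hL] at hc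
  linarith

/-- In the equality case the deficit vanishes. -/
theorem HalfLineH1.deficit_ae_eq_zero (h : HalfLineH1 f g) (hB : 0 < B) (hk : 0 < k)
    (hμ : 0 < μ) (ht : 0 < t)
    (hm : ∫ x in Ioi (0 : ℝ), ‖f x‖ ^ (2 * μ + 2) = tailMass B k μ t)
    (he : (∫ x in Ioi (0 : ℝ), ‖g x‖ ^ 2) + k ^ 2 * (∫ x in Ioi (0 : ℝ), ‖f x‖ ^ 2) ≤
      potential B k μ f t 0) {σ X : ℝ} (hσ : σ ∈ Ico t 1) (hX0 : 0 ≤ X)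
    (hX : remMass μ f (tailMass B k μ t) X = tailMass B k μ σ) :
    ∀ᵐ x ∂volume.restrict (Icc 0 X), deficit B k μ f g t x = 0 := by
  have h1 := h.setIntegral_deficit_le hB hk hμ ht hm hσ hX0 hX
  have hle : ∫ x in (0 : ℝ)..X, deficit B k μ f g t x ≤ 0 := by
    refine ge_of_tendsto (tendsto_potentialBound (B := B) (k := k) hμ
      (√(∫ x in Ioi (0 : ℝ), ‖g x‖ ^ 2))) ?_
    -- The error term vanishes only as the slope tends to `1`, so the deficit on `[0, X]` is bounded
    -- by that on a longer interval `[0, Y]` with slope `τ > σ` at `Y`.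
    filter_upwards [eventually_mem_Ico_nhdsLT_one hσ.2,
      mem_nhdsWithin_of_mem_nhds (lt_mem_nhds hσ.2)] with τ hτ hστ
    have hτ' : τ ∈ Ico t 1 := ⟨hσ.1.trans hτ.1, hτ.2⟩
    obtain ⟨Y, hY0, hY⟩ := h.exists_remMass_eq hB hk hμ ht hm hτ'
    have h2 := h.setIntegral_deficit_le hB hk hμ ht hm hτ' hY0 hY
    have hXY : X ≤ Y := by
      by_contra hcon
      have h3 := antitone_remMass h.continuous hμ (tailMass B k μ t) (not_le.1 hcon).le
      rw [hX, hY] at h3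
      have h4 := strictAntiOn_tailMass hB hk hμ (a := σ) (b := τ) ⟨ht.le.trans hσ.1, hσ.2.le⟩
        ⟨ht.le.trans hτ'.1, hτ.2.le⟩ hστ
      linarith
    have h5 : ∫ x in (0 : ℝ)..X, deficit B k μ f g t x ≤
        ∫ x in (0 : ℝ)..Y, deficit B k μ f g t x := by
      refine intervalIntegral.integral_mono_interval le_rfl hX0 hXY ?_ h2.1
      refine (ae_restrict_iff' measurableSet_Ioc).2 (Eventually.of_forall fun x hx => ?_)
      exact h2.2.1 x ⟨hx.1.le, hx.2⟩
    linarith [h2.2.2]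
  have h0 : ∫ x in (0 : ℝ)..X, deficit B k μ f g t x = 0 :=
    le_antisymm hle (intervalIntegral.integral_nonneg hX0 h1.2.1)
  rw [intervalIntegral.integral_of_le hX0, ← integral_Icc_eq_integral_Ioc] at h0
  refine (setIntegral_eq_zero_iff_of_nonneg_ae ?_ ?_).1 h0
  · exact (ae_restrict_iff' measurableSet_Icc).2 (Eventually.of_forall h1.2.1)
  · rw [integrableOn_Icc_iff_integrableOn_Ioc]
    exact (intervalIntegrable_iff_integrableOn_Ioc_of_le hX0).1 h1.1

/-- In the equality case `|f|²` is the squared soliton amplitude at the given slope, and `g` is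
determined by `f`. -/
theorem HalfLineH1.normSq_eq_of_equality (h : HalfLineH1 f g) (hB : 0 < B) (hk : 0 < k)
    (hμ : 0 < μ) (ht : 0 < t) (ht1 : t < 1)
    (hm : ∫ x in Ioi (0 : ℝ), ‖f x‖ ^ (2 * μ + 2) = tailMass B k μ t)
    (he : (∫ x in Ioi (0 : ℝ), ‖g x‖ ^ 2) + k ^ 2 * (∫ x in Ioi (0 : ℝ), ‖f x‖ ^ 2) ≤
      (μ + 1) * k ^ 2 / B * tailMass B k μ t + k * t * ‖f 0‖ ^ 2)
    {σ X : ℝ} (hσ : σ ∈ Ico t 1) (hX0 : 0 < X)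
    (hX : remMass μ f (tailMass B k μ t) X = tailMass B k μ σ) :
    (∀ x ∈ Icc 0 X, Complex.normSq (f x) = ampPow B (tailSlope B k μ f t x) ^ (1 / μ)) ∧
    ∀ᵐ x ∂volume.restrict (Icc 0 X), g x = -((k * tailSlope B k μ f t x : ℝ) : ℂ) * f x := by
  have hbt := ampPow_pos hB (by linarith : -1 < t) ht1
  have hyb := young_boundary hμ (Complex.normSq_nonneg (f 0)) hbt
  have hp0 := potential_zero (f := f) hB hk hμ ht ht1
  have hple := h.potential_zero_le hB hk hμ ht ht1 hm
  rw [← Complex.normSq_eq_norm_sq (f 0)] at he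
  have hkt : 0 < k * t := mul_pos hk ht
  have hmul := mul_le_mul_of_nonneg_left hyb.1 hkt.le
  -- Equality overall forces equality in the boundary Young inequality as well; this fixes `|f(0)|`
  -- and later excludes the zero branch.
  have h0 : Complex.normSq (f 0) = ampPow B t ^ (1 / μ) := by
    refine hyb.2 (mul_left_cancel₀ hkt.ne' ?_)
    linarith
  have hdz := h.deficit_ae_eq_zero hB hk hμ ht hm (by linarith) hσ hX0.le hX
  set s := tailSlope B k μ f t with hsdef
  have hs : ∀ x ∈ Icc 0 X, s x ∈ Ioo (-1 : ℝ) 1 := fun x hx => by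
    have := (tailSlope_spec h.continuous hB hk hμ ht hσ hX hx).1
    exact ⟨by linarith [this.1], this.2.trans_lt hσ.2⟩
  have hs0 : s 0 = t := by
    rw [hsdef, tailSlope, remMass_zero]
    exact tailMassInv_tailMass hB hk hμ ⟨ht.le, ht1.le⟩
  have hsc : ContinuousOn s (Icc 0 X) := fun x hx =>
    (hasDerivAt_tailSlope h.continuous hB hk hμ ht hσ hX hx).continuousAt.continuousWithinAt
  have hb : ∀ x ∈ Icc 0 X, 0 < ampPow B (s x) := fun x hx => ampPow_pos hB (hs x hx).1 (hs x hx).2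
  have hEc : ContinuousOn (fun x => ampPow B (s x) ^ (1 / μ)) (Icc 0 X) := by
    have hac : Continuous (ampPow B) := by unfold ampPow; fun_prop
    exact (hac.comp_continuousOn hsc).rpow_const fun x hx => Or.inr (by positivity)
  have hE : ∀ x ∈ Icc 0 X, 0 < ampPow B (s x) ^ (1 / μ) := fun x hx =>
    Real.rpow_pos_of_pos (hb x hx) _
  have hNc : Continuous fun x => Complex.normSq (f x) :=
    Complex.continuous_normSq.comp h.continuous
  have hsplit : ∀ x ∈ Icc 0 X, deficit B k μ f g t x = 0 →
      (g x + ((k * s x * ampPow B (s x) ^ (-(1 / 2) : ℝ) *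
        Complex.normSq (f x) ^ (μ / 2) : ℝ) : ℂ) * f x = 0) ∧
      (Complex.normSq (f x) = 0 ∨ Complex.normSq (f x) = ampPow B (s x) ^ (1 / μ)) := by
    intro x hx hd
    have hy := young_interior hμ (Complex.normSq_nonneg (f x)) (hb x hx)
    rw [deficit, ← hsdef] at hd
    have hN := Complex.normSq_nonneg (f x)
    have h2 := mul_nonneg (mul_nonneg (sq_nonneg k) hN) hy.1
    obtain ⟨e1, e2⟩ := (add_eq_zero_iff_of_nonneg (by positivity) h2).1 hd
    refine ⟨norm_eq_zero.1 (pow_eq_zero_iff two_ne_zero |>.1 e1), ?_⟩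
    rcases mul_eq_zero.1 e2 with e3 | e3
    · exact Or.inl ((mul_eq_zero.1 e3).resolve_left (by positivity))
    · exact Or.inr (hy.2 e3)
  -- The alternative "zero or soliton amplitude" holds almost everywhere; written as a vanishing
  -- product of continuous functions it holds everywhere.
  have hzero : EqOn (fun x => Complex.normSq (f x) *
      (Complex.normSq (f x) - ampPow B (s x) ^ (1 / μ))) (fun _ => 0) (Icc 0 X) := by
    refine Measure.eqOn_Icc_of_ae_eq volume hX0.ne ?_
      (hNc.continuousOn.mul (hNc.continuousOn.sub hEc)) continuousOn_const
    filter_upwards [hdz, ae_restrict_mem measurableSet_Icc] with x hx hxI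
    rcases (hsplit x hxI hx).2 with e | e <;> simp [e]
  have hall : ∀ x ∈ Icc 0 X, Complex.normSq (f x) = ampPow B (s x) ^ (1 / μ) := by
    intro x hx
    rcases mul_eq_zero.1 (hzero hx) with e | e
    -- The ratio of `|f|²` to the squared soliton amplitude takes only the values `0` and `1` and
    -- starts at `1`. If it reached `0`, it would take the value `1/2` in between.
    · exfalso
      have hq : ContinuousOn (fun x => Complex.normSq (f x) / ampPow B (s x) ^ (1 / μ))
          (Icc 0 X) := hNc.continuousOn.div hEc fun y hy => (hE y hy).ne'
      have hi := intermediate_value_Icc' hx.1 (hq.mono (Icc_subset_Icc_right hx.2))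
      have hmem : (1 / 2 : ℝ) ∈ Icc (Complex.normSq (f x) / ampPow B (s x) ^ (1 / μ))
          (Complex.normSq (f 0) / ampPow B (s 0) ^ (1 / μ)) := by
        rw [e, hs0, h0, div_self (Real.rpow_pos_of_pos hbt _).ne']
        norm_num
      obtain ⟨y, hy, hye⟩ := hi hmem
      have hyI : y ∈ Icc 0 X := ⟨hy.1, hy.2.trans hx.2⟩
      rcases mul_eq_zero.1 (hzero hyI) with e' | e'
      · simp [e'] at hye
      · simp only [sub_eq_zero.1 e', div_self (hE y hyI).ne'] at hye
        norm_num at hye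
    · exact sub_eq_zero.1 e
  refine ⟨hall, ?_⟩
  filter_upwards [hdz, ae_restrict_mem measurableSet_Icc] with x hx hxI
  have e := (hsplit x hxI hx).1
  have e1 : ampPow B (s x) ^ (-(1 / 2) : ℝ) * Complex.normSq (f x) ^ (μ / 2) = 1 := by
    rw [hall x hxI, ← Real.rpow_mul (hb x hxI).le, ← Real.rpow_add (hb x hxI),
      show (-(1 / 2) : ℝ) + 1 / μ * (μ / 2) = 0 by field_simp; ring, Real.rpow_zero]
  rw [mul_assoc, e1, mul_one] at e
  rw [eq_neg_of_add_eq_zero_left e]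
  ring

/-- Rigidity in the sharp inequality on the half-line: only soliton tails give equality. -/
theorem HalfLineH1.eq_tailProfile_of_equality (h : HalfLineH1 f g) (hB : 0 < B) (hk : 0 < k)
    (hμ : 0 < μ) {y : ℝ} (hy : 0 < y)
    (hm : ∫ x in Ioi (0 : ℝ), ‖f x‖ ^ (2 * μ + 2) = tailMass B k μ (Real.tanh (μ * k * y)))
    (he : (∫ x in Ioi (0 : ℝ), ‖g x‖ ^ 2) + k ^ 2 * (∫ x in Ioi (0 : ℝ), ‖f x‖ ^ 2) ≤
      (μ + 1) * k ^ 2 / B * tailMass B k μ (Real.tanh (μ * k * y)) +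
        k * Real.tanh (μ * k * y) * ‖f 0‖ ^ 2) :
    ∃ θ : ℝ, ∀ x, 0 ≤ x → f x = Complex.exp (θ * Complex.I) * tailProfile B k μ y x := by
  set t := Real.tanh (μ * k * y) with htdef
  have ht : 0 < t := by
    rw [htdef, ← Real.tanh_zero]
    exact strictMono_tanh (by positivity)
  have ht1 : t < 1 := Real.tanh_lt_one _
  set s := tailSlope B k μ f t with hsdef
  have hs0 : s 0 = t := by
    rw [hsdef, tailSlope, remMass_zero]
    exact tailMassInv_tailMass hB hk hμ ⟨ht.le, ht1.le⟩
  -- With `|f|` known in terms of the slope, the equation for the slope becomes `s' = μk(1 - s²)`.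
  have hkey : ∀ X σ, σ ∈ Ico t 1 → 0 < X →
      remMass μ f (tailMass B k μ t) X = tailMass B k μ σ →
      ∀ x ∈ Icc 0 X, s x = Real.tanh (μ * k * (x + y)) := by
    intro X σ hσ hX0 hX x hx
    have hN := (h.normSq_eq_of_equality hB hk hμ ht ht1 hm he hσ hX0 hX).1
    have hs : ∀ x ∈ Icc 0 X, s x ∈ Ioo (-1 : ℝ) 1 := fun x hx => by
      have := (tailSlope_spec h.continuous hB hk hμ ht hσ hX hx).1
      exact ⟨by linarith [this.1], this.2.trans_lt hσ.2⟩
    have hd : ∀ x ∈ Icc 0 X, HasDerivAt s (μ * k * (1 - s x ^ 2)) x := by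
      intro x hx
      refine (hasDerivAt_tailSlope h.continuous hB hk hμ ht hσ hX hx).congr_deriv ?_
      rw [← hsdef]
      have hb := ampPow_pos hB (hs x hx).1 (hs x hx).2
      rw [show 2 * μ + 2 = 2 * (μ + 1) by ring, norm_rpow_eq_normSq_rpow, hN x hx, ← hsdef,
        ← Real.rpow_mul hb.le, show 1 / μ * (μ + 1) = 1 / μ + 1 by field_simp; ring,
        Real.rpow_add_one hb.ne', tailDensity, ← ampPow]
      have := Real.rpow_pos_of_pos hb (1 / μ)
      nth_rewrite 2 [ampPow]
      field_simp
    have hx' : ∀ z ∈ Icc 0 x, z ∈ Icc 0 X := fun z hz => ⟨hz.1, hz.2.trans hx.2⟩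
    have hA := artanh_eq_of_hasDerivAt hx.1 (fun z hz => hs z (hx' z hz))
      (fun z hz => hd z (hx' z hz))
    rw [hs0, htdef, Real.artanh_tanh] at hA
    rw [← Real.tanh_artanh (hs x hx), hA]
    congr 1
    ring
  have hlarge : ∀ x, 0 ≤ x → ∃ X σ, σ ∈ Ico t 1 ∧ 0 < X ∧ x ≤ X ∧
      remMass μ f (tailMass B k μ t) X = tailMass B k μ σ := by
    intro x hx
    -- By `hkey` this slope is reached exactly at `X = x + 1`. Hence the power norm is not exhausted
    -- at any finite point and the whole half-line is covered.
    set σ := Real.tanh (μ * k * (x + 1 + y)) with hσdef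
    have hσ : σ ∈ Ico t 1 :=
      ⟨strictMono_tanh.monotone (mul_le_mul_of_nonneg_left (by linarith) (by positivity)),
        Real.tanh_lt_one _⟩
    obtain ⟨X, hX0, hX⟩ := h.exists_remMass_eq hB hk hμ ht hm hσ
    have hσX : s X = σ := by
      rw [hsdef, tailSlope, hX]
      exact tailMassInv_tailMass hB hk hμ ⟨ht.le.trans hσ.1, hσ.2.le⟩
    have hXpos : 0 < X := by
      refine lt_of_le_of_ne hX0 fun hX' => ?_
      rw [← hX', hs0, htdef, hσdef] at hσX
      have := Real.tanh_injective hσX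
      have hmk : 0 < μ * k := by positivity
      have := mul_left_cancel₀ hmk.ne' this
      linarith
    refine ⟨X, σ, hσ, hXpos, ?_, hX⟩
    have e := hkey X σ hσ hXpos hX X ⟨hX0, le_rfl⟩
    rw [hσX, hσdef] at e
    have hmk : 0 < μ * k := by positivity
    have := mul_left_cancel₀ hmk.ne' (Real.tanh_injective e)
    linarith
  set G : ℝ → ℂ := fun z => -((k * Real.tanh (μ * k * (z + y)) : ℝ) : ℂ) * f z with hG
  have hGc : Continuous G := by
    have : Continuous fun z => Real.tanh (μ * k * (z + y)) := continuous_tanh.comp (by fun_prop)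
    have := h.continuous
    fun_prop
  -- A `C¹` copy of `f`: the derivative of `f` equals the continuous function `G` almost everywhere.
  set F : ℝ → ℂ := fun x => f 0 + ∫ z in (0 : ℝ)..x, G z with hF
  have hFd : ∀ x, HasDerivAt F (G x) x := fun x =>
    (intervalIntegral.integral_hasDerivAt_right (hGc.intervalIntegrable _ _)
      (hGc.stronglyMeasurableAtFilter _ _) hGc.continuousAt).const_add _
  have hfF : ∀ x, 0 ≤ x → f x = F x := by
    intro x hx
    obtain ⟨X, σ, hσ, hX0, hxX, hX⟩ := hlarge x hx
    have hg := (h.normSq_eq_of_equality hB hk hμ ht ht1 hm he hσ hX0 hX).2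
    rw [h.eq_add_integral x hx, hF]
    simp only
    congr 1
    rw [intervalIntegral.integral_of_le hx, intervalIntegral.integral_of_le hx]
    refine integral_congr_ae ?_
    have hsub : Ioc 0 x ⊆ Icc 0 X := fun z hz => ⟨hz.1.le, hz.2.trans hxX⟩
    filter_upwards [ae_restrict_of_ae_restrict_of_subset hsub hg,
      ae_restrict_mem measurableSet_Ioc] with z hz hzI
    rw [hz, hG, ← hsdef, hkey X σ hσ hX0 hX z (hsub hzI)]
  -- `F` and the tail solve the same linear first-order equation, so their quotient is constant;
  -- only a phase is left.
  have hconst : ∀ x, 0 ≤ x → F x * ((tailProfile B k μ y x)⁻¹ : ℝ) =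
      F 0 * ((tailProfile B k μ y 0)⁻¹ : ℝ) := by
    intro x hx
    have hd : ∀ z, 0 ≤ z → HasDerivAt (fun z => F z * ((tailProfile B k μ y z)⁻¹ : ℝ)) 0 z := by
      intro z hz
      have hpos := (tailProfile_pos (k := k) (μ := μ) hB y z).ne'
      have h1 := (hFd z).mul ((hasDerivAt_tailProfile (B := B) (k := k) hμ y z).inv hpos).ofReal_comp
      refine h1.congr_deriv ?_
      simp only [hG, Pi.inv_apply]
      rw [← hfF z hz]
      have hpos' : (tailProfile B k μ y z : ℂ) ≠ 0 := by exact_mod_cast hpos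
      push_cast
      field_simp
      ring
    exact constant_of_has_deriv_right_zero (a := 0) (b := x)
      (fun z hz => (hd z hz.1).continuousAt.continuousWithinAt)
      (fun z hz => (hd z hz.1).hasDerivWithinAt) x ⟨hx, le_rfl⟩
  obtain ⟨X, σ, hσ, hX0, -, hX⟩ := hlarge 0 le_rfl
  have hN0 := (h.normSq_eq_of_equality hB hk hμ ht ht1 hm he hσ hX0 hX).1 0 ⟨le_rfl, hX0.le⟩
  rw [← hsdef, hs0] at hN0
  have hn0 : ‖f 0‖ = tailProfile B k μ y 0 := by
    have e := tailProfile_sq (k := k) (μ := μ) hB y 0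
    rw [zero_add, ← htdef, ← hN0, Complex.normSq_eq_norm_sq] at e
    exact ((sq_eq_sq₀ (tailProfile_pos hB y 0).le (norm_nonneg _)).1 e).symm
  refine ⟨(f 0).arg, fun x hx => ?_⟩
  have hc := hconst x hx
  rw [← hfF x hx, ← hfF 0 le_rfl] at hc
  have hpx : (tailProfile B k μ y x : ℂ) ≠ 0 := by
    exact_mod_cast (tailProfile_pos (k := k) (μ := μ) hB y x).ne'
  have hp0 : (tailProfile B k μ y 0 : ℂ) ≠ 0 := by
    exact_mod_cast (tailProfile_pos (k := k) (μ := μ) hB y 0).ne'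
  have hpolar := Complex.norm_mul_exp_arg_mul_I (f 0)
  rw [hn0] at hpolar
  rw [← hpolar] at hc
  push_cast at hc
  field_simp at hc
  rw [hc]
  ring

end

/-! ### Minimizing the total power norm of a pair of tails -/

/-- The function whose equal values are matched in the system for `(t₁, t₂)`. -/
def matching (μ t : ℝ) : ℝ := t ^ (2 * μ) - t ^ (2 * μ + 2)

/-- Logarithm of the ratio of `matching μ` at `(A + d)⁻¹` and at `(A - d)⁻¹`. -/
def logRatio (μ A d : ℝ) : ℝ :=
  (Real.log (A - 1 + d) - Real.log (A - 1 - d)) + (Real.log (A + 1 + d) - Real.log (A + 1 - d)) -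
    (2 * μ + 2) * (Real.log (A + d) - Real.log (A - d))

/-- Up to the positive factor `(A² - d²) / 2` the derivative of `logRatio` at `d`, as a function of
`z = d²`. -/
def logRatioRate (μ A z : ℝ) : ℝ :=
  2 * A + (A - 1) * (2 * A - 1) / ((A - 1) ^ 2 - z) - (A + 1) * (2 * A + 1) / ((A + 1) ^ 2 - z) -
    2 * (μ + 1) * A

/-- The total power norm of a pair of soliton tails with slopes `(A + d)⁻¹` and `(A - d)⁻¹`. -/
def splitMass (B k μ A d : ℝ) : ℝ := tailMass B k μ (A + d)⁻¹ + tailMass B k μ (A - d)⁻¹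

section

variable {B k μ A : ℝ}

theorem matching_inv {u : ℝ} (hu : 1 < u) :
    0 < matching μ u⁻¹ ∧
    Real.log (matching μ u⁻¹) = Real.log (u - 1) + Real.log (u + 1) - (2 * μ + 2) * Real.log u := by
  have hu0 : 0 < u := by linarith
  have e : matching μ u⁻¹ = (u - 1) * (u + 1) * u ^ (-(2 * μ + 2)) := by
    rw [matching, Real.inv_rpow hu0.le, Real.inv_rpow hu0.le, ← Real.rpow_neg hu0.le,
      ← Real.rpow_neg hu0.le]
    have : u ^ (-(2 * μ)) = u ^ (-(2 * μ + 2)) * u ^ 2 := by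
      rw [← Real.rpow_natCast u 2, ← Real.rpow_add hu0]
      congr 1
      push_cast
      ring
    rw [this]
    ring
  have h1 : 0 < u - 1 := by linarith
  have h2 : 0 < u + 1 := by linarith
  have h3 : 0 < u ^ (-(2 * μ + 2)) := Real.rpow_pos_of_pos hu0 _
  rw [e]
  refine ⟨by positivity, ?_⟩
  rw [Real.log_mul (by positivity) h3.ne', Real.log_mul h1.ne' h2.ne', Real.log_rpow hu0]
  ring

theorem logRatio_eq {d : ℝ} (h1 : 1 < A + d) (h2 : 1 < A - d) :
    logRatio μ A d = Real.log (matching μ (A + d)⁻¹) - Real.log (matching μ (A - d)⁻¹) := by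
  rw [(matching_inv h1).2, (matching_inv h2).2, logRatio]
  rw [show A - 1 + d = A + d - 1 by ring, show A - 1 - d = A - d - 1 by ring,
    show A + 1 + d = A + d + 1 by ring, show A + 1 - d = A - d + 1 by ring]
  ring

theorem logRatio_zero : logRatio μ A 0 = 0 := by simp [logRatio]

theorem hasDerivAt_logRatio {d : ℝ} (h1 : 1 < A + d) (h2 : 1 < A - d) :
    HasDerivAt (logRatio μ A) (2 / (A ^ 2 - d ^ 2) * logRatioRate μ A (d ^ 2)) d := by
  have hlog : ∀ a : ℝ, 0 < a + d → 0 < a - d →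
      HasDerivAt (fun d => Real.log (a + d) - Real.log (a - d)) (1 / (a + d) - -1 / (a - d)) d := by
    intro a ha hb
    exact (((hasDerivAt_id d).const_add a).log ha.ne').sub
      (((hasDerivAt_id d).const_sub a).log hb.ne')
  have h := ((hlog (A - 1) (by linarith) (by linarith)).add
    (hlog (A + 1) (by linarith) (by linarith))).sub
    ((hlog A (by linarith) (by linarith)).const_mul (2 * μ + 2))
  refine h.congr_deriv ?_
  have p1 : A - 1 + d ≠ 0 := by linarith
  have p2 : A - 1 - d ≠ 0 := by linarith
  have p3 : A + 1 + d ≠ 0 := by linarith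
  have p4 : A + 1 - d ≠ 0 := by linarith
  have p5 : A + d ≠ 0 := by linarith
  have p6 : A - d ≠ 0 := by linarith
  rw [logRatioRate, show (A - 1) ^ 2 - d ^ 2 = (A - 1 + d) * (A - 1 - d) by ring,
    show (A + 1) ^ 2 - d ^ 2 = (A + 1 + d) * (A + 1 - d) by ring,
    show A ^ 2 - d ^ 2 = (A + d) * (A - d) by ring]
  field_simp
  ring

/-- The sign here decides the bifurcation: with `A = γ√ω/2` the factor `1 - μ(A²-1)` vanishes
exactly at `ω = ω*`. -/
theorem logRatioRate_zero (hA : 1 < A) :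
    logRatioRate μ A 0 = 2 * A / (A ^ 2 - 1) * (1 - μ * (A ^ 2 - 1)) := by
  have p1 : A - 1 ≠ 0 := by linarith
  have p2 : A + 1 ≠ 0 := by linarith
  rw [logRatioRate, show A ^ 2 - 1 = (A + 1) * (A - 1) by ring]
  simp only [sub_zero]
  field_simp
  ring

/-- The increments of the two fractions are compared. Each ratio `((A-1)²-z)/((A+1)²-z)` is at most
its value at `z = 0`, which reduces the claim to `(2A+1)(A-1)³ < (2A-1)(A+1)³`. -/
theorem strictMonoOn_logRatioRate (hA : 1 < A) :
    StrictMonoOn (logRatioRate μ A) (Ico 0 ((A - 1) ^ 2)) := by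
  intro x hx y hy hxy
  have ha : 0 < A - 1 := by linarith
  have p1 : 0 < (A - 1) ^ 2 - x := by linarith [hx.2]
  have p2 : 0 < (A - 1) ^ 2 - y := by linarith [hy.2]
  have hAA : (A + 1) ^ 2 - (A - 1) ^ 2 = 4 * A := by ring
  have p3 : 0 < (A + 1) ^ 2 - x := by linarith
  have p4 : 0 < (A + 1) ^ 2 - y := by linarith
  have e1 : (A - 1) * (2 * A - 1) / ((A - 1) ^ 2 - y) - (A - 1) * (2 * A - 1) / ((A - 1) ^ 2 - x) =
      (y - x) * ((2 * A - 1) * (A - 1) / (((A - 1) ^ 2 - y) * ((A - 1) ^ 2 - x))) := by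
    field_simp
    ring
  have e2 : (A + 1) * (2 * A + 1) / ((A + 1) ^ 2 - y) - (A + 1) * (2 * A + 1) / ((A + 1) ^ 2 - x) =
      (y - x) * ((2 * A + 1) * (A + 1) / (((A + 1) ^ 2 - y) * ((A + 1) ^ 2 - x))) := by
    field_simp
    ring
  have key : (2 * A + 1) * (A + 1) / (((A + 1) ^ 2 - y) * ((A + 1) ^ 2 - x)) <
      (2 * A - 1) * (A - 1) / (((A - 1) ^ 2 - y) * ((A - 1) ^ 2 - x)) := by
    rw [div_lt_div_iff₀ (by positivity) (by positivity)]
    have q1 : ((A - 1) ^ 2 - y) * (A + 1) ^ 2 ≤ ((A + 1) ^ 2 - y) * (A - 1) ^ 2 := by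
      nlinarith [mul_nonneg hy.1 (by linarith : 0 ≤ 4 * A)]
    have q2 : ((A - 1) ^ 2 - x) * (A + 1) ^ 2 ≤ ((A + 1) ^ 2 - x) * (A - 1) ^ 2 := by
      nlinarith [mul_nonneg hx.1 (by linarith : 0 ≤ 4 * A)]
    have q3 := mul_le_mul q1 q2 (by positivity) (by positivity)
    have q4 : (2 * A + 1) * (A - 1) ^ 3 < (2 * A - 1) * (A + 1) ^ 3 := by
      nlinarith [mul_pos ha ha, mul_pos ha (mul_pos ha ha)]
    have hX : 0 < ((A + 1) ^ 2 - y) * ((A + 1) ^ 2 - x) := by positivity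
    have hA1 : 0 < A + 1 := by linarith
    have hc : 0 < (A + 1) ^ 4 := by positivity
    refine lt_of_mul_lt_mul_right ?_ hc.le
    calc (2 * A + 1) * (A + 1) * (((A - 1) ^ 2 - y) * ((A - 1) ^ 2 - x)) * (A + 1) ^ 4
        = (2 * A + 1) * (A + 1) *
          ((((A - 1) ^ 2 - y) * (A + 1) ^ 2) * (((A - 1) ^ 2 - x) * (A + 1) ^ 2)) := by ring
      _ ≤ (2 * A + 1) * (A + 1) *
          ((((A + 1) ^ 2 - y) * (A - 1) ^ 2) * (((A + 1) ^ 2 - x) * (A - 1) ^ 2)) :=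
          mul_le_mul_of_nonneg_left q3 (by positivity)
      _ = ((2 * A + 1) * (A - 1) ^ 3) *
          ((A + 1) * (A - 1) * (((A + 1) ^ 2 - y) * ((A + 1) ^ 2 - x))) := by ring
      _ < ((2 * A - 1) * (A + 1) ^ 3) *
          ((A + 1) * (A - 1) * (((A + 1) ^ 2 - y) * ((A + 1) ^ 2 - x))) :=
          mul_lt_mul_of_pos_right q4 (by positivity)
      _ = _ := by ring
  have := mul_lt_mul_of_pos_left key (sub_pos.2 hxy)
  rw [← e1, ← e2] at this
  rw [logRatioRate, logRatioRate]
  linarith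

theorem continuousOn_logRatio : ContinuousOn (logRatio μ A) (Ico 0 (A - 1)) := fun d hd =>
  (hasDerivAt_logRatio (by linarith [hd.1, hd.2]) (by linarith [hd.2])).continuousAt.continuousWithinAt

theorem logRatioRate_sq_lt (hA : 1 < A) {c d : ℝ} (hc : 0 ≤ c) (hcd : c < d) (hd : d < A - 1) :
    logRatioRate μ A (c ^ 2) < logRatioRate μ A (d ^ 2) :=
  strictMonoOn_logRatioRate hA ⟨by positivity, by nlinarith⟩ ⟨by positivity, by nlinarith⟩
    (by nlinarith)

theorem two_div_pos {d : ℝ} (hd0 : 0 ≤ d) (hd : d < A - 1) : 0 < 2 / (A ^ 2 - d ^ 2) := by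
  have : 0 < A ^ 2 - d ^ 2 := by nlinarith
  positivity

theorem logRatio_strictMonoOn (hA : 1 < A) {c : ℝ} (hc : 0 ≤ c)
    (h : 0 ≤ logRatioRate μ A (c ^ 2)) : StrictMonoOn (logRatio μ A) (Ico c (A - 1)) := by
  refine strictMonoOn_of_deriv_pos (convex_Ico _ _)
    (continuousOn_logRatio.mono (Ico_subset_Ico_left hc)) fun d hd => ?_
  rw [interior_Ico] at hd
  have hd0 := hc.trans_lt hd.1
  rw [(hasDerivAt_logRatio (by linarith [hd.2]) (by linarith [hd.2])).deriv]
  exact mul_pos (two_div_pos hd0.le hd.2) (h.trans_lt (logRatioRate_sq_lt hA hc hd.1 hd.2))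

theorem logRatio_strictAntiOn (hA : 1 < A) {c : ℝ} (hc : c < A - 1)
    (h : logRatioRate μ A (c ^ 2) ≤ 0) : StrictAntiOn (logRatio μ A) (Icc 0 c) := by
  refine strictAntiOn_of_deriv_neg (convex_Icc _ _)
    (continuousOn_logRatio.mono fun x hx => ⟨hx.1, hx.2.trans_lt hc⟩) fun d hd => ?_
  rw [interior_Icc] at hd
  rw [(hasDerivAt_logRatio (by linarith [hd.1, hd.2]) (by linarith [hd.2])).deriv]
  exact mul_neg_of_pos_of_neg (two_div_pos hd.1.le (hd.2.trans hc))
    ((logRatioRate_sq_lt hA hd.1.le hd.2 hc).trans_le h)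

theorem logRatio_pos_of_subcritical (hA : 1 < A) (h : μ * (A ^ 2 - 1) ≤ 1) {d : ℝ}
    (hd : d ∈ Ioo 0 (A - 1)) : 0 < logRatio μ A d := by
  have h0 : 0 ≤ logRatioRate μ A (0 ^ 2) := by
    rw [zero_pow two_ne_zero, logRatioRate_zero hA]
    have : 0 < A ^ 2 - 1 := by nlinarith
    have : 0 ≤ 1 - μ * (A ^ 2 - 1) := by linarith
    positivity
  have := logRatio_strictMonoOn hA le_rfl h0 (a := 0) (b := d) ⟨le_rfl, by linarith⟩
    ⟨hd.1.le, hd.2⟩ hd.1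
  rwa [logRatio_zero] at this

/-- `logRatio` vanishes at `0` and `d₀`, so by Rolle its derivative vanishes at some `c` in between.
As the rate is strictly increasing, the function decreases up to `c` and increases after it. -/
theorem logRatio_sign_of_zero (hA : 1 < A) {d₀ : ℝ} (hd₀ : d₀ ∈ Ioo 0 (A - 1))
    (hz : logRatio μ A d₀ = 0) :
    (∀ d ∈ Ioo 0 d₀, logRatio μ A d < 0) ∧ ∀ d ∈ Ioo d₀ (A - 1), 0 < logRatio μ A d := by
  obtain ⟨c, hc, hc0⟩ := exists_hasDerivAt_eq_zero hd₀.1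
    (continuousOn_logRatio.mono fun x hx => ⟨hx.1, hx.2.trans_lt hd₀.2⟩)
    (by rw [logRatio_zero, hz])
    (fun x hx => hasDerivAt_logRatio (μ := μ) (A := A) (by linarith [hx.1, hx.2, hd₀.2])
      (by linarith [hx.2, hd₀.2]))
  have hcA : c < A - 1 := hc.2.trans hd₀.2
  have hR : logRatioRate μ A (c ^ 2) = 0 :=
    (mul_eq_zero.1 hc0).resolve_left (two_div_pos hc.1.le hcA).ne'
  have hanti := logRatio_strictAntiOn hA hcA hR.le
  have hmono := logRatio_strictMonoOn hA hc.1.le hR.ge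
  constructor
  · intro d hd
    rcases le_or_gt d c with hdc | hdc
    · have := hanti (a := 0) (b := d) ⟨le_rfl, hc.1.le⟩ ⟨hd.1.le, hdc⟩ hd.1
      rwa [logRatio_zero] at this
    · have := hmono (a := d) (b := d₀) ⟨hdc.le, hd.2.trans hd₀.2⟩ ⟨hc.2.le, hd₀.2⟩ hd.2
      rwa [hz] at this
  · intro d hd
    have := hmono (a := d₀) (b := d) ⟨hc.2.le, hd₀.2⟩ ⟨(hc.2.trans hd.1).le, hd.2⟩ hd.1
    rwa [hz] at this

/-- Above the bifurcation the slope at `0` is negative, while `-log(A - 1 - d)` drives the function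
to `+∞` at the right end. -/
theorem exists_logRatio_eq_zero (hA : 1 < A) (h : 1 < μ * (A ^ 2 - 1)) :
    ∃ d ∈ Ioo 0 (A - 1), logRatio μ A d = 0 := by
  have hneg : ∃ d ∈ Ioo 0 (A - 1), logRatio μ A d < 0 := by
    have hd := hasDerivAt_logRatio (μ := μ) (A := A) (d := 0) (by linarith) (by linarith)
    have hlt : 2 / (A ^ 2 - 0 ^ 2) * logRatioRate μ A (0 ^ 2) < 0 := by
      refine mul_neg_of_pos_of_neg (two_div_pos le_rfl (by linarith)) ?_
      rw [zero_pow two_ne_zero, logRatioRate_zero hA]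
      have : 0 < A ^ 2 - 1 := by nlinarith
      exact mul_neg_of_pos_of_neg (by positivity) (by linarith)
    have h1 := (hasDerivAt_iff_tendsto_slope.1 hd).eventually (gt_mem_nhds hlt)
    have h2 : ∀ᶠ x in 𝓝[>] (0 : ℝ), slope (logRatio μ A) 0 x < 0 :=
      h1.filter_mono (nhdsWithin_mono _ fun x hx => ne_of_gt hx)
    obtain ⟨d, hd1, hd2⟩ := (h2.and (Ioo_mem_nhdsGT (by linarith : (0 : ℝ) < A - 1))).exists
    refine ⟨d, hd2, ?_⟩
    rw [slope_def_field, logRatio_zero, sub_zero, sub_zero] at hd1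
    exact (div_neg_iff.1 hd1).elim (fun h => absurd h.2 (not_lt.2 hd2.1.le)) fun h => h.1
  obtain ⟨a, ha, ha0⟩ := hneg
  have hlim : Tendsto (logRatio μ A) (𝓝[<] (A - 1)) atTop := by
    have h1 : Tendsto (fun d => -Real.log (A - 1 - d)) (𝓝[<] (A - 1)) atTop := by
      refine tendsto_neg_atBot_atTop.comp (Real.tendsto_log_nhdsNE_zero.comp ?_)
      refine tendsto_nhdsWithin_iff.2 ⟨?_, ?_⟩
      · have : Continuous fun d => A - 1 - d := by fun_prop
        have := this.tendsto (A - 1)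
        rw [sub_self] at this
        exact this.mono_left nhdsWithin_le_nhds
      · filter_upwards [self_mem_nhdsWithin] with x hx
        exact (sub_pos.2 hx).ne'
    have h2 : ContinuousAt (fun d => Real.log (A - 1 + d) +
        (Real.log (A + 1 + d) - Real.log (A + 1 - d)) -
        (2 * μ + 2) * (Real.log (A + d) - Real.log (A - d))) (A - 1) := by
      have c1 : ∀ a : ℝ, a + (A - 1) ≠ 0 → ContinuousAt (fun d => Real.log (a + d)) (A - 1) :=
        fun a ha => (by fun_prop : ContinuousAt (fun d => a + d) (A - 1)).log ha
      have c2 : ∀ a : ℝ, a - (A - 1) ≠ 0 → ContinuousAt (fun d => Real.log (a - d)) (A - 1) :=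
        fun a ha => (by fun_prop : ContinuousAt (fun d => a - d) (A - 1)).log ha
      exact ((c1 _ (by linarith)).add ((c1 _ (by linarith)).sub (c2 _ (by linarith)))).sub
        (continuousAt_const.mul ((c1 _ (by linarith)).sub (c2 _ (by linarith))))
    refine (h1.atTop_add (h2.tendsto.mono_left nhdsWithin_le_nhds)).congr fun d => ?_
    rw [logRatio]
    ring
  obtain ⟨b, hb1, hb2⟩ := ((hlim.eventually_gt_atTop 0).and
    (Ioo_mem_nhdsLT ha.2)).exists
  obtain ⟨d, hd, hd0⟩ := intermediate_value_Icc hb2.1.le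
    (continuousOn_logRatio.mono fun x hx => ⟨ha.1.le.trans hx.1, hx.2.trans_lt hb2.2⟩)
    ⟨ha0.le, hb1.le⟩
  exact ⟨d, ⟨ha.1.trans_le hd.1, hd.2.trans_lt hb2.2⟩, hd0⟩

theorem continuousOn_splitMass (hμ : 0 < μ) :
    ContinuousOn (splitMass B k μ A) (Icc (-(A - 1)) (A - 1)) := by
  have hM := continuous_tailMass (B := B) (k := k) hμ
  refine (hM.comp_continuousOn (ContinuousOn.inv₀ (by fun_prop) fun d hd => ?_)).add
    (hM.comp_continuousOn (ContinuousOn.inv₀ (by fun_prop) fun d hd => ?_))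
  · linarith [hd.1]
  · linarith [hd.2]

theorem splitMass_neg (d : ℝ) : splitMass B k μ A (-d) = splitMass B k μ A d := by
  rw [splitMass, splitMass, sub_neg_eq_add, ← sub_eq_add_neg, add_comm]

theorem splitMass_abs (d : ℝ) : splitMass B k μ A |d| = splitMass B k μ A d := by
  rcases abs_choice d with h | h <;> rw [h]
  exact splitMass_neg d

/-- The left side is the derivative of `u ↦ M(1/u)`. This identity is why critical points of
`splitMass` are the solutions of the matching system. -/
theorem tailDensity_inv (hB : 0 < B) (hμ : 0 < μ) {u : ℝ} (hu : 1 < u) :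
    tailDensity B k μ u⁻¹ / u ^ 2 =
      B / (μ * k) * B ^ (1 / μ) * matching μ u⁻¹ ^ (1 / μ) := by
  have hu0 : 0 < u := by linarith
  have hi : 0 < u⁻¹ := by positivity
  have hi1 : u⁻¹ < 1 := inv_lt_one_of_one_lt₀ hu
  have h1 := one_sub_sq_pos (by linarith : -1 < u⁻¹) hi1
  have e : matching μ u⁻¹ = (u⁻¹ ^ 2) ^ μ * (1 - u⁻¹ ^ 2) := by
    rw [matching, ← Real.rpow_natCast, ← Real.rpow_mul hi.le, Real.rpow_add hi]
    push_cast
    rw [Real.rpow_two]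
    ring
  rw [tailDensity, e, Real.mul_rpow hB.le h1.le, Real.mul_rpow (by positivity) h1.le,
    ← Real.rpow_mul (by positivity), mul_one_div_cancel hμ.ne', Real.rpow_one, inv_pow]
  ring

theorem hasDerivAt_splitMass (hB : 0 < B) (hμ : 0 < μ) {d : ℝ} (h1 : 1 < A + d)
    (h2 : 1 < A - d) :
    HasDerivAt (splitMass B k μ A) (B / (μ * k) * B ^ (1 / μ) *
      (matching μ (A + d)⁻¹ ^ (1 / μ) - matching μ (A - d)⁻¹ ^ (1 / μ))) d := by
  have i1 := ((hasDerivAt_id d).const_add A).inv (by simp only [id]; linarith)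
  have i2 := ((hasDerivAt_id d).const_sub A).inv (by simp only [id]; linarith)
  have h := ((hasStrictDerivAt_tailMass (B := B) (k := k) hμ (A + d)⁻¹).hasDerivAt.comp d i1).add
    ((hasStrictDerivAt_tailMass (B := B) (k := k) hμ (A - d)⁻¹).hasDerivAt.comp d i2)
  refine h.congr_deriv ?_
  rw [mul_sub, ← tailDensity_inv hB hμ h1, ← tailDensity_inv hB hμ h2]
  simp only [id]
  ring

theorem splitMass_strictMonoOn (hB : 0 < B) (hk : 0 < k) (hμ : 0 < μ) (hA : 1 < A) {c : ℝ}
    (hc : 0 ≤ c) (h : ∀ d ∈ Ioo c (A - 1), 0 < logRatio μ A d) :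
    StrictMonoOn (splitMass B k μ A) (Icc c (A - 1)) := by
  refine strictMonoOn_of_deriv_pos (convex_Icc _ _)
    ((continuousOn_splitMass hμ).mono (Icc_subset_Icc_left (by linarith))) fun d hd => ?_
  rw [interior_Icc] at hd
  have h1 : 1 < A + d := by linarith [hd.1]
  have h2 : 1 < A - d := by linarith [hd.2]
  rw [(hasDerivAt_splitMass hB hμ h1 h2).deriv]
  have hl := h d hd
  rw [logRatio_eq h1 h2, sub_pos, Real.log_lt_log_iff (matching_inv h2).1 (matching_inv h1).1] at hl
  have := Real.rpow_lt_rpow (matching_inv h2).1.le hl (by positivity : 0 < 1 / μ)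
  exact mul_pos (by positivity) (sub_pos.2 this)

theorem splitMass_strictAntiOn (hB : 0 < B) (hk : 0 < k) (hμ : 0 < μ) (hA : 1 < A) {c : ℝ}
    (hc : c ≤ A - 1) (h : ∀ d ∈ Ioo 0 c, logRatio μ A d < 0) :
    StrictAntiOn (splitMass B k μ A) (Icc 0 c) := by
  refine strictAntiOn_of_deriv_neg (convex_Icc _ _)
    ((continuousOn_splitMass hμ).mono (Icc_subset_Icc (by linarith) hc)) fun d hd => ?_
  rw [interior_Icc] at hd
  have h1 : 1 < A + d := by linarith [hd.1]
  have h2 : 1 < A - d := by linarith [hd.2]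
  rw [(hasDerivAt_splitMass hB hμ h1 h2).deriv]
  have hl := h d hd
  rw [logRatio_eq h1 h2, sub_neg, Real.log_lt_log_iff (matching_inv h1).1 (matching_inv h2).1] at hl
  have := Real.rpow_lt_rpow (matching_inv h1).1.le hl (by positivity : 0 < 1 / μ)
  exact mul_neg_of_pos_of_neg (by positivity) (sub_neg.2 this)

/-- Below the bifurcation the symmetric splitting is the unique minimizer. -/
theorem splitMass_zero_lt (hB : 0 < B) (hk : 0 < k) (hμ : 0 < μ) (hA : 1 < A)
    (h : μ * (A ^ 2 - 1) ≤ 1) {d : ℝ} (hd : |d| ≤ A - 1) (hd0 : d ≠ 0) :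
    splitMass B k μ A 0 < splitMass B k μ A d := by
  rw [← splitMass_abs d]
  exact splitMass_strictMonoOn hB hk hμ hA le_rfl
    (fun d hd => logRatio_pos_of_subcritical hA h hd) ⟨le_rfl, by linarith⟩
    ⟨abs_nonneg d, hd⟩ (abs_pos.2 hd0)

/-- A zero of `logRatio` minimizes `splitMass`. -/
theorem splitMass_lt_of_logRatio_eq_zero (hB : 0 < B) (hk : 0 < k) (hμ : 0 < μ) (hA : 1 < A)
    {d₀ : ℝ} (hd₀ : d₀ ∈ Ioo 0 (A - 1)) (hz : logRatio μ A d₀ = 0) {d : ℝ} (hd : |d| ≤ A - 1)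
    (hne : |d| ≠ d₀) : splitMass B k μ A d₀ < splitMass B k μ A d := by
  have hs := logRatio_sign_of_zero hA hd₀ hz
  rw [← splitMass_abs d]
  rcases lt_or_gt_of_ne hne with h | h
  · exact splitMass_strictAntiOn hB hk hμ hA hd₀.2.le hs.1 ⟨abs_nonneg d, h.le⟩
      ⟨hd₀.1.le, le_rfl⟩ h
  · exact splitMass_strictMonoOn hB hk hμ hA hd₀.1.le hs.2 ⟨le_rfl, hd₀.2.le⟩ ⟨h.le, hd⟩ h

theorem logRatio_eq_zero_iff {d : ℝ} (h1 : 1 < A + d) (h2 : 1 < A - d) :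
    logRatio μ A d = 0 ↔ matching μ (A + d)⁻¹ = matching μ (A - d)⁻¹ := by
  rw [logRatio_eq h1 h2, sub_eq_zero]
  exact (Real.log_injOn_pos.eq_iff (matching_inv h1).1 (matching_inv h2).1)

end

/-! ### Splitting and gluing at the origin -/

section Splitting

theorem HalfLineH1.const_mul {f g : ℝ → ℂ} (h : HalfLineH1 f g) (c : ℂ) :
    HalfLineH1 (fun x => c * f x) (fun x => c * g x) := by
  refine ⟨⟨continuous_const.mul h.continuous, h.memLp_deriv.const_mul c, fun x hx => ?_⟩,
    h.memLp.const_mul c⟩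
  rw [intervalIntegral.integral_const_mul, h.eq_add_integral x hx, mul_add]

variable {B k μ : ℝ}

/-- The sharp inequality for `f / r`, multiplied by `r²`: the quadratic terms are unaffected and
only the power-norm term keeps the factor. -/
theorem HalfLineH1.scaled_tailMass_le_action {f g : ℝ → ℂ} (h : HalfLineH1 f g) (hB : 0 < B)
    (hk : 0 < k) (hμ : 0 < μ) {t r : ℝ} (ht : 0 < t) (ht1 : t ≤ 1) (hr : 0 < r)
    (hm : ∫ x in Ioi (0 : ℝ), ‖f x‖ ^ (2 * μ + 2) = r ^ (2 * μ + 2) * tailMass B k μ t) :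
    r ^ 2 * ((μ + 1) * k ^ 2 / B * tailMass B k μ t) + k * t * ‖f 0‖ ^ 2 ≤
      (∫ x in Ioi (0 : ℝ), ‖g x‖ ^ 2) + k ^ 2 * (∫ x in Ioi (0 : ℝ), ‖f x‖ ^ 2) := by
  have hn : ∀ z : ℂ, ‖((r⁻¹ : ℝ) : ℂ) * z‖ = r⁻¹ * ‖z‖ := fun z => by
    rw [norm_mul, Complex.norm_real, Real.norm_of_nonneg (inv_nonneg.2 hr.le)]
  have hri : 0 ≤ r⁻¹ := inv_nonneg.2 hr.le
  have h1 := (h.const_mul ((r⁻¹ : ℝ) : ℂ)).tailMass_le_action hB hk hμ ht ht1 (by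
    simp only [hn]
    have : ∀ x, (r⁻¹ * ‖f x‖) ^ (2 * μ + 2) = (r ^ (2 * μ + 2))⁻¹ * ‖f x‖ ^ (2 * μ + 2) :=
      fun x => by rw [Real.mul_rpow hri (norm_nonneg _), Real.inv_rpow hr.le]
    simp only [this]
    rw [integral_const_mul, hm, inv_mul_cancel_left₀ (Real.rpow_pos_of_pos hr _).ne'])
  simp only [hn, mul_pow, integral_const_mul] at h1
  have h2 := mul_le_mul_of_nonneg_left h1 (sq_nonneg r)
  have e : r ^ 2 * r⁻¹ ^ 2 = 1 := by
    rw [← mul_pow, mul_inv_cancel₀ hr.ne', one_pow]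
  have e1 : ∀ a b c d : ℝ, r ^ 2 * (r⁻¹ ^ 2 * a + b * (r⁻¹ ^ 2 * c)) =
      (r ^ 2 * r⁻¹ ^ 2) * (a + b * c) := fun a b c d => by ring
  have e2 : ∀ a b c : ℝ, r ^ 2 * (a + b * (r⁻¹ ^ 2 * c)) =
      r ^ 2 * a + (r ^ 2 * r⁻¹ ^ 2) * (b * c) := fun a b c => by ring
  rw [e1 _ _ _ 0, e2, e, one_mul, one_mul] at h2
  exact h2

/-- The intermediate value theorem for the cross product `m₁ M(t₂) - m₂ M(t₁)` gives the right
proportion; then `r` adjusts the total. At `|d| = A - 1` one slope is `1`, which allows for a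
half-line carrying nothing. -/
theorem exists_split {A m₁ m₂ : ℝ} (hB : 0 < B) (hk : 0 < k) (hμ : 0 < μ) (hA : 1 < A)
    (h₁ : 0 ≤ m₁) (h₂ : 0 ≤ m₂) (hm : 0 < m₁ + m₂) :
    ∃ d r, |d| ≤ A - 1 ∧ 0 < r ∧ m₁ = r ^ (2 * μ + 2) * tailMass B k μ (A + d)⁻¹ ∧
      m₂ = r ^ (2 * μ + 2) * tailMass B k μ (A - d)⁻¹ := by
  have hM := continuous_tailMass (B := B) (k := k) hμ
  have c1 : ContinuousOn (fun d => tailMass B k μ (A + d)⁻¹) (Icc (-(A - 1)) (A - 1)) :=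
    hM.comp_continuousOn (ContinuousOn.inv₀ (by fun_prop) fun d hd => by linarith [hd.1])
  have c2 : ContinuousOn (fun d => tailMass B k μ (A - d)⁻¹) (Icc (-(A - 1)) (A - 1)) :=
    hM.comp_continuousOn (ContinuousOn.inv₀ (by fun_prop) fun d hd => by linarith [hd.2])
  have hnn : ∀ u : ℝ, 1 ≤ u → 0 ≤ tailMass B k μ u⁻¹ := fun u hu =>
    tailMass_nonneg hB hk hμ (by positivity) (inv_le_one_of_one_le₀ hu)
  have hpos : ∀ u : ℝ, 1 < u → 0 < tailMass B k μ u⁻¹ := fun u hu =>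
    tailMass_pos hB hk hμ (by positivity) (inv_lt_one_of_one_lt₀ hu)
  have hIcc : -(A - 1) ≤ A - 1 := by linarith
  have hH : ContinuousOn (fun d => m₁ * tailMass B k μ (A - d)⁻¹ - m₂ * tailMass B k μ (A + d)⁻¹)
      (Icc (-(A - 1)) (A - 1)) := (continuousOn_const.mul c2).sub (continuousOn_const.mul c1)
  have hr : m₁ * tailMass B k μ (A - (A - 1))⁻¹ - m₂ * tailMass B k μ (A + (A - 1))⁻¹ ≤ 0 := by
    rw [sub_sub_cancel, inv_one, tailMass_one, mul_zero, zero_sub]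
    exact neg_nonpos.2 (mul_nonneg h₂ (hnn _ (by linarith)))
  have hl : 0 ≤ m₁ * tailMass B k μ (A - -(A - 1))⁻¹ - m₂ * tailMass B k μ (A + -(A - 1))⁻¹ := by
    rw [show A + -(A - 1) = 1 by ring, inv_one, tailMass_one, mul_zero, sub_zero]
    exact mul_nonneg h₁ (hnn _ (by linarith))
  obtain ⟨d, hd, hd1⟩ := intermediate_value_Icc' hIcc hH ⟨hr, hl⟩
  have hd0 : m₁ * tailMass B k μ (A - d)⁻¹ - m₂ * tailMass B k μ (A + d)⁻¹ = 0 := hd1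
  have hs : 0 < tailMass B k μ (A + d)⁻¹ + tailMass B k μ (A - d)⁻¹ := by
    rcases le_total 0 d with h | h
    · exact add_pos_of_pos_of_nonneg (hpos _ (by linarith)) (hnn _ (by linarith [hd.2]))
    · exact add_pos_of_nonneg_of_pos (hnn _ (by linarith [hd.1])) (hpos _ (by linarith))
  have hp : 2 * μ + 2 ≠ 0 := by positivity
  have hq : 0 < (m₁ + m₂) / (tailMass B k μ (A + d)⁻¹ + tailMass B k μ (A - d)⁻¹) := by positivity
  refine ⟨d, ((m₁ + m₂) / (tailMass B k μ (A + d)⁻¹ + tailMass B k μ (A - d)⁻¹)) ^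
    (2 * μ + 2)⁻¹, abs_le.2 ⟨hd.1, hd.2⟩, Real.rpow_pos_of_pos hq _, ?_, ?_⟩
  · rw [Real.rpow_inv_rpow hq.le hp, div_mul_eq_mul_div, eq_div_iff hs.ne']
    linarith
  · rw [Real.rpow_inv_rpow hq.le hp, div_mul_eq_mul_div, eq_div_iff hs.ne']
    linarith

/-- Cauchy-Schwarz after the triangle inequality. Equality forces `a` and `b` to point in opposite
directions, which is where the sign change at the origin comes from. -/
theorem norm_sub_sq_le {t₁ t₂ : ℝ} (h₁ : 0 < t₁) (h₂ : 0 < t₂) (a b : ℂ) :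
    ‖a - b‖ ^ 2 ≤ (t₁⁻¹ + t₂⁻¹) * (t₁ * ‖a‖ ^ 2 + t₂ * ‖b‖ ^ 2) ∧
    ((t₁⁻¹ + t₂⁻¹) * (t₁ * ‖a‖ ^ 2 + t₂ * ‖b‖ ^ 2) ≤ ‖a - b‖ ^ 2 → ‖a - b‖ = ‖a‖ + ‖b‖) := by
  have h := norm_sub_le a b
  have h0 : (t₁⁻¹ + t₂⁻¹) * (t₁ * ‖a‖ ^ 2 + t₂ * ‖b‖ ^ 2) =
      (‖a‖ + ‖b‖) ^ 2 + (t₁ * ‖a‖ - t₂ * ‖b‖) ^ 2 * (t₁⁻¹ * t₂⁻¹) := by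
    field_simp
    ring
  have h1 : 0 ≤ (t₁ * ‖a‖ - t₂ * ‖b‖) ^ 2 * (t₁⁻¹ * t₂⁻¹) := by positivity
  have h2 : ‖a - b‖ ^ 2 ≤ (‖a‖ + ‖b‖) ^ 2 := by gcongr
  rw [h0]
  refine ⟨by linarith, fun h3 => le_antisymm h ?_⟩
  have h4 : (‖a‖ + ‖b‖) ^ 2 ≤ ‖a - b‖ ^ 2 := by linarith
  exact (sq_le_sq₀ (by positivity) (by positivity)).1 h4

theorem eq_neg_of_norm_sub_eq {u v : ℂ} {r s : ℝ} (hu : ‖u‖ = 1) (hv : ‖v‖ = 1) (hr : 0 < r)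
    (hs : 0 < s) (h : ‖u * r - v * s‖ = r + s) : v = -u := by
  have h1 : ‖u * r - v * s‖ = ‖u * r‖ + ‖v * s‖ := by
    rw [h, norm_mul, norm_mul, hu, hv, Complex.norm_real, Complex.norm_real,
      Real.norm_of_nonneg hr.le, Real.norm_of_nonneg hs.le, one_mul, one_mul]
  have h2 : ‖u * r + -(v * s)‖ = ‖u * r‖ + ‖-(v * s)‖ := by
    rw [← sub_eq_add_neg, norm_neg, h1]
  have h3 : SameRay ℝ (u * r) (-(v * s)) := sameRay_iff_norm_add.2 h2
  have h4 := sameRay_iff_norm_smul_eq.1 h3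
  rw [norm_neg, norm_mul, norm_mul, hu, hv, Complex.norm_real, Complex.norm_real,
      Real.norm_of_nonneg hr.le, Real.norm_of_nonneg hs.le, one_mul, one_mul] at h4
  have hrs : ((r * s : ℝ) : ℂ) ≠ 0 := by exact_mod_cast (mul_pos hr hs).ne'
  refine mul_left_cancel₀ hrs ?_
  simp only [Complex.real_smul] at h4
  push_cast
  linear_combination -h4

end Splitting

/-! ### Bound states and ground states -/

section BoundStates

variable {γ lam μ ω : ℝ}

theorem soliton_eq_tailProfile (hlam : 0 < lam) (hμ : 0 < μ) (hω : 0 < ω) (x₀ x : ℝ) :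
    soliton lam μ ω x₀ x = tailProfile ((μ + 1) * ω / lam) (√ω) μ (-x₀) x := by
  rw [soliton, tailProfile, Real.div_rpow (by positivity) hlam.le,
    Real.mul_rpow (by positivity) hω.le, Real.rpow_neg hlam.le, ← sub_eq_add_neg]
  ring

theorem soliton_neg (lam μ ω x₀ x : ℝ) : soliton lam μ ω x₀ (-x) = soliton lam μ ω (-x₀) x := by
  rw [soliton, soliton, ← Real.cosh_neg (μ * √ω * (-x - x₀))]
  congr 4
  ring

theorem centre_eq {t : ℝ} (ht : -1 < t) (ht1 : t < 1) :
    centre μ ω t = Real.artanh t / (μ * √ω) := by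
  rw [centre, Real.artanh_eq_half_log ⟨ht.le, ht1.le⟩,
    abs_of_pos (div_pos (by linarith) (by linarith)), ← div_div, ← div_div]
  ring

theorem tanh_centre (hμ : 0 < μ) (hω : 0 < ω) {t : ℝ} (ht : -1 < t) (ht1 : t < 1) :
    Real.tanh (μ * √ω * centre μ ω t) = t := by
  have : 0 < √ω := Real.sqrt_pos.2 hω
  rw [centre_eq ht ht1, mul_div_cancel₀ _ (by positivity), Real.tanh_artanh ⟨ht, ht1⟩]

theorem centre_pos (hμ : 0 < μ) (hω : 0 < ω) {t : ℝ} (ht : 0 < t) (ht1 : t < 1) :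
    0 < centre μ ω t := by
  have : 0 < √ω := Real.sqrt_pos.2 hω
  rw [centre_eq (by linarith) ht1]
  exact div_pos (Real.artanh_pos ⟨ht, ht1⟩) (by positivity)

theorem centre_lt_centre (hμ : 0 < μ) (hω : 0 < ω) {t₁ t₂ : ℝ} (ht : 0 < t₁) (h : t₁ < t₂)
    (ht1 : t₂ < 1) : centre μ ω t₁ < centre μ ω t₂ := by
  have : 0 < √ω := Real.sqrt_pos.2 hω
  rw [centre_eq (by linarith) (by linarith), centre_eq (by linarith) ht1]
  exact div_lt_div_of_pos_right (Real.artanh_lt_artanh (by linarith) ht1 h) (by positivity)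

theorem boundState_neg {θ x : ℝ} (y : ℝ) (hx : x ≠ 0) :
    boundState lam μ ω y (-y) θ (-x) = -boundState lam μ ω y (-y) θ x := by
  rcases lt_or_gt_of_ne hx with h | h
  · rw [boundState, boundState, if_neg (by linarith), if_pos h, soliton_neg]
    simp
  · rw [boundState, boundState, if_pos (by linarith), if_neg (by linarith), soliton_neg]

theorem ae_of_ae_restrict {P : ℝ → Prop} (h1 : ∀ᵐ x ∂volume.restrict (Ioi 0), P x)
    (h2 : ∀ᵐ x ∂volume.restrict (Iio 0), P x) : ∀ᵐ x, P x := by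
  rw [ae_restrict_iff' measurableSet_Ioi] at h1
  rw [ae_restrict_iff' measurableSet_Iio] at h2
  have h0 : ∀ᵐ x : ℝ, x ≠ 0 := by simp [ae_iff, measure_singleton]
  filter_upwards [h1, h2, h0] with x hx1 hx2 hx0
  rcases lt_or_gt_of_ne hx0 with h | h
  · exact hx2 h
  · exact hx1 h

theorem mem_phaseOrbit_iff (hlam : 0 < lam) (hμ : 0 < μ) (hω : 0 < ω) {x₁ x₂ : ℝ} {ψ : ℝ → ℂ} :
    ψ ∈ phaseOrbit lam μ ω x₁ (-x₂) ↔ ∃ θ : ℝ,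
      (ψ =ᵐ[volume.restrict (Ioi 0)] fun x => Complex.exp (θ * Complex.I) *
        tailProfile ((μ + 1) * ω / lam) (√ω) μ x₂ x) ∧
      (fun x => ψ (-x)) =ᵐ[volume.restrict (Ioi 0)] fun x => -Complex.exp (θ * Complex.I) *
        tailProfile ((μ + 1) * ω / lam) (√ω) μ x₁ x := by
  have hr : ∀ θ x : ℝ, 0 < x → boundState lam μ ω x₁ (-x₂) θ x = Complex.exp (θ * Complex.I) *
      tailProfile ((μ + 1) * ω / lam) (√ω) μ x₂ x := fun θ x hx => by
    rw [boundState, if_neg (by linarith), soliton_eq_tailProfile hlam hμ hω, neg_neg]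
  have hl : ∀ θ x : ℝ, 0 < x → boundState lam μ ω x₁ (-x₂) θ (-x) =
      -Complex.exp (θ * Complex.I) * tailProfile ((μ + 1) * ω / lam) (√ω) μ x₁ x :=
    fun θ x hx => by
    rw [boundState, if_pos (by linarith), soliton_neg, soliton_eq_tailProfile hlam hμ hω, neg_neg,
      neg_mul]
  refine exists_congr fun θ => ⟨fun h => ⟨?_, ?_⟩, fun h => ae_of_ae_restrict ?_ ?_⟩
  · filter_upwards [ae_restrict_of_ae h, ae_restrict_mem measurableSet_Ioi] with x hx hx0
    rw [hx, hr θ x hx0]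
  · have h' := (Measure.measurePreserving_neg
      (volume : Measure ℝ)).quasiMeasurePreserving.ae_eq_comp h
    filter_upwards [ae_restrict_of_ae h', ae_restrict_mem measurableSet_Ioi] with x hx hx0
    exact hx.trans (hl θ x hx0)
  · filter_upwards [h.1, ae_restrict_mem measurableSet_Ioi] with x hx hx0
    rw [hx, hr θ x hx0]
  · filter_upwards [ae_eq_Iio_of_comp_neg h.2, ae_restrict_mem measurableSet_Iio] with x hx hx0
    have := hl θ (-x) (by simpa using hx0)
    rw [neg_neg] at this
    rw [hx, this]

theorem lam_eq (hlam : 0 < lam) (hμ : 0 < μ) (hω : 0 < ω) :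
    (μ + 1) * √ω ^ 2 / ((μ + 1) * ω / lam) = lam := by
  rw [Real.sq_sqrt hω.le]
  field_simp

theorem sq_mul_ampPow_rpow {B : ℝ} (hB : 0 < B) (hμ : 0 < μ) {t : ℝ} (ht : 0 < t) (ht1 : t < 1) :
    t ^ 2 * ampPow B t ^ (1 / μ) = (B * matching μ t) ^ (1 / μ) := by
  have e : B * matching μ t = (t ^ 2) ^ μ * ampPow B t := by
    rw [matching, ampPow, ← Real.rpow_natCast, ← Real.rpow_mul ht.le, Real.rpow_add ht]
    push_cast
    rw [Real.rpow_two]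
    ring
  rw [e, Real.mul_rpow (by positivity) (ampPow_pos hB (by linarith) ht1).le,
    ← Real.rpow_mul (by positivity), mul_one_div_cancel hμ.ne', Real.rpow_one]

/-- The bound states with matched slopes lie on the Nehari manifold. -/
theorem mem_nehariManifold_of_mem_phaseOrbit (hγ : 0 < γ) (hlam : 0 < lam) (hμ : 0 < μ)
    (hω : 0 < ω) {t₁ t₂ : ℝ} (h₁ : 0 < t₁) (h₁' : t₁ < 1) (h₂ : 0 < t₂) (h₂' : t₂ < 1)
    (hsum : t₁⁻¹ + t₂⁻¹ = γ * √ω) (hmatch : matching μ t₁ = matching μ t₂) {ψ : ℝ → ℂ}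
    (hψ : ψ ∈ phaseOrbit lam μ ω (centre μ ω t₂) (-centre μ ω t₁)) :
    ψ ∈ nehariManifold γ lam μ ω ∧
      powerNorm μ ψ = tailMass ((μ + 1) * ω / lam) (√ω) μ t₁ +
        tailMass ((μ + 1) * ω / lam) (√ω) μ t₂ := by
  set B := (μ + 1) * ω / lam with hBdef
  have hB : 0 < B := by positivity
  have hk : 0 < √ω := Real.sqrt_pos.2 hω
  obtain ⟨θ, hr, hl⟩ := (mem_phaseOrbit_iff hlam hμ hω).1 hψ
  set y₁ := centre μ ω t₁
  set y₂ := centre μ ω t₂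
  have hT₁ : Real.tanh (μ * √ω * y₁) = t₁ := tanh_centre hμ hω (by linarith) h₁'
  have hT₂ : Real.tanh (μ * √ω * y₂) = t₂ := tanh_centre hμ hω (by linarith) h₂'
  have hu : ‖Complex.exp (θ * Complex.I)‖ = 1 := Complex.norm_exp_ofReal_mul_I θ
  have hu' : ‖-Complex.exp (θ * Complex.I)‖ = 1 := by rw [norm_neg, hu]
  have hrep : EnergyRep ψ _ _ _ _ := ⟨halfLineH1_tailProfile hB hk hμ y₁ _ hu,
    halfLineH1_tailProfile hB hk hμ y₂ _ hu', hr, hl⟩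
  have hpow : ∀ (u : ℂ) (y : ℝ), ‖u‖ = 1 →
      ∫ x in Ioi (0 : ℝ), ‖u * (tailProfile B (√ω) μ y x : ℂ)‖ ^ (2 * μ + 2) =
      tailMass B (√ω) μ (Real.tanh (μ * √ω * y)) := by
    intro u y hu
    rw [← integral_tailProfile_rpow hB hk hμ]
    congr 1
    funext x
    rw [norm_mul, hu, one_mul, Complex.norm_real,
      Real.norm_of_nonneg (tailProfile_pos hB y x).le]
  have hN : powerNorm μ ψ = tailMass B (√ω) μ t₁ + tailMass B (√ω) μ t₂ := by
    rw [hrep.powerNorm_eq hμ, hpow _ _ hu, hpow _ _ hu', hT₁, hT₂]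
  refine ⟨⟨hrep.mem_energySpace, fun h0 => ?_, ?_⟩, hN⟩
  · have : powerNorm μ ψ = 0 := by
      rw [powerNorm, integral_congr_ae (g := fun _ => (0 : ℝ)), integral_zero]
      filter_upwards [h0] with x hx
      rw [hx, Pi.zero_apply, norm_zero, Real.zero_rpow (by positivity)]
    have p1 := tailMass_pos (k := √ω) hB hk hμ h₁.le h₁'
    have p2 := tailMass_pos (k := √ω) hB hk hμ h₂.le h₂'
    linarith
  · rw [hrep.nehari_eq hμ, hpow _ _ hu, hpow _ _ hu']
    have a1 := integral_action_tailProfile hB hk hμ y₁ _ hu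
    have a2 := integral_action_tailProfile hB hk hμ y₂ _ hu'
    rw [hT₁] at a1
    rw [hT₂] at a2
    rw [lam_eq hlam hμ hω] at a1 a2
    rw [hT₁, hT₂]
    rw [Real.sq_sqrt hω.le] at a1 a2
    rw [a1, a2]
    set p₁ := tailProfile B (√ω) μ y₁ 0
    set p₂ := tailProfile B (√ω) μ y₂ 0
    have hp₁ : 0 < p₁ := tailProfile_pos hB _ _
    have hp₂ : 0 < p₂ := tailProfile_pos hB _ _
    have hdiff : ‖Complex.exp (θ * Complex.I) * (p₁ : ℂ) - -Complex.exp (θ * Complex.I) * (p₂ : ℂ)‖ =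
        p₁ + p₂ := by
      rw [neg_mul, sub_neg_eq_add, ← mul_add, ← Complex.ofReal_add,
        norm_exp_mul_ofReal θ _ (by positivity)]
    rw [hdiff]
    -- Here the matching condition enters: it says that the one-sided derivatives at the origin
    -- agree.
    have hq : t₁ * p₁ = t₂ * p₂ := by
      refine (sq_eq_sq₀ (by positivity) (by positivity)).1 ?_
      rw [mul_pow, mul_pow, tailProfile_sq hB, tailProfile_sq hB, zero_add, zero_add, hT₁, hT₂,
        sq_mul_ampPow_rpow hB hμ h₁ h₁', sq_mul_ampPow_rpow hB hμ h₂ h₂', hmatch]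
    have hp₂' : p₂ = t₁ * p₁ / t₂ := by rw [hq]; field_simp
    have hkγ : √ω = γ⁻¹ * (t₁⁻¹ + t₂⁻¹) := by rw [hsum]; field_simp
    rw [hp₂', hkγ]
    field_simp
    ring

/-- Every element of the Nehari manifold has at least the power norm of some pair of soliton tails,
with equality only for bound states. -/
theorem exists_splitMass_le_powerNorm (hγ : 0 < γ) (hlam : 0 < lam) (hμ : 0 < μ) (hω : 0 < ω)
    {A : ℝ} (hA : 1 < A) (hAe : 2 * A = γ * √ω) {ψ : ℝ → ℂ}
    (hψ : ψ ∈ nehariManifold γ lam μ ω) :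
    ∃ d, |d| ≤ A - 1 ∧ splitMass ((μ + 1) * ω / lam) (√ω) μ A d ≤ powerNorm μ ψ ∧
      (powerNorm μ ψ ≤ splitMass ((μ + 1) * ω / lam) (√ω) μ A d → |d| < A - 1 →
        ψ ∈ phaseOrbit lam μ ω (centre μ ω (A - d)⁻¹) (-centre μ ω (A + d)⁻¹)) := by
  set B := (μ + 1) * ω / lam with hBdef
  have hB : 0 < B := by positivity
  have hk : 0 < √ω := Real.sqrt_pos.2 hω
  obtain ⟨hQ, hne, hI⟩ := hψ
  obtain ⟨f₁, g₁, f₂, g₂, hrep⟩ := exists_energyRep hQ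
  have hN := hrep.powerNorm_eq hμ
  rw [hrep.nehari_eq hμ, ← hN] at hI
  set m₁ := ∫ x in Ioi (0 : ℝ), ‖f₁ x‖ ^ (2 * μ + 2) with hm₁
  set m₂ := ∫ x in Ioi (0 : ℝ), ‖f₂ x‖ ^ (2 * μ + 2) with hm₂
  have hm₁0 : 0 ≤ m₁ := integral_nonneg fun x => by positivity
  have hm₂0 : 0 ≤ m₂ := integral_nonneg fun x => by positivity
  have hmpos : 0 < m₁ + m₂ := by
    refine lt_of_le_of_ne (by positivity) fun h0 => hne ?_
    have z1 := hrep.right.ae_eq_zero_of_integral_eq_zero hμ (show m₁ = 0 by linarith)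
    have z2 := hrep.left.ae_eq_zero_of_integral_eq_zero hμ (show m₂ = 0 by linarith)
    refine ae_of_ae_restrict (hrep.right_ae.trans z1) ?_
    exact ae_eq_Iio_of_comp_neg (f := fun _ => 0) (hrep.left_ae.trans z2)
  obtain ⟨d, r, hd, hr, e₁, e₂⟩ := exists_split (k := √ω) hB hk hμ hA hm₁0 hm₂0 hmpos
  have hd' := abs_le.1 hd
  have u₁ : 1 ≤ A + d := by linarith [hd'.1]
  have u₂ : 1 ≤ A - d := by linarith [hd'.2]
  set t₁ := (A + d)⁻¹ with ht₁
  set t₂ := (A - d)⁻¹ with ht₂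
  have h₁ : 0 < t₁ := by positivity
  have h₂ : 0 < t₂ := by positivity
  have h₁1 : t₁ ≤ 1 := inv_le_one_of_one_le₀ u₁
  have h₂1 : t₂ ≤ 1 := inv_le_one_of_one_le₀ u₂
  have hS : splitMass B (√ω) μ A d = tailMass B (√ω) μ t₁ + tailMass B (√ω) μ t₂ := rfl
  have hNS : powerNorm μ ψ = r ^ (2 * μ + 2) * splitMass B (√ω) μ A d := by
    rw [hN, e₁, e₂, hS]
    ring
  have hSpos : 0 < splitMass B (√ω) μ A d := by
    rw [← hN, hNS] at hmpos
    exact pos_of_mul_pos_right hmpos (Real.rpow_pos_of_pos hr _).le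
  have i₁ := hrep.right.scaled_tailMass_le_action hB hk hμ h₁ h₁1 hr e₁
  have i₂ := hrep.left.scaled_tailMass_le_action hB hk hμ h₂ h₂1 hr e₂
  rw [lam_eq hlam hμ hω, Real.sq_sqrt hω.le] at i₁ i₂
  have hcs := norm_sub_sq_le h₁ h₂ (f₁ 0) (f₂ 0)
  have hsum : t₁⁻¹ + t₂⁻¹ = γ * √ω := by
    rw [ht₁, ht₂, inv_inv, inv_inv, ← hAe]
    ring
  rw [hsum] at hcs
  have hcs' : γ⁻¹ * ‖f₁ 0 - f₂ 0‖ ^ 2 ≤ √ω * t₁ * ‖f₁ 0‖ ^ 2 + √ω * t₂ * ‖f₂ 0‖ ^ 2 := by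
    rw [inv_mul_le_iff₀ hγ]
    linarith [hcs.1]
  -- The sum of the two half-line inequalities, with the jump term of the Nehari constraint absorbed
  -- by the boundary terms.
  have hmain : r ^ 2 * (lam * splitMass B (√ω) μ A d) ≤ lam * powerNorm μ ψ := by
    rw [hS]
    linarith
  have hrr : r ^ 2 ≤ r ^ (2 * μ + 2) := by
    rw [hNS] at hmain
    have : 0 < lam * splitMass B (√ω) μ A d := by positivity
    refine le_of_mul_le_mul_right ?_ this
    linarith
  have hr1 : 1 ≤ r := by
    by_contra hlt
    have := Real.rpow_lt_rpow_of_exponent_gt hr (not_le.1 hlt) (by linarith : 2 < 2 * μ + 2)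
    rw [Real.rpow_two] at this
    linarith
  have hle : splitMass B (√ω) μ A d ≤ powerNorm μ ψ := by
    rw [hNS]
    exact le_mul_of_one_le_left hSpos.le (Real.one_le_rpow hr1 (by positivity))
  refine ⟨d, hd, hle, fun hge hdlt => ?_⟩
  -- Equality of power norms leaves no room for scaling, and then every inequality used is an
  -- equality. Strict `|d| < A - 1` keeps both slopes below `1`, as the rigidity statement requires.
  have hreq : r = 1 := by
    have h0 : r ^ (2 * μ + 2) ≤ 1 := by
      rw [hNS] at hge
      exact le_of_mul_le_mul_right (by linarith) hSpos
    by_contra hne1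
    have := Real.one_lt_rpow (lt_of_le_of_ne hr1 (Ne.symm hne1)) (by positivity : 0 < 2 * μ + 2)
    linarith
  rw [hreq, Real.one_rpow, one_mul] at e₁ e₂
  have hNe : powerNorm μ ψ = splitMass B (√ω) μ A d := le_antisymm hge hle
  rw [hreq, one_pow, one_mul] at i₁ i₂
  rw [hNe, hS] at hI
  have hdlt' := abs_lt.1 hdlt
  have h₁' : t₁ < 1 := inv_lt_one_of_one_lt₀ (by linarith [hdlt'.1])
  have h₂' : t₂ < 1 := inv_lt_one_of_one_lt₀ (by linarith [hdlt'.2])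
  set y₁ := centre μ ω t₁
  set y₂ := centre μ ω t₂
  have hT₁ : Real.tanh (μ * √ω * y₁) = t₁ := tanh_centre hμ hω (by linarith) h₁'
  have hT₂ : Real.tanh (μ * √ω * y₂) = t₂ := tanh_centre hμ hω (by linarith) h₂'
  obtain ⟨θ₁, hf₁⟩ := hrep.right.eq_tailProfile_of_equality hB hk hμ (y := y₁)
    (centre_pos hμ hω h₁ h₁') (by rw [hT₁]; exact e₁) (by
      rw [hT₁, lam_eq hlam hμ hω, Real.sq_sqrt hω.le]
      linarith)
  obtain ⟨θ₂, hf₂⟩ := hrep.left.eq_tailProfile_of_equality hB hk hμ (y := y₂)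
    (centre_pos hμ hω h₂ h₂') (by rw [hT₂]; exact e₂) (by
      rw [hT₂, lam_eq hlam hμ hω, Real.sq_sqrt hω.le]
      linarith)
  have hnorm := hcs.2 (by
    have : √ω * t₁ * ‖f₁ 0‖ ^ 2 + √ω * t₂ * ‖f₂ 0‖ ^ 2 ≤ γ⁻¹ * ‖f₁ 0 - f₂ 0‖ ^ 2 := by linarith
    rw [le_inv_mul_iff₀ hγ] at this
    linarith)
  have hp₁ := tailProfile_pos (k := √ω) (μ := μ) hB y₁ 0
  have hp₂ := tailProfile_pos (k := √ω) (μ := μ) hB y₂ 0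
  rw [hf₁ 0 le_rfl, hf₂ 0 le_rfl, norm_exp_mul_ofReal _ _ hp₁.le,
    norm_exp_mul_ofReal _ _ hp₂.le] at hnorm
  have hopp := eq_neg_of_norm_sub_eq (Complex.norm_exp_ofReal_mul_I θ₁)
    (Complex.norm_exp_ofReal_mul_I θ₂) hp₁ hp₂ hnorm
  refine (mem_phaseOrbit_iff hlam hμ hω).2 ⟨θ₁, ?_, ?_⟩
  · filter_upwards [hrep.right_ae, ae_restrict_mem measurableSet_Ioi] with x hx hx0
    rw [hx, hf₁ x (le_of_lt hx0)]
  · filter_upwards [hrep.left_ae, ae_restrict_mem measurableSet_Ioi] with x hx hx0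
    rw [hx, hf₂ x (le_of_lt hx0), hopp]

/-- The ground states are the bound states whose splitting minimizes `splitMass`. -/
theorem groundStates_eq (hγ : 0 < γ) (hlam : 0 < lam) (hμ : 0 < μ) (hω : 0 < ω) {A d₀ : ℝ}
    (hAe : 2 * A = γ * √ω) (hd0 : 0 ≤ d₀) (hd1 : d₀ < A - 1)
    (hmatch : matching μ (A + d₀)⁻¹ = matching μ (A - d₀)⁻¹)
    (hmin : ∀ d, |d| ≤ A - 1 → |d| ≠ d₀ → splitMass ((μ + 1) * ω / lam) (√ω) μ A d₀ <
      splitMass ((μ + 1) * ω / lam) (√ω) μ A d) :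
    groundStates γ lam μ ω =
      phaseOrbit lam μ ω (centre μ ω (A + d₀)⁻¹) (-centre μ ω (A - d₀)⁻¹) ∪
      phaseOrbit lam μ ω (centre μ ω (A - d₀)⁻¹) (-centre μ ω (A + d₀)⁻¹) := by
  have hA : 1 < A := by linarith
  set B := (μ + 1) * ω / lam with hBdef
  have p₁ : 0 < (A + d₀)⁻¹ := inv_pos.2 (by linarith)
  have p₂ : 0 < (A - d₀)⁻¹ := inv_pos.2 (by linarith)
  have q₁ : (A + d₀)⁻¹ < 1 := inv_lt_one_of_one_lt₀ (by linarith)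
  have q₂ : (A - d₀)⁻¹ < 1 := inv_lt_one_of_one_lt₀ (by linarith)
  have hc : 0 < lam * μ / (2 * μ + 2) := by positivity
  have horb : ∀ ψ, ψ ∈ phaseOrbit lam μ ω (centre μ ω (A + d₀)⁻¹) (-centre μ ω (A - d₀)⁻¹) ∪
      phaseOrbit lam μ ω (centre μ ω (A - d₀)⁻¹) (-centre μ ω (A + d₀)⁻¹) →
      ψ ∈ nehariManifold γ lam μ ω ∧ powerNorm μ ψ = splitMass B (√ω) μ A d₀ := by
    rintro ψ (hψ | hψ)
    · have := mem_nehariManifold_of_mem_phaseOrbit hγ hlam hμ hω p₂ q₂ p₁ q₁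
        (by rw [inv_inv, inv_inv, ← hAe]; ring) hmatch.symm hψ
      exact ⟨this.1, by rw [this.2, splitMass, add_comm]⟩
    · have := mem_nehariManifold_of_mem_phaseOrbit hγ hlam hμ hω p₁ q₁ p₂ q₂
        (by rw [inv_inv, inv_inv, ← hAe]; ring) hmatch hψ
      exact ⟨this.1, by rw [this.2, splitMass]⟩
  ext ψ
  constructor
  · rintro ⟨hψ, hψmin⟩
    obtain ⟨d, hd, hle, hrig⟩ := exists_splitMass_le_powerNorm hγ hlam hμ hω hA hAe hψ
    obtain ⟨hφ, hφN⟩ := horb (boundState lam μ ω (centre μ ω (A + d₀)⁻¹)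
      (-centre μ ω (A - d₀)⁻¹) 0) (Or.inl ⟨0, ae_eq_refl _⟩)
    have h1 := hψmin _ hφ
    rw [action_eq_of_nehari_eq_zero hμ hψ.2.2, action_eq_of_nehari_eq_zero hμ hφ.2.2, hφN] at h1
    have h2 := le_of_mul_le_mul_left h1 hc
    -- A ground state has power norm at most `S(d₀)` but at least `S(d)`, so `d` itself is a
    -- minimizer. Its sign selects one of the two orbits.
    have hdd : |d| = d₀ := by
      by_contra hne
      have := hmin d hd hne
      linarith
    have hdS : splitMass B (√ω) μ A d = splitMass B (√ω) μ A d₀ := by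
      rw [← splitMass_abs d, hdd]
    have := hrig (by rw [hdS]; exact h2) (by rw [hdd]; exact hd1)
    rcases abs_choice d with h | h
    · rw [hdd] at h
      rw [← h] at this
      exact Or.inr this
    · rw [hdd] at h
      rw [show d = -d₀ by linarith, sub_neg_eq_add, ← sub_eq_add_neg] at this
      exact Or.inl this
  · intro hψ
    obtain ⟨hψn, hψN⟩ := horb ψ hψ
    refine ⟨hψn, fun φ hφ => ?_⟩
    rw [action_eq_of_nehari_eq_zero hμ hψn.2.2, action_eq_of_nehari_eq_zero hμ hφ.2.2, hψN]
    refine mul_le_mul_of_nonneg_left ?_ hc.le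
    obtain ⟨d, hd, hle, -⟩ := exists_splitMass_le_powerNorm hγ hlam hμ hω hA hAe hφ
    refine le_trans ?_ hle
    by_cases hdd : |d| = d₀
    · rw [← splitMass_abs d, hdd]
    · exact (hmin d hd hdd).le

/-- A common element would have two different moduli at some `x > 0`, since the amplitude is a
strictly decreasing function of the slope, which is larger for the larger centre. -/
theorem disjoint_phaseOrbit (hlam : 0 < lam) (hμ : 0 < μ) (hω : 0 < ω) {y₁ y₂ : ℝ} (h₁ : 0 < y₁)
    (h : y₁ < y₂) :
    Disjoint (phaseOrbit lam μ ω y₁ (-y₂)) (phaseOrbit lam μ ω y₂ (-y₁)) := by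
  rw [Set.disjoint_left]
  intro ψ hψ hψ'
  obtain ⟨θ, hr, -⟩ := (mem_phaseOrbit_iff hlam hμ hω).1 hψ
  obtain ⟨θ', hr', -⟩ := (mem_phaseOrbit_iff hlam hμ hω).1 hψ'
  have hB : 0 < (μ + 1) * ω / lam := by positivity
  have hk : 0 < √ω := Real.sqrt_pos.2 hω
  have hne : (ae (volume.restrict (Ioi (0 : ℝ)))).NeBot := by
    rw [ae_neBot, Ne, Measure.restrict_eq_zero, Real.volume_Ioi]
    exact ENNReal.top_ne_zero
  obtain ⟨x, ⟨hx, hx'⟩, hx0⟩ := ((hr.and hr').and (ae_restrict_mem measurableSet_Ioi)).exists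
  have he := congrArg norm (hx.symm.trans hx')
  rw [norm_exp_mul_ofReal _ _ (tailProfile_pos hB _ _).le,
    norm_exp_mul_ofReal _ _ (tailProfile_pos hB _ _).le] at he
  have he2 := congrArg (fun z => z ^ (2 * μ)) he
  simp only [tailProfile_rpow hB] at he2
  rw [div_self (by positivity), Real.rpow_one, Real.rpow_one, ampPow, ampPow] at he2
  have hx0' : (0 : ℝ) < x := hx0
  have t1 : 0 < Real.tanh (μ * √ω * (x + y₁)) := by
    rw [← Real.tanh_zero]
    exact strictMono_tanh (by positivity)
  have t2 : Real.tanh (μ * √ω * (x + y₁)) < Real.tanh (μ * √ω * (x + y₂)) :=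
    strictMono_tanh (mul_lt_mul_of_pos_left (by linarith) (by positivity))
  have := mul_left_cancel₀ hB.ne' he2
  nlinarith

/-- The inverses `1/t₁` and `1/t₂` have mean `A`, and `d` is half their difference; the matching
equation then says that the log ratio is zero. -/
theorem SolvesSystem.logRatio_eq_zero {t₁ t₂ : ℝ} (h : SolvesSystem γ μ ω t₁ t₂) {A : ℝ}
    (hAe : 2 * A = γ * √ω) :
    ∃ d ∈ Ioo 0 (A - 1), logRatio μ A d = 0 ∧ t₁ = (A + d)⁻¹ ∧ t₂ = (A - d)⁻¹ := by
  obtain ⟨h1, h12, h2, hm, hs⟩ := h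
  have h2' : 0 < t₂ := h1.trans h12
  rw [← hAe] at hs
  have i1 : t₂⁻¹ < t₁⁻¹ := (inv_lt_inv₀ h2' h1).2 h12
  have i2 : 1 < t₂⁻¹ := (one_lt_inv₀ h2').2 h2
  have e1 : A + (t₁⁻¹ - t₂⁻¹) / 2 = t₁⁻¹ := by linarith
  have e2 : A - (t₁⁻¹ - t₂⁻¹) / 2 = t₂⁻¹ := by linarith
  refine ⟨(t₁⁻¹ - t₂⁻¹) / 2, ⟨by linarith, by linarith⟩, ?_, ?_, ?_⟩
  · rw [logRatio_eq_zero_iff (by rw [e1]; linarith) (by rw [e2]; linarith), e1, e2, inv_inv,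
      inv_inv]
    exact hm
  · rw [e1, inv_inv]
  · rw [e2, inv_inv]

theorem solvesSystem_of_logRatio_eq_zero {A d : ℝ} (hAe : 2 * A = γ * √ω)
    (hd : d ∈ Ioo 0 (A - 1)) (hz : logRatio μ A d = 0) :
    SolvesSystem γ μ ω (A + d)⁻¹ (A - d)⁻¹ := by
  have h1 : 1 < A + d := by linarith [hd.1, hd.2]
  have h2 : 1 < A - d := by linarith [hd.2]
  refine ⟨by positivity, (inv_lt_inv₀ (by linarith) (by linarith)).2 (by linarith [hd.1]),
    inv_lt_one_of_one_lt₀ h2, (logRatio_eq_zero_iff h1 h2).1 hz, ?_⟩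
  rw [inv_inv, inv_inv, ← hAe]
  ring

theorem logRatio_zero_unique {A d d' : ℝ} (hA : 1 < A) (hd : d ∈ Ioo 0 (A - 1))
    (hd' : d' ∈ Ioo 0 (A - 1)) (hz : logRatio μ A d = 0) (hz' : logRatio μ A d' = 0) : d = d' := by
  have hs := logRatio_sign_of_zero hA hd hz
  rcases lt_trichotomy d d' with h | h | h
  · exact absurd hz' (hs.2 d' ⟨h, hd'.2⟩).ne'
  · exact h
  · exact absurd hz' (hs.1 d' ⟨hd'.1, h⟩).ne

end BoundStates

end DeltaPrimeNLS
end

/-! ### The theorem -/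

open DeltaPrimeNLS
theorem theorem5p3 (γ lam μ ω : ℝ) (hγ : 0 < γ) (hlam : 0 < lam) (hμ : 0 < μ) :
    (4 / γ ^ 2 < ω → ω ≤ omegaStar γ μ →
      ∀ y : ℝ, y = 1 / (2 * μ * √ω) * Real.log ((γ * √ω + 2) / (γ * √ω - 2)) →
        groundStates γ lam μ ω = phaseOrbit lam μ ω y (-y) ∧
        ∀ θ x : ℝ, x ≠ 0 →
          boundState lam μ ω y (-y) θ (-x) = -boundState lam μ ω y (-y) θ x) ∧
    (omegaStar γ μ < ω →
      (∃! t : ℝ × ℝ, SolvesSystem γ μ ω t.1 t.2) ∧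
      ∀ t₁ t₂ : ℝ, SolvesSystem γ μ ω t₁ t₂ →
        ∀ y₁ y₂ : ℝ, y₁ = centre μ ω t₁ → y₂ = centre μ ω t₂ →
          0 < y₁ ∧ y₁ < y₂ ∧
          groundStates γ lam μ ω =
            phaseOrbit lam μ ω y₁ (-y₂) ∪ phaseOrbit lam μ ω y₂ (-y₁) ∧
          Disjoint (phaseOrbit lam μ ω y₁ (-y₂)) (phaseOrbit lam μ ω y₂ (-y₁))) := by
  have hAe : 2 * (γ * √ω / 2) = γ * √ω := by ring
  have hsq : 0 < ω → (γ * √ω / 2) ^ 2 = γ ^ 2 * ω / 4 := fun hω => by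
    rw [div_pow, mul_pow, Real.sq_sqrt hω.le]
    norm_num
  have hgt : 0 < ω → 4 < γ ^ 2 * ω → 1 < γ * √ω / 2 := fun hω h => by
    have : 0 ≤ γ * √ω / 2 := by positivity
    nlinarith [hsq hω]
  constructor
  · intro hω0 hωs y hy
    have hω : 0 < ω := lt_trans (by positivity) hω0
    have hB : 0 < (μ + 1) * ω / lam := by positivity
    have hk : 0 < √ω := Real.sqrt_pos.2 hω
    have h4 : 4 < γ ^ 2 * ω := by
      rw [div_lt_iff₀ (by positivity)] at hω0
      linarith
    have hA := hgt hω h4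
    have hsub : μ * ((γ * √ω / 2) ^ 2 - 1) ≤ 1 := by
      rw [omegaStar, le_div_iff₀ (by positivity)] at hωs
      rw [hsq hω]
      linarith
    -- With `d₀ = 0` the matching condition is trivial and the two orbits coincide.
    have hg := groundStates_eq hγ hlam hμ hω (d₀ := 0) hAe le_rfl (by linarith)
      (by rw [add_zero, sub_zero]) (fun d hd hne =>
        splitMass_zero_lt hB hk hμ hA hsub hd fun h0 => hne (by rw [h0, abs_zero]))
    have hyc : centre μ ω (γ * √ω / 2)⁻¹ = y := by
      rw [hy, centre]
      have h2 : 0 < γ * √ω - 2 := by linarith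
      have e : (1 + (γ * √ω / 2)⁻¹) / (1 - (γ * √ω / 2)⁻¹) = (γ * √ω + 2) / (γ * √ω - 2) := by
        have : 0 < γ * √ω := by positivity
        rw [inv_div, one_add_div this.ne', one_sub_div this.ne',
          div_div_div_cancel_right₀ this.ne']
      rw [e, abs_of_pos (by positivity)]
    rw [add_zero, sub_zero, union_self, hyc] at hg
    exact ⟨hg, fun θ x hx => boundState_neg y hx⟩
  · intro hωs
    have hω : 0 < ω := lt_trans (by unfold omegaStar; positivity) hωs
    have hB : 0 < (μ + 1) * ω / lam := by positivity
    have hk : 0 < √ω := Real.sqrt_pos.2 hω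
    have hsup : 1 < μ * ((γ * √ω / 2) ^ 2 - 1) := by
      rw [omegaStar, div_lt_iff₀ (by positivity)] at hωs
      rw [hsq hω]
      linarith
    -- The supercritical condition already implies `ω > 4/γ²`.
    have hA : 1 < γ * √ω / 2 := by
      refine hgt hω ?_
      rw [hsq hω] at hsup
      by_contra hcon
      nlinarith
    obtain ⟨d₀, hd₀, hz⟩ := exists_logRatio_eq_zero hA hsup
    have hkey : ∀ t₁ t₂, SolvesSystem γ μ ω t₁ t₂ →
        t₁ = (γ * √ω / 2 + d₀)⁻¹ ∧ t₂ = (γ * √ω / 2 - d₀)⁻¹ := by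
      intro t₁ t₂ ht
      obtain ⟨d, hd, hdz, e1, e2⟩ := ht.logRatio_eq_zero hAe
      rw [logRatio_zero_unique hA hd₀ hd hz hdz]
      exact ⟨e1, e2⟩
    have hsol := solvesSystem_of_logRatio_eq_zero hAe hd₀ hz
    refine ⟨⟨⟨_, _⟩, hsol, fun t ht => ?_⟩, ?_⟩
    · exact Prod.ext (hkey _ _ ht).1 (hkey _ _ ht).2
    · rintro t₁ t₂ ht y₁ y₂ rfl rfl
      have hc₁ := centre_pos hμ hω ht.1 (ht.2.1.trans ht.2.2.1)
      have hc₂ := centre_lt_centre hμ hω ht.1 ht.2.1 ht.2.2.1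
      obtain ⟨rfl, rfl⟩ := hkey t₁ t₂ ht
      exact ⟨hc₁, hc₂, groundStates_eq hγ hlam hμ hω hAe hd₀.1.le hd₀.2
        ((logRatio_eq_zero_iff (by linarith [hd₀.1]) (by linarith [hd₀.2])).1 hz)
        (fun d hd hne => splitMass_lt_of_logRatio_eq_zero hB hk hμ hA hd₀ hz hd hne),
        disjoint_phaseOrbit hlam hμ hω hc₁ hc₂⟩
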